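/- **Theorem 3.2.** Let $n\ge 1$, $p\ge 0$ be integers. *Setting.* Let $T\subset\mathbb R^n$ be an $n$-simplex (the interior of the convex hull of $n+1$ affinely independent vertices), $\mathcal F_T$ the set of its $n+1$ faces, $h_T=\operatorname{diam}(T)$; $|\cdot|$ denotes volume and $(n-1)$-dimensional surface measure, $(\cdot,\cdot)_T$, $\langle\cdot,\cdot\rangle_F$ and $\langle\cdot,\cdot\rangle_{\partial T}$ the inner products of $L^2(T)$, $L^2(F)$, $L^2(\partial T)$, $\|\cdot\|_T$ the norm of $L^2(T)$ (also for vector fields). Boundary values of $v\in H^1(T)$ are understood as traces in $L^2(\partial T)$. $P^q(T)$, $P^q(F)$ are the polynomials of total degree at most $q$ on $T$ and on a face $F$, and $P^q(\mathcal F_T)\subset L^2(\partial T)$ are the face-wise polynomials of degree at most $q$. For a vertex $z$ let $\eta_z\in P^1(T)$ be the affine function with value $1$ at $z$ and $0$ at the other vertices; put $\eta_F=\prod_{z\text{ vertex of }F}\eta_z$ and $\eta_T=\prod_{z\text{ vertex of }T}\eta_z$. For each face $F$ choose $\widetilde\chi_{F,j}\in P^p(T)$, $1\le j\le\dim P^p(F)$,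 whose restrictions to $F$ form a basis of $P^p(F)$, and choose a basis $\widetilde\chi_{T,j}$, $1\le j\le \dim P^p(T)$, of $P^p(T)$. Put $\eta_{F,j}=\eta_F\widetilde\chi_{F,j}$ and $\eta_{T,j}=\eta_T\widetilde\chi_{T,j}$. Let $\chi_{F,j}\in P^p(\mathcal F_T)$ vanish on all faces other than $F$ and satisfy $\langle\chi_{F,j},\eta_{F,k}\rangle_F=\delta_{jk}|F|$, and let $\chi_{T,j}\in P^p(T)$ satisfy $(\chi_{T,j},\eta_{T,k})_T=\delta_{jk}|T|$. For $v\in H^1(T)$, with $\Pi^0_Tv$ the mean value of $v$ on $T$, define $$\widetilde\Pi v=\Pi_T^0v+\sum_{F\in\mathcal F_T}\sum_{j}\frac{\langle\chi_{F,j},(1-\Pi_T^0)v\rangle_F}{\langle\chi_{F,j},\eta_{F,j}\rangle_F}\,\eta_{F,j},\qquad \Pi v=\widetilde\Pi v+\sum_j\frac{(\chi_{T,j},(1-\widetilde\Pi)v)_T}{(\chi_{T,j},\eta_{T,j})_T}\,\eta_{T,j}.$$ *Qualitative properties.* For every $T$ and every choice of the bases $\widetilde\chi_{F,j},\widetilde\chi_{T,j}$,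 the functions $\chi_{F,j},\chi_{T,j}$ exist. For all $v\in H^1(T)$, $v$ has a trace in $L^2(\partial T)$, $$\Pi v\in V:=P^0(T)+\operatorname{span}\{\eta_{F,j}\}_{F,j}+\operatorname{span}\{\eta_{T,j}\}_j\subset H^1(T),$$ $$\langle\tau,v-\Pi v\rangle_{\partial T}=0\quad\forall\tau\in P^p(\mathcal F_T),\qquad (u,v-\Pi v)_T=0\quad\forall u\in P^p(T),$$ and $\Pi c=c$ for every constant $c\in P^0(T)$. *Estimates.* Let $\sigma>0$. There is a constant $C>0$ depending only on $n,p,\sigma$ such that, for every simplex $T$ that contains a ball of some radius $r>0$ with $h_T\le\sigma r$, and for every choice of the bases $\widetilde\chi_{F,j},\widetilde\chi_{T,j}$ as above, for all $v\in H^1(T)$, $$\|\Pi v\|_T\le C(\|v\|_T+h_T\|\nabla v\|_T),\qquad \|\nabla\Pi v\|_T\le C\|\nabla v\|_T,\qquad \|(1-\Pi)v\|_T\le C\,h_T\|\nabla v\|_T .$$ Consequently, given also $K>0$, there is $C'>0$ depending only on $n,p,\sigma,K$ such that, for all such $T$ and bases and all $\alpha>0$ with $h_T\le K\alpha$, the norm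 $\|v\|_{T,\alpha}:=(\|v\|_T^2+\alpha^2\|\nabla v\|_T^2)^{1/2}$ satisfies $\|\Pi v\|_{T,\alpha}\le C'\|v\|_{T,\alpha}$ for all $v\in H^1(T)$. -/

import Mathlib

open MeasureTheory Set Filter Topology
open scoped ContDiff

noncomputable section

namespace Fortin

/-- The Euclidean space `ℝⁿ`. -/
abbrev E (n : ℕ) : Type := EuclideanSpace ℝ (Fin n)

/-! ### Sobolev functions -/

/-- `g` is the weak gradient on `Ω` of the function `v`, both being square integrable on `Ω`:
`∫_Ω v ∂_i φ = - ∫_Ω g_i φ` for all test functions `φ ∈ C_c^∞(Ω)` and all `i`. -/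
structure IsWeakGrad {n : ℕ} (Ω : Set (E n)) (v : E n → ℝ) (g : E n → E n) : Prop where
  memLp_fun : MemLp v 2 (volume.restrict Ω)
  memLp_grad : MemLp g 2 (volume.restrict Ω)
  integral_eq : ∀ φ : E n → ℝ, ContDiff ℝ ∞ φ → HasCompactSupport φ → tsupport φ ⊆ Ω →
    ∀ i : Fin n, ∫ x in Ω, v x * fderiv ℝ φ x (EuclideanSpace.single i 1)
      = - ∫ x in Ω, g x i * φ x

/-- `v` belongs to `H¹(Ω)`. -/
def MemH1 {n : ℕ} (Ω : Set (E n)) (v : E n → ℝ) : Prop := ∃ g, IsWeakGrad Ω v g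

open Classical in
/-- The weak gradient `∇v` of `v ∈ H¹(Ω)` (determined up to null sets of `Ω`). -/
def weakGrad {n : ℕ} (Ω : Set (E n)) (v : E n → ℝ) : E n → E n :=
  if h : MemH1 Ω v then h.choose else 0

/-- The norm of `L²(μ)`, for scalar and for vector valued functions. -/
def normL2 {X F : Type*} [MeasurableSpace X] [NormedAddCommGroup F] (μ : Measure X)
    (f : X → F) : ℝ := (eLpNorm f 2 μ).toReal

/-! ### Polynomials -/

/-- The polynomial functions on `ℝⁿ` of (total) degree at most `q`. Polynomials on the open
nonempty set `T` are identified with polynomial functions on `ℝⁿ`. -/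
def polyFun (n q : ℕ) : Submodule ℝ (E n → ℝ) :=
  (MvPolynomial.restrictTotalDegree (Fin n) ℝ q).map
    (LinearMap.pi fun x : E n => (MvPolynomial.aeval fun i => x i).toLinearMap)

/-- Restriction of functions to a set. -/
def restrictTo {n : ℕ} (S : Set (E n)) : (E n → ℝ) →ₗ[ℝ] (S → ℝ) :=
  LinearMap.funLeft ℝ ℝ Subtype.val

/-- `P^q(S)`: the restrictions to `S` of the polynomials of degree at most `q`. -/
def polyOn {n : ℕ} (q : ℕ) (S : Set (E n)) : Submodule ℝ (S → ℝ) :=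
  (polyFun n q).map (restrictTo S)

/-! ### The simplex, its faces, and bubble functions

A simplex is given by its `n + 1` affinely independent vertices `T.points i`. The index `i` also
labels the face opposite to the vertex `T.points i`. -/

variable {n : ℕ}

/-- The open element: the interior of the convex hull of the vertices. -/
def elem (T : Affine.Simplex ℝ (E n) n) : Set (E n) :=
  interior (convexHull ℝ (range T.points))

/-- The face opposite to the vertex `i`. -/
def face (T : Affine.Simplex ℝ (E n) n) (i : Fin (n + 1)) : Set (E n) :=
  convexHull ℝ (T.points '' {i}ᶜ)

/-- The boundary `∂T`, the union of the `n + 1` faces. -/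
def bdry (T : Affine.Simplex ℝ (E n) n) : Set (E n) := ⋃ i, face T i

/-- The diameter `h_T`. -/
def size (T : Affine.Simplex ℝ (E n) n) : ℝ := Metric.diam (elem T)

/-- Shape regularity with parameter `σ`: the diameter is at most `σ` times the radius of some ball
inscribed in the element. -/
def ShapeRegular (σ : ℝ) (T : Affine.Simplex ℝ (E n) n) : Prop :=
  ∃ x r, 0 < r ∧ Metric.ball x r ⊆ elem T ∧ size T ≤ σ * r

/-- Lebesgue measure on the element. -/
def vol (T : Affine.Simplex ℝ (E n) n) : Measure (E n) := volume.restrict (elem T)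

/-- Surface measure on a subset `S` of `∂T`: the `(n-1)`-dimensional Hausdorff measure, normalized
so that it is Lebesgue measure on `(n-1)`-dimensional Euclidean spaces. -/
def surf (S : Set (E n)) : Measure (E n) :=
  (Measure.euclideanHausdorffMeasure (n - 1)).restrict S

/-- The vertices as an affine basis of `ℝⁿ`. -/
def affBasis (T : Affine.Simplex ℝ (E n) n) : AffineBasis (Fin (n + 1)) ℝ (E n) :=
  ⟨T.points, T.independent, T.span_eq_top (by simp)⟩

/-- The canonical basis function `η_z ∈ P¹(T)` of the vertex `z = T.points i`: the affine function
that is `1` at this vertex and `0` at the others. -/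
def etaV (T : Affine.Simplex ℝ (E n) n) (i : Fin (n + 1)) (x : E n) : ℝ := (affBasis T).coord i x

/-- The face bubble function `η_F`, the product of `η_z` over the vertices `z` of the face
opposite to the vertex `i`. -/
def etaF (T : Affine.Simplex ℝ (E n) n) (i : Fin (n + 1)) (x : E n) : ℝ :=
  ∏ k ∈ Finset.univ.erase i, etaV T k x

/-- The element bubble function `η_T`, the product of `η_z` over all vertices. -/
def etaT (T : Affine.Simplex ℝ (E n) n) (x : E n) : ℝ := ∏ k, etaV T k x

/-- Face-wise polynomials `P^q(𝓕_T)` on the boundary (up to null sets). -/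
def FacewisePoly (T : Affine.Simplex ℝ (E n) n) (q : ℕ) (τ : E n → ℝ) : Prop :=
  ∀ i, ∃ P ∈ polyFun n q, τ =ᵐ[surf (face T i)] P

/-! ### Traces -/

/-- `w` is the trace on `∂T` of `v ∈ H¹(T)`: there are smooth functions which converge to `v` in
`H¹(T)` and whose restrictions to `∂T` converge to `w` in `L²(∂T)`. -/
def IsTrace (T : Affine.Simplex ℝ (E n) n) (v w : E n → ℝ) : Prop :=
  MemH1 (elem T) v ∧ MemLp w 2 (surf (bdry T)) ∧
  ∃ φ : ℕ → E n → ℝ, (∀ k, ContDiff ℝ ∞ (φ k)) ∧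
    Tendsto (fun k => eLpNorm (fun x => φ k x - v x) 2 (vol T)) atTop (𝓝 0) ∧
    Tendsto (fun k => eLpNorm (fun x => gradient (φ k) x - weakGrad (elem T) v x) 2 (vol T))
      atTop (𝓝 0) ∧
    Tendsto (fun k => eLpNorm (fun x => φ k x - w x) 2 (surf (bdry T))) atTop (𝓝 0)

open Classical in
/-- The trace of `v ∈ H¹(T)` on `∂T` (determined up to null sets of `∂T`). -/
def trace (T : Affine.Simplex ℝ (E n) n) (v : E n → ℝ) : E n → ℝ :=
  if h : ∃ w, IsTrace T v w then h.choose else 0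

/-! ### Higher order bases -/

/-- The number `dim P^p(F)` for the face `F` opposite to the vertex `i`. -/
abbrev dimFace (T : Affine.Simplex ℝ (E n) n) (p : ℕ) (i : Fin (n + 1)) : ℕ :=
  Module.finrank ℝ (polyOn p (face T i))

/-- The number `dim P^p(T)`. -/
abbrev dimElem (T : Affine.Simplex ℝ (E n) n) (p : ℕ) : ℕ :=
  Module.finrank ℝ (polyOn p (elem T))

/-- A choice of the bases `χ̃_{F,j}`, `χ̃_{T,j}`: polynomials `tchiF i j ∈ P^p(T)` whose restrictions
to the face `i` form a basis of `P^p(F)`, and polynomials `tchiT j` that form a basis of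
`P^p(T)`. -/
structure Bases (T : Affine.Simplex ℝ (E n) n) (p : ℕ) where
  tchiF : ∀ i : Fin (n + 1), Fin (dimFace T p i) → E n → ℝ
  tchiF_mem : ∀ i j, tchiF i j ∈ polyFun n p
  tchiF_indep : ∀ i, LinearIndependent ℝ fun j => restrictTo (face T i) (tchiF i j)
  tchiF_span : ∀ i,
    Submodule.span ℝ (range fun j => restrictTo (face T i) (tchiF i j)) = polyOn p (face T i)
  tchiT : Fin (dimElem T p) → E n → ℝ
  tchiT_mem : ∀ j, tchiT j ∈ polyFun n p
  tchiT_indep : LinearIndependent ℝ fun j => restrictTo (elem T) (tchiT j)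
  tchiT_span :
    Submodule.span ℝ (range fun j => restrictTo (elem T) (tchiT j)) = polyOn p (elem T)

namespace Bases

variable {T : Affine.Simplex ℝ (E n) n} {p : ℕ}

/-- The face bubbles `η_{F,j} = η_F χ̃_{F,j}`. -/
def etaFj (B : Bases T p) (i : Fin (n + 1)) (j : Fin (dimFace T p i)) (x : E n) : ℝ :=
  etaF T i x * B.tchiF i j x

/-- The element bubbles `η_{T,j} = η_T χ̃_{T,j}`. -/
def etaTj (B : Bases T p) (j : Fin (dimElem T p)) (x : E n) : ℝ := etaT T x * B.tchiT j x

/-- The discrete space `P⁰(T) + span {η_{F,j}} + span {η_{T,j}}`. -/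
def space (B : Bases T p) : Submodule ℝ (E n → ℝ) :=
  polyFun n 0 ⊔ Submodule.span ℝ {f | ∃ i j, f = B.etaFj i j} ⊔ Submodule.span ℝ (range B.etaTj)

end Bases

/-- The dual functions: `χ_{F,j}`, a polynomial of degree at most `p` on the face `F` (and zero on
the other faces), with `⟨χ_{F,j}, η_{F,k}⟩_F = δ_{jk} |F|`, and `χ_{T,j} ∈ P^p(T)` with
`(χ_{T,j}, η_{T,k})_T = δ_{jk} |T|`. The values of `chiF i j` are only used on the face `i`. -/
structure DualBases {T : Affine.Simplex ℝ (E n) n} {p : ℕ} (B : Bases T p) where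
  chiF : ∀ i : Fin (n + 1), Fin (dimFace T p i) → E n → ℝ
  chiF_mem : ∀ i j, chiF i j ∈ polyFun n p
  chiF_dual : ∀ i j k,
    ∫ x, chiF i j x * B.etaFj i k x ∂surf (face T i)
      = if j = k then (surf (face T i)).real univ else 0
  chiT : Fin (dimElem T p) → E n → ℝ
  chiT_mem : ∀ j, chiT j ∈ polyFun n p
  chiT_dual : ∀ j k,
    ∫ x, chiT j x * B.etaTj k x ∂vol T = if j = k then (vol T).real univ else 0

/-! ### The operators -/

/-- The `L²(T)`-orthogonal projection onto the constants: the mean value. -/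
def proj0 (T : Affine.Simplex ℝ (E n) n) (v : E n → ℝ) : E n → ℝ := fun _ => ⨍ x, v x ∂vol T

section Operators

variable {T : Affine.Simplex ℝ (E n) n} {p : ℕ} {B : Bases T p}

/-- The auxiliary operator that only uses the face bubbles. -/
def PiTilde (D : DualBases B) (v : E n → ℝ) : E n → ℝ := fun x =>
  proj0 T v x + ∑ i, ∑ j,
    (∫ y, D.chiF i j y * trace T (v - proj0 T v) y ∂surf (face T i)) /
      (∫ y, D.chiF i j y * B.etaFj i j y ∂surf (face T i)) * B.etaFj i j x

/-- The Fortin operator `Π_{F,hp}^∇`. -/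
def Pi (D : DualBases B) (v : E n → ℝ) : E n → ℝ := fun x =>
  PiTilde D v x + ∑ j,
    (∫ y, D.chiT j y * (v - PiTilde D v) y ∂vol T) /
      (∫ y, D.chiT j y * B.etaTj j y ∂vol T) * B.etaTj j x

end Operators

/-- The norm `(‖v‖_T² + α² ‖∇v‖_T²)^{1/2}`. -/
def normAlpha (T : Affine.Simplex ℝ (E n) n) (α : ℝ) (v : E n → ℝ) : ℝ :=
  Real.sqrt (normL2 (vol T) v ^ 2 + α ^ 2 * normL2 (vol T) (weakGrad (elem T) v) ^ 2)

end Fortin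

end

/-! Subtracting the mean of v from Πv leaves an element of the space of bubble functions ∑_F η_F q_F
+ η_T r with polynomials q_F, r of degree at most p (`Pi_sub_mean_mem`). This space does not depend
on the chosen bases, and its elements are determined by their moments against P^p on the faces and
on T (`bubble_eq_zero`). Indeed, on a face F such a function reduces to η_F q_F. If its face moments
vanish, testing with q_F gives ∫_F η_F q_F² = 0, so q_F vanishes on the hyperplane of F and is a
multiple of η_z, where z is the vertex opposite to F. As η_z η_F = η_T, the whole function is η_T
times a polynomial of degree at most p, and testing with that polynomial shows that it is zero.

The same positivity makes the weighted Gram matrices invertible, which gives the dual functions. By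
duality the face corrections reproduce the face moments of v, because no other bubble is visible on
F. The element corrections reproduce the moments on T and vanish on the boundary. Hence Πv minus the
mean of v is the only bubble function with the moments of v minus its mean. This makes Πv
independent of the bases and reproduces constants.

On one fixed simplex, unique solvability in finite dimension bounds a bubble function by the L²
norms on ∂T and T of any data with the same moments (`exists_bubble_stability`). For data φ minus
its mean, the trace and Poincaré inequalities bound these norms by ‖∇φ‖. The dependence on T is then
made explicit by an affine map Φ from a reference simplex (`exists_uniform_bubble_estimate`).
Pullback by Φ preserves bubble functions, means and vanishing moments, the volume factors cancel,
and ‖DΦ‖ ≤ C h_T, ‖DΦ⁻¹‖ ≤ C / r. This yields the factors C h_T and C h_T / r ≤ C σ.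

All this is done for smooth functions. They are dense in H¹ of a convex open set, by dilation
towards an interior point followed by mollification (`exists_smooth_close`). Together with the trace
inequality, density gives existence and uniqueness of traces. The moment bound shows that Π is
continuous along the approximating sequence (`exists_seq_tendsto_Pi`), so the estimates pass to the
limit. -/

noncomputable section

namespace Fortin

/-! ### Polynomial functions -/

section Polynomials

variable {n : ℕ}

theorem mem_polyFun_iff {m : ℕ} {q : E n → ℝ} :
    q ∈ polyFun n m ↔ ∃ P : MvPolynomial (Fin n) ℝ, P.totalDegree ≤ m ∧
      q = fun x => MvPolynomial.eval (fun i => x i) P := by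
  constructor
  · rintro ⟨P, hP, rfl⟩
    exact ⟨P, (MvPolynomial.mem_restrictTotalDegree _ _ _).1 hP, by
      ext x; simp [MvPolynomial.aeval_eq_eval]⟩
  · rintro ⟨P, hP, rfl⟩
    exact ⟨P, (MvPolynomial.mem_restrictTotalDegree _ _ _).2 hP, by
      ext x; simp [MvPolynomial.aeval_eq_eval]⟩

instance (m : ℕ) : Module.Finite ℝ (polyFun n m) := by
  unfold polyFun; infer_instance

theorem polyFun_mono {a b : ℕ} (h : a ≤ b) : polyFun n a ≤ polyFun n b := by
  intro q hq
  obtain ⟨P, hP, rfl⟩ := mem_polyFun_iff.1 hq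
  exact mem_polyFun_iff.2 ⟨P, hP.trans h, rfl⟩

theorem const_mem_polyFun (m : ℕ) (c : ℝ) : (fun _ => c) ∈ polyFun n m :=
  mem_polyFun_iff.2 ⟨MvPolynomial.C c, by simp, by simp⟩

theorem coord_mem_polyFun (i : Fin n) : (fun x : E n => x i) ∈ polyFun n 1 :=
  mem_polyFun_iff.2 ⟨MvPolynomial.X i, by simp [MvPolynomial.totalDegree_X], by simp⟩

theorem mul_mem_polyFun {a b : ℕ} {q r : E n → ℝ} (hq : q ∈ polyFun n a) (hr : r ∈ polyFun n b) :
    (fun x => q x * r x) ∈ polyFun n (a + b) := by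
  obtain ⟨P, hP, rfl⟩ := mem_polyFun_iff.1 hq
  obtain ⟨Q, hQ, rfl⟩ := mem_polyFun_iff.1 hr
  exact mem_polyFun_iff.2 ⟨P * Q, (MvPolynomial.totalDegree_mul _ _).trans (by omega), by simp⟩

/-- Induction on polynomial functions, building them from constants by addition and by
multiplication with coordinates. -/
theorem polyFun_induction {motive : ℕ → (E n → ℝ) → Prop}
    (const : ∀ c : ℝ, motive 0 fun _ => c)
    (add : ∀ m f g, motive m f → motive m g → motive m (fun x => f x + g x))
    (mono : ∀ m f, motive m f → motive (m + 1) f)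
    (coord_mul : ∀ m (i : Fin n) f, f ∈ polyFun n m → motive m f →
      motive (m + 1) (fun x => x i * f x))
    {m : ℕ} {q : E n → ℝ} (hq : q ∈ polyFun n m) : motive m q := by
  have mono' : ∀ a b f, a ≤ b → motive a f → motive b f := by
    intro a b f hab hf
    induction hab with
    | refl => exact hf
    | step _ ih => exact mono _ _ ih
  -- Monomials are treated by induction on their exact degree: splitting off one coordinate lowers
  -- it by one, matching `coord_mul`.
  have mon : ∀ k, ∀ s : Fin n →₀ ℕ, (s.sum fun _ e => e) = k → ∀ c : ℝ,
      motive k fun x => MvPolynomial.eval (fun i => x i) (MvPolynomial.monomial s c) := by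
    intro k
    induction k with
    | zero =>
      intro s hs c
      have : s = 0 := by
        ext i
        by_contra h
        have := (Finset.sum_eq_zero_iff.1 hs) i (by simpa using h)
        exact h (by simpa using this)
      subst this
      simpa using const c
    | succ k ih =>
      intro s hs c
      obtain ⟨i, hi⟩ : ∃ i, s i ≠ 0 := by
        by_contra! h
        have : s = 0 := by ext i; simp [h i]
        subst this
        simp at hs
      have e : s = Finsupp.single i 1 + (s - Finsupp.single i 1) := by
        rw [add_comm, Finsupp.sub_add_single_one_cancel hi]
      have hs' : ((s - Finsupp.single i 1).sum fun _ e => e) = k := by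
        rw [e, Finsupp.sum_add_index' (by simp) (by simp)] at hs
        simp at hs; omega
      have := coord_mul k i _ (mem_polyFun_iff.2 ⟨MvPolynomial.monomial (s - Finsupp.single i 1) c,
        (MvPolynomial.totalDegree_monomial_le _ _).trans hs'.le, rfl⟩) (ih _ hs' c)
      rw [e, MvPolynomial.monomial_single_add]
      simpa using this
  obtain ⟨P, hP, rfl⟩ := mem_polyFun_iff.1 hq
  have key : ∀ S : Finset (Fin n →₀ ℕ), S ⊆ P.support → motive m fun x =>
      MvPolynomial.eval (fun i => x i) (∑ s ∈ S, MvPolynomial.monomial s (P.coeff s)) := by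
    intro S
    induction S using Finset.induction_on with
    | empty => intro _; simpa using mono' 0 m _ (by omega) (const 0)
    | insert s S hs ih =>
      intro h
      rw [Finset.insert_subset_iff] at h
      rw [Finset.sum_insert hs]
      simp only [map_add]
      exact add _ _ _ (mono' _ m _ ((MvPolynomial.le_totalDegree h.1).trans hP) (mon _ s rfl _))
        (ih h.2)
  have := key _ subset_rfl
  rwa [MvPolynomial.support_sum_monomial_coeff] at this

theorem contDiff_of_mem_polyFun {m : ℕ} {q : E n → ℝ} (hq : q ∈ polyFun n m) :
    ContDiff ℝ ∞ q := by
  refine polyFun_induction (motive := fun _ q => ContDiff ℝ ∞ q) (fun c => contDiff_const)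
    (fun _ f g hf hg => hf.add hg) (fun _ f hf => hf) (fun m i f _ hf => ?_) hq
  exact ContDiff.mul (by fun_prop) hf

theorem affine_mem_polyFun (f : E n →ᵃ[ℝ] ℝ) : (fun x => f x) ∈ polyFun n 1 := by
  have : (fun x => f x) = (∑ i, f.linear (EuclideanSpace.single i 1) • fun x : E n => x i)
      + fun _ => f 0 := by
    ext x
    have h1 := f.map_vadd 0 x
    simp only [vadd_eq_add, add_zero] at h1
    rw [h1]
    have h2 : x = ∑ i, x i • EuclideanSpace.single i (1 : ℝ) := by
      ext j; simp [Finset.sum_apply, Pi.single_apply]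
    conv_lhs => rw [h2]
    simp [Finset.sum_apply, mul_comm]
  rw [this]
  exact add_mem (sum_mem fun i _ => Submodule.smul_mem _ _ (coord_mem_polyFun i))
    (const_mem_polyFun 1 _)

theorem comp_affine_mem_polyFun {m : ℕ} {q : E n → ℝ} (hq : q ∈ polyFun n m)
    (A : E n →ᵃ[ℝ] E n) : (fun x => q (A x)) ∈ polyFun n m := by
  refine polyFun_induction (motive := fun m q => (fun x => q (A x)) ∈ polyFun n m)
    (fun c => const_mem_polyFun 0 c) (fun _ f g hf hg => add_mem hf hg)
    (fun _ f hf => polyFun_mono (by omega) hf) (fun m i f _ hf => ?_) hq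
  have h1 : (fun x => A x i) ∈ polyFun n 1 :=
    affine_mem_polyFun ((EuclideanSpace.proj i : E n →L[ℝ] ℝ).toLinearMap.toAffineMap.comp A)
  rw [add_comm]
  exact mul_mem_polyFun h1 hf

/-- A polynomial that vanishes on the zero set of a nonconstant affine function is a multiple of
this function. -/
theorem exists_factor_of_vanish {m : ℕ} {q : E n → ℝ} (hq : q ∈ polyFun n m)
    (ℓ : E n →ᵃ[ℝ] ℝ) (d : E n) (hd : ℓ.linear d = 1) (h0 : ∀ x, ℓ x = 0 → q x = 0) :
    ∃ r ∈ polyFun n m, ∀ x, q x = ℓ x * r x := by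
  -- `A` is the projection along `d` onto the zero set of `ℓ`; it lands there because the linear
  -- part of `ℓ` is 1 on `d`.
  let A : E n →ᵃ[ℝ] E n := AffineMap.id ℝ (E n) - (LinearMap.toSpanSingleton ℝ (E n) d).toAffineMap.comp ℓ
  have hA : ∀ x, A x = x - ℓ x • d := fun x => by simp [A]
  -- The difference q - q ∘ A is divisible by `ℓ` for every polynomial. For a product, x_i f(x) - (A
  -- x)_i f(A x) = x_i (f(x) - f(A x)) + ℓ(x) d_i f(A x). The vanishing of q is used only
  -- afterwards, to remove q ∘ A.
  have key : ∃ r ∈ polyFun n m, ∀ x, q x - q (A x) = ℓ x * r x := by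
    refine polyFun_induction (motive := fun m q => ∃ r ∈ polyFun n m, ∀ x, q x - q (A x) = ℓ x * r x)
      (fun c => ⟨fun _ => 0, const_mem_polyFun 0 0, by simp⟩) ?_ ?_ ?_ hq
    · rintro m f g ⟨r, hr, h⟩ ⟨s, hs, h'⟩
      exact ⟨_, add_mem hr hs, fun x => by simp; linear_combination h x + h' x⟩
    · rintro m f ⟨r, hr, h⟩
      exact ⟨r, polyFun_mono (by omega) hr, h⟩
    · rintro m i f hf ⟨r, hr, h⟩
      refine ⟨(fun x => x i * r x) + d i • fun x => f (A x), add_mem ?_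
        (Submodule.smul_mem _ _ (polyFun_mono (by omega) (comp_affine_mem_polyFun hf A))), ?_⟩
      · rw [add_comm m]; exact mul_mem_polyFun (coord_mem_polyFun i) hr
      · intro x
        have : (A x) i = x i - ℓ x * d i := by rw [hA]; simp
        simp only [this, Pi.add_apply, Pi.smul_apply, smul_eq_mul]
        linear_combination (x i) * h x
  obtain ⟨r, hr, h⟩ := key
  refine ⟨r, hr, fun x => ?_⟩
  have : ℓ (A x) = 0 := by
    have := ℓ.map_vadd x (-(ℓ x • d))
    simp only [vadd_eq_add, map_neg, map_smul, hd] at this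
    rw [hA, sub_eq_neg_add, this]; simp
  have h1 := h x
  rw [h0 _ this] at h1
  simpa using h1

end Polynomials

/-! ### Barycentric coordinates on a simplex -/

section Simplex

variable {n : ℕ}

theorem etaV_vertex (T : Affine.Simplex ℝ (E n) n) (i j : Fin (n + 1)) :
    etaV T i (T.points j) = if i = j then 1 else 0 :=
  (affBasis T).coord_apply i j

theorem sum_etaV (T : Affine.Simplex ℝ (E n) n) (x : E n) : ∑ i, etaV T i x = 1 :=
  (affBasis T).sum_coord_apply_eq_one x

theorem sum_etaV_smul (T : Affine.Simplex ℝ (E n) n) (x : E n) :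
    ∑ i, etaV T i x • T.points i = x :=
  (affBasis T).linear_combination_coord_eq_self x

theorem etaV_mem_polyFun (T : Affine.Simplex ℝ (E n) n) (i : Fin (n + 1)) :
    etaV T i ∈ polyFun n 1 := affine_mem_polyFun _

theorem continuous_etaV (T : Affine.Simplex ℝ (E n) n) (i : Fin (n + 1)) :
    Continuous (etaV T i) := (contDiff_of_mem_polyFun (etaV_mem_polyFun T i)).continuous

theorem etaV_lineMap (T : Affine.Simplex ℝ (E n) n) (i : Fin (n + 1)) (x y : E n) (t : ℝ) :
    etaV T i (x + t • (y - x)) = (1 - t) * etaV T i x + t * etaV T i y := by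
  have := ((affBasis T).coord i).apply_lineMap x y t
  simp only [AffineMap.lineMap_apply, vsub_eq_sub, vadd_eq_add, smul_eq_mul] at this
  unfold etaV
  rw [add_comm x (t • (y - x)), this]; ring

theorem prod_mem_polyFun {ι : Type*} (s : Finset ι) (f : ι → E n → ℝ)
    (hf : ∀ i ∈ s, f i ∈ polyFun n 1) : (fun x => ∏ i ∈ s, f i x) ∈ polyFun n s.card := by
  classical
  induction s using Finset.induction_on with
  | empty => simpa using const_mem_polyFun 0 1
  | insert i s hi ih =>
    rw [Finset.card_insert_of_notMem hi, add_comm]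
    simp only [Finset.prod_insert hi]
    exact mul_mem_polyFun (hf i (by simp)) (ih fun j hj => hf j (by simp [hj]))

theorem etaF_mem_polyFun (T : Affine.Simplex ℝ (E n) n) (i : Fin (n + 1)) :
    etaF T i ∈ polyFun n n := by
  have := prod_mem_polyFun (Finset.univ.erase i) (etaV T) fun k _ => etaV_mem_polyFun T k
  rwa [Finset.card_erase_of_mem (Finset.mem_univ i), Finset.card_univ, Fintype.card_fin] at this

theorem etaT_mem_polyFun (T : Affine.Simplex ℝ (E n) n) : etaT T ∈ polyFun n (n + 1) := by
  have := prod_mem_polyFun Finset.univ (etaV T) fun k _ => etaV_mem_polyFun T k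
  rwa [Finset.card_univ, Fintype.card_fin] at this

theorem etaT_eq (T : Affine.Simplex ℝ (E n) n) (i : Fin (n + 1)) (x : E n) :
    etaT T x = etaV T i x * etaF T i x :=
  (Finset.mul_prod_erase _ (fun k => etaV T k x) (Finset.mem_univ i)).symm

theorem convexHull_eq (T : Affine.Simplex ℝ (E n) n) :
    convexHull ℝ (range T.points) = {x | ∀ i, 0 ≤ etaV T i x} :=
  (affBasis T).convexHull_eq_nonneg_coord

theorem elem_eq (T : Affine.Simplex ℝ (E n) n) : elem T = {x | ∀ i, 0 < etaV T i x} :=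
  (affBasis T).interior_convexHull

/-- Together with `elem_eq` this turns questions about the geometry of faces and elements into sign
conditions on barycentric coordinates. -/
theorem face_eq (T : Affine.Simplex ℝ (E n) n) (i : Fin (n + 1)) :
    face T i = {x | etaV T i x = 0 ∧ ∀ j, 0 ≤ etaV T j x} := by
  apply subset_antisymm
  · refine convexHull_min ?_ ?_
    · rintro _ ⟨j, hj, rfl⟩
      have hj : j ≠ i := hj
      refine ⟨by simp [etaV_vertex, hj.symm], fun k => ?_⟩
      rw [etaV_vertex]; split_ifs <;> norm_num
    · intro x hx y hy a b ha hb hab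
      have e : a • x + b • y = x + b • (y - x) := by
        rw [show a = 1 - b by linarith]; module
      simp only [mem_ofPred_eq] at *
      rw [e]
      refine ⟨by rw [etaV_lineMap, hx.1, hy.1]; ring, fun j => ?_⟩
      rw [etaV_lineMap, show 1 - b = a by linarith]
      have := hx.2 j; have := hy.2 j
      positivity
  · rintro x ⟨h0, h⟩
    have hs := sum_etaV T x
    rw [← Finset.add_sum_erase _ _ (Finset.mem_univ i), h0, zero_add] at hs
    rw [← sum_etaV_smul T x, ← Finset.add_sum_erase _ _ (Finset.mem_univ i), h0, zero_smul,
      zero_add]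
    refine (convex_convexHull ℝ _).sum_mem (fun j _ => h j) hs fun j hj => ?_
    exact subset_convexHull ℝ _ ⟨j, (Finset.mem_erase.1 hj).1, rfl⟩

theorem isOpen_elem (T : Affine.Simplex ℝ (E n) n) : IsOpen (elem T) := isOpen_interior

theorem convex_elem (T : Affine.Simplex ℝ (E n) n) : Convex ℝ (elem T) :=
  (convex_convexHull ℝ _).interior

theorem nonempty_elem (T : Affine.Simplex ℝ (E n) n) : (elem T).Nonempty :=
  ⟨_, (affBasis T).centroid_mem_interior_convexHull⟩

theorem isCompact_convexHull (T : Affine.Simplex ℝ (E n) n) :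
    IsCompact (convexHull ℝ (range T.points)) := (Set.finite_range _).isCompact_convexHull ℝ

theorem isBounded_elem (T : Affine.Simplex ℝ (E n) n) : Bornology.IsBounded (elem T) :=
  (isCompact_convexHull T).isBounded.subset interior_subset

theorem isCompact_face (T : Affine.Simplex ℝ (E n) n) (i : Fin (n + 1)) :
    IsCompact (face T i) := ((Set.toFinite _).image _).isCompact_convexHull ℝ

theorem isCompact_bdry (T : Affine.Simplex ℝ (E n) n) : IsCompact (bdry T) :=
  isCompact_iUnion fun i => isCompact_face T i

theorem face_subset_convexHull (T : Affine.Simplex ℝ (E n) n) (i : Fin (n + 1)) :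
    face T i ⊆ convexHull ℝ (range T.points) := convexHull_mono (image_subset_range _ _)

/-- The bubble of another face contains the factor that vanishes on this one. Hence the face
corrections do not interact. -/
theorem etaF_eq_zero_of_mem_face (T : Affine.Simplex ℝ (E n) n) {i k : Fin (n + 1)} (h : k ≠ i)
    {x : E n} (hx : x ∈ face T i) : etaF T k x = 0 := by
  rw [face_eq] at hx
  exact Finset.prod_eq_zero (Finset.mem_erase.2 ⟨h.symm, Finset.mem_univ i⟩) hx.1

theorem etaT_eq_zero_of_mem_face (T : Affine.Simplex ℝ (E n) n) {i : Fin (n + 1)}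
    {x : E n} (hx : x ∈ face T i) : etaT T x = 0 := by
  rw [face_eq] at hx
  rw [etaT_eq T i, hx.1, zero_mul]

theorem etaF_nonneg (T : Affine.Simplex ℝ (E n) n) {i k : Fin (n + 1)}
    {x : E n} (hx : x ∈ face T i) : 0 ≤ etaF T k x := by
  rw [face_eq] at hx
  exact Finset.prod_nonneg fun j _ => hx.2 j

theorem etaT_pos (T : Affine.Simplex ℝ (E n) n) {x : E n} (hx : x ∈ elem T) : 0 < etaT T x := by
  rw [elem_eq] at hx
  exact Finset.prod_pos fun j _ => hx j

/-- The restriction of Lebesgue measure does not see the boundary of the simplex. -/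
theorem vol_eq_restrict_convexHull (T : Affine.Simplex ℝ (E n) n) :
    vol T = volume.restrict (convexHull ℝ (range T.points)) :=
  Measure.restrict_congr_set
    (interior_ae_eq_of_null_frontier ((convex_convexHull ℝ _).addHaar_frontier volume))

instance (T : Affine.Simplex ℝ (E n) n) : IsFiniteMeasure (vol T) :=
  ⟨by rw [vol, Measure.restrict_apply_univ]; exact (isBounded_elem T).measure_lt_top⟩

theorem vol_univ_pos (T : Affine.Simplex ℝ (E n) n) : 0 < vol T univ := by
  rw [vol, Measure.restrict_apply_univ]
  exact (isOpen_elem T).measure_pos _ (nonempty_elem T)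

instance (T : Affine.Simplex ℝ (E n) n) : NeZero (vol T) :=
  ⟨fun h => (vol_univ_pos T).ne' (by simp [h])⟩

/-- The affine map between two simplices that maps vertices to vertices. -/
def simplexEquiv (S T : Affine.Simplex ℝ (E n) n) : E n ≃ᵃ[ℝ] E n :=
  (AffineEquiv.vaddConst ℝ (S.points 0)).symm.trans
    ((((affBasis S).basisOf 0).equiv ((affBasis T).basisOf 0)
      (Equiv.refl _)).toAffineEquiv.trans (AffineEquiv.vaddConst ℝ (T.points 0)))

theorem simplexEquiv_points (S T : Affine.Simplex ℝ (E n) n) (i : Fin (n + 1)) :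
    simplexEquiv S T (S.points i) = T.points i := by
  by_cases h : i = 0
  · subst h; simp [simplexEquiv]
  · have e : ∀ T : Affine.Simplex ℝ (E n) n,
        (affBasis T).basisOf 0 ⟨i, h⟩ = T.points i - T.points 0 := fun T => by
      rw [AffineBasis.basisOf_apply]; rfl
    simp only [simplexEquiv, AffineEquiv.trans_apply, AffineEquiv.vaddConst_symm_apply,
      vsub_eq_sub, ← e, LinearEquiv.coe_toAffineEquiv, Module.Basis.equiv_apply,
      Equiv.refl_apply, AffineEquiv.vaddConst_apply]
    rw [e]; simp

/-- Affine maps preserve the weights of affine combinations. Consequently elements, faces and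
bubbles of the two simplices correspond by mere composition. -/
theorem etaV_simplexEquiv (S T : Affine.Simplex ℝ (E n) n) (i : Fin (n + 1)) (x : E n) :
    etaV T i (simplexEquiv S T x) = etaV S i x := by
  have h := (affBasis S).affineCombination_coord_eq_self x
  have hs := (affBasis S).sum_coord_apply_eq_one x
  have h2 : simplexEquiv S T x = Finset.univ.affineCombination ℝ (affBasis T)
      (fun i => (affBasis S).coord i x) := by
    conv_lhs => rw [← h]
    rw [← AffineEquiv.coe_toAffineMap, Finset.map_affineCombination _ _ _ hs]
    have e : (simplexEquiv S T).toAffineMap ∘ affBasis S = affBasis T :=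
      funext fun j => simplexEquiv_points S T j
    rw [e]
  unfold etaV
  rw [h2, AffineBasis.coord_apply_combination_of_mem _ (Finset.mem_univ i) hs]

theorem preimage_elem (S T : Affine.Simplex ℝ (E n) n) :
    simplexEquiv S T ⁻¹' elem T = elem S := by
  ext x; simp [elem_eq, etaV_simplexEquiv]

theorem preimage_face (S T : Affine.Simplex ℝ (E n) n) (i : Fin (n + 1)) :
    simplexEquiv S T ⁻¹' face T i = face S i := by
  ext x; simp [face_eq, etaV_simplexEquiv]

theorem etaF_simplexEquiv (S T : Affine.Simplex ℝ (E n) n) (i : Fin (n + 1)) (x : E n) :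
    etaF T i (simplexEquiv S T x) = etaF S i x := by
  simp [etaF, etaV_simplexEquiv]

theorem etaT_simplexEquiv (S T : Affine.Simplex ℝ (E n) n) (x : E n) :
    etaT T (simplexEquiv S T x) = etaT S x := by
  simp [etaT, etaV_simplexEquiv]

end Simplex

/-! ### Surface measure on the faces -/

section Faces

variable {n : ℕ}

/-- The direction of the hyperplane that contains the face opposite to the vertex `i`. -/
def faceDir (T : Affine.Simplex ℝ (E n) n) (i : Fin (n + 1)) : Submodule ℝ (E n) :=
  LinearMap.ker ((affBasis T).coord i).linear

theorem etaV_add (T : Affine.Simplex ℝ (E n) n) (i : Fin (n + 1)) (x v : E n) :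
    etaV T i (x + v) = etaV T i x + ((affBasis T).coord i).linear v := by
  have := ((affBasis T).coord i).map_vadd x v
  simp only [vadd_eq_add] at this
  unfold etaV
  rw [add_comm x v, this, add_comm]

/-- The barycentre of the face has weight 1/n at each of its n vertices. It serves as a point of the
relative interior. -/
theorem exists_face_center (T : Affine.Simplex ℝ (E n) n) (hn : 1 ≤ n) (i : Fin (n + 1)) :
    ∃ y, etaV T i y = 0 ∧ ∀ j ≠ i, 0 < etaV T j y := by
  have hs : ∑ j : Fin (n + 1), (if j = i then (0 : ℝ) else (n : ℝ)⁻¹) = 1 := by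
    rw [Finset.sum_ite]
    simp [Finset.filter_ne', Finset.card_erase_of_mem]
    field_simp
  have h := fun j => (affBasis T).coord_apply_combination_of_mem (Finset.mem_univ j) hs
  refine ⟨_, (h i).trans (by simp), fun j hj => ?_⟩
  have := h j
  rw [if_neg hj] at this
  unfold etaV
  rw [this]; positivity

theorem finrank_faceDir (T : Affine.Simplex ℝ (E n) n) (hn : 1 ≤ n) (i : Fin (n + 1)) :
    Module.finrank ℝ (faceDir T i) = n - 1 := by
  have h0 : ((affBasis T).coord i).linear ≠ 0 := by
    intro h
    obtain ⟨y, hy, -⟩ := exists_face_center T hn i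
    have := etaV_add T i y (T.points i - y)
    rw [h, add_sub_cancel, etaV_vertex] at this
    simp [hy] at this
  have := Module.Dual.finrank_ker_add_one_of_ne_zero (f := ((affBasis T).coord i).linear) h0
  rw [finrank_euclideanSpace_fin] at this
  exact Nat.eq_sub_of_add_eq this

theorem isometry_add_faceDir (T : Affine.Simplex ℝ (E n) n) (i : Fin (n + 1)) (y : E n) :
    Isometry fun w : faceDir T i => y + w :=
  (isometry_add_left y).comp isometry_subtype_coe

theorem measurableEmbedding_add_faceDir (T : Affine.Simplex ℝ (E n) n) (i : Fin (n + 1))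
    (y : E n) : MeasurableEmbedding fun w : faceDir T i => y + w :=
  (isometry_add_faceDir T i y).isClosedEmbedding.measurableEmbedding

/-- Surface measure on a face is Lebesgue measure on the parallel linear space. -/
theorem surf_face_eq (T : Affine.Simplex ℝ (E n) n) (hn : 1 ≤ n) (i : Fin (n + 1)) {y : E n}
    (hy : etaV T i y = 0) :
    surf (face T i) = (Measure.map (fun w : faceDir T i => y + w) volume).restrict (face T i) := by
  -- The normalized Hausdorff measure is Lebesgue measure on a space of dimension n - 1, and
  -- isometries preserve it.
  rw [← InnerProductSpace.euclideanHausdorffMeasure_eq_volume, finrank_faceDir T hn,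
    (isometry_add_faceDir T i y).map_euclideanHausdorffMeasure,
    Measure.restrict_restrict (isCompact_face T i).measurableSet, surf]
  congr 1
  rw [inter_eq_left.2]
  intro x hx
  rw [face_eq] at hx
  refine ⟨⟨x - y, ?_⟩, by simp⟩
  have := etaV_add T i y (x - y)
  rw [add_sub_cancel, hx.1, hy] at this
  exact LinearMap.mem_ker.2 (by linarith)

theorem surf_face_eq_map (T : Affine.Simplex ℝ (E n) n) (hn : 1 ≤ n) (i : Fin (n + 1)) {y : E n}
    (hy : etaV T i y = 0) :
    surf (face T i) = Measure.map (fun w : faceDir T i => y + w)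
      (volume.restrict ((fun w : faceDir T i => y + w) ⁻¹' face T i)) := by
  rw [surf_face_eq T hn i hy, (measurableEmbedding_add_faceDir T i y).restrict_map]

theorem isFiniteMeasure_surf_face (T : Affine.Simplex ℝ (E n) n) (hn : 1 ≤ n) (i : Fin (n + 1)) :
    IsFiniteMeasure (surf (face T i)) := by
  obtain ⟨y, hy, -⟩ := exists_face_center T hn i
  rw [surf_face_eq_map T hn i hy]
  have : IsCompact ((fun w : faceDir T i => y + w) ⁻¹' face T i) :=
    (isometry_add_faceDir T i y).isClosedEmbedding.isCompact_preimage (isCompact_face T i)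
  have : IsFiniteMeasure (volume.restrict ((fun w : faceDir T i => y + w) ⁻¹' face T i)) :=
    ⟨by rw [Measure.restrict_apply_univ]; exact this.measure_lt_top⟩
  infer_instance

/-- A continuous function that vanishes almost everywhere on a face vanishes on the face. -/
theorem eq_zero_on_face (T : Affine.Simplex ℝ (E n) n) (hn : 1 ≤ n) (i : Fin (n + 1))
    {f : E n → ℝ} (hf : Continuous f) (h : f =ᵐ[surf (face T i)] 0) : ∀ x ∈ face T i, f x = 0 := by
  obtain ⟨y, hy, hy'⟩ := exists_face_center T hn i
  have hem := measurableEmbedding_add_faceDir T i y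
  rw [surf_face_eq_map T hn i hy, Filter.EventuallyEq, hem.ae_map_iff] at h
  -- `U` is the relative interior of the face. It is open in the parallel space, so there "almost
  -- everywhere" becomes "everywhere" by continuity.
  set U : Set (faceDir T i) := {w | ∀ j ≠ i, 0 < etaV T j (y + w)} with hU
  have hUo : IsOpen U := by
    have : U = ⋂ j, ⋂ (_ : j ≠ i), {w : faceDir T i | 0 < etaV T j (y + w)} := by ext; simp [hU]
    rw [this]
    refine isOpen_iInter_of_finite fun j => isOpen_iInter_of_finite fun _ => ?_
    exact isOpen_lt continuous_const ((continuous_etaV T j).comp (by fun_prop))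
  have hker : ∀ w : faceDir T i, etaV T i (y + w) = 0 := fun w => by
    rw [etaV_add, hy, LinearMap.mem_ker.1 w.2, add_zero]
  have hUF : U ⊆ (fun w : faceDir T i => y + w) ⁻¹' face T i := by
    intro w hw
    simp only [mem_preimage, face_eq, mem_ofPred_eq]
    refine ⟨hker w, fun j => ?_⟩
    by_cases hj : j = i
    · rw [hj, hker w]
    · exact (hw j hj).le
  have h1 : (fun w : faceDir T i => f (y + w)) =ᵐ[volume.restrict U] fun _ => 0 :=
    ae_mono (Measure.restrict_mono hUF le_rfl) h
  have h2 := Measure.eqOn_open_of_ae_eq h1 hUo (by fun_prop) (by fun_prop)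
  intro x hx
  rw [face_eq] at hx
  have hxy : x - y ∈ faceDir T i := by
    have := etaV_add T i y (x - y)
    rw [add_sub_cancel, hx.1, hy] at this
    exact LinearMap.mem_ker.2 (by linarith)
  -- Any point of the face is the limit of points on the segment from the barycentre, which are
  -- relatively interior.
  have h3 : ∀ t ∈ Ioo (0 : ℝ) 1, f (y + t • (x - y)) = 0 := by
    intro t ht
    refine h2 (x := ⟨t • (x - y), Submodule.smul_mem _ _ hxy⟩) fun j hj => ?_
    simp only
    rw [etaV_lineMap]
    have := hx.2 j; have := hy' j hj; have := ht.1; have := sub_pos.2 ht.2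
    positivity
  have h4 : Tendsto (fun t : ℝ => f (y + t • (x - y))) (𝓝[<] 1) (𝓝 (f (y + (1 : ℝ) • (x - y)))) :=
    ((by fun_prop : Continuous fun t : ℝ => f (y + t • (x - y))).tendsto 1).mono_left
      nhdsWithin_le_nhds
  have h5 : Tendsto (fun t : ℝ => f (y + t • (x - y))) (𝓝[<] 1) (𝓝 0) := by
    refine tendsto_const_nhds.congr' ?_
    filter_upwards [Ioo_mem_nhdsLT (show (0 : ℝ) < 1 by norm_num)] with t ht
    exact (h3 t ht).symm
  have := tendsto_nhds_unique h4 h5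
  simpa using this

theorem eq_zero_on_elem (T : Affine.Simplex ℝ (E n) n)
    {f : E n → ℝ} (hf : Continuous f) (h : f =ᵐ[vol T] 0) : ∀ x ∈ elem T, f x = 0 :=
  Measure.eqOn_open_of_ae_eq (g := fun _ => 0) h (isOpen_elem T) hf.continuousOn
    continuousOn_const

/-- Inside the hyperplane of one face, the other face lies in the zero set of a further barycentric
coordinate. This affine subspace is proper, as the barycentre is not in it, and so it is a null set.
-/
theorem surf_face_inter (T : Affine.Simplex ℝ (E n) n) (hn : 1 ≤ n) {i j : Fin (n + 1)}
    (hij : j ≠ i) : surf (face T i) (face T j) = 0 := by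
  obtain ⟨y, hy, hy'⟩ := exists_face_center T hn i
  rw [surf_face_eq_map T hn i hy, (measurableEmbedding_add_faceDir T i y).map_apply]
  refine measure_mono_null (t := {w | etaV T j (y + w) = 0}) (fun w hw => ?_)
    (Measure.restrict_le_self.absolutelyContinuous ?_)
  · simp only [mem_preimage, face_eq] at hw
    exact hw.1
  let g : faceDir T i →ᵃ[ℝ] ℝ := ((affBasis T).coord j).comp
    ((AffineEquiv.constVAdd ℝ (E n) y).toAffineMap.comp (faceDir T i).subtype.toAffineMap)
  have hg : ∀ w, g w = etaV T j (y + w) := fun w => rfl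
  have := Measure.addHaar_affineSubspace (volume : Measure (faceDir T i))
    ((AffineSubspace.mk' (0 : ℝ) ⊥).comap g) (by
      intro h
      have : (0 : faceDir T i) ∈ (AffineSubspace.mk' (0 : ℝ) ⊥).comap g := by
        rw [h]; exact AffineSubspace.mem_top _ _ _
      rw [AffineSubspace.mem_comap, AffineSubspace.mem_mk'] at this
      simp [hg] at this
      exact (hy' j hij).ne' this)
  convert this using 2
  ext w
  simp [AffineSubspace.mem_mk', hg]

theorem aedisjoint_face (T : Affine.Simplex ℝ (E n) n) (hn : 1 ≤ n) :
    Pairwise (Function.onFun (AEDisjoint (Measure.euclideanHausdorffMeasure (n - 1)))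
      (face T)) := by
  intro i j hij
  have := surf_face_inter T hn hij.symm
  rw [surf, Measure.restrict_apply (isCompact_face T j).measurableSet, inter_comm] at this
  exact this

/-- Surface measure on the boundary is the sum of the surface measures of the faces. -/
theorem surf_bdry (T : Affine.Simplex ℝ (E n) n) (hn : 1 ≤ n) :
    surf (bdry T) = Measure.sum fun i => surf (face T i) :=
  Measure.restrict_iUnion_ae (aedisjoint_face T hn)
    fun i => (isCompact_face T i).measurableSet.nullMeasurableSet

theorem surf_face_le (T : Affine.Simplex ℝ (E n) n) (i : Fin (n + 1)) :
    surf (face T i) ≤ surf (bdry T) := Measure.restrict_mono (subset_iUnion _ i) le_rfl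

theorem isFiniteMeasure_surf_bdry (T : Affine.Simplex ℝ (E n) n) (hn : 1 ≤ n) :
    IsFiniteMeasure (surf (bdry T)) := by
  have := isFiniteMeasure_surf_face T hn
  rw [surf_bdry T hn]
  infer_instance

/-- The affine map between two simplices preserves surface measure up to a factor. -/
theorem map_surf_face (S T : Affine.Simplex ℝ (E n) n) (hn : 1 ≤ n) (i : Fin (n + 1)) :
    ∃ c : ENNReal, c ≠ 0 ∧ c ≠ ⊤ ∧
      (surf (face S i)).map (simplexEquiv S T) = c • surf (face T i) := by
  obtain ⟨y, hy, -⟩ := exists_face_center S hn i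
  set Φ := simplexEquiv S T with hΦ
  have hΦm : Measurable Φ := Φ.continuous_of_finiteDimensional.measurable
  have hadd : ∀ x v, Φ (x + v) = Φ x + Φ.linear v := fun x v => by
    have := Φ.map_vadd x v
    simp only [vadd_eq_add] at this
    rw [add_comm x v, this, add_comm]
  have hlin : ∀ v, ((affBasis T).coord i).linear (Φ.linear v) = ((affBasis S).coord i).linear v := by
    intro v
    have h1 := etaV_simplexEquiv S T i (y + v)
    rw [← hΦ, hadd, etaV_add, etaV_simplexEquiv, etaV_add] at h1
    linarith
  have hy1 : etaV T i (Φ y) = 0 := by rw [hΦ, etaV_simplexEquiv, hy]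
  let A : faceDir S i ≃ₗ[ℝ] faceDir T i := Φ.linear.ofSubmodules _ _ (by
    ext w
    simp only [Submodule.mem_map, faceDir, LinearMap.mem_ker]
    constructor
    · rintro ⟨v, hv, rfl⟩
      exact (hlin v).trans hv
    · intro hw
      refine ⟨Φ.linear.symm w, ?_, by simp⟩
      rw [← hlin, LinearEquiv.apply_symm_apply]; exact hw)
  have hA : ∀ w : faceDir S i, (A w : E n) = Φ.linear w := fun w => rfl
  have hAc : Continuous A := A.toLinearMap.continuous_of_finiteDimensional
  have hH : (Measure.map A volume).IsAddHaarMeasure :=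
    A.toContinuousLinearEquiv.isAddHaarMeasure_map volume
  -- The factor comes from uniqueness of Haar measure on the parallel spaces. Its value plays no
  -- role, because only vanishing face moments are transported.
  have hs := Measure.isAddLeftInvariant_eq_smul (Measure.map A volume)
    (volume : Measure (faceDir T i))
  set c := Measure.addHaarScalarFactor (Measure.map A volume) (volume : Measure (faceDir T i))
  have hc : (c : ENNReal) ≠ 0 := by
    have := Measure.addHaarScalarFactor_pos_of_isAddHaarMeasure (Measure.map A volume)
      (volume : Measure (faceDir T i))
    exact_mod_cast this.ne'
  refine ⟨c, hc, ENNReal.coe_ne_top, ?_⟩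
  have hmT := (measurableEmbedding_add_faceDir T i (Φ y)).measurable
  have hmS := (measurableEmbedding_add_faceDir S i y).measurable
  rw [surf_face_eq S hn i hy, surf_face_eq T hn i hy1, ← preimage_face S T,
    ← Measure.restrict_map hΦm (isCompact_face T i).measurableSet, Measure.map_map hΦm hmS,
    ← Measure.restrict_smul]
  congr 1
  have : (Φ ∘ fun w : faceDir S i => y + (w : E n)) = (fun w : faceDir T i => Φ y + w) ∘ A := by
    ext1 w
    simp [hadd, hA]
  rw [this, ← Measure.map_map hmT hAc.measurable, hs, Measure.map_smul]
  rfl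

/-- Again by uniqueness of Haar measure. The factor cancels from means and from both sides of the
norm estimates, for which it has to be nonzero and finite. -/
theorem map_vol (S T : Affine.Simplex ℝ (E n) n) :
    ∃ c : ENNReal, c ≠ 0 ∧ c ≠ ⊤ ∧ (vol S).map (simplexEquiv S T) = c • vol T := by
  set Φ := simplexEquiv S T with hΦ
  have hΦm : Measurable Φ := Φ.continuous_of_finiteDimensional.measurable
  have hadd : ∀ v, Φ v = Φ 0 + Φ.linear v := fun v => by
    have := Φ.map_vadd 0 v
    simp only [vadd_eq_add, add_zero] at this
    rw [this, add_comm]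
  have hH : (Measure.map Φ.linear volume).IsAddHaarMeasure :=
    Φ.linear.toContinuousLinearEquiv.isAddHaarMeasure_map volume
  have hs := Measure.isAddLeftInvariant_eq_smul (Measure.map Φ.linear volume)
    (volume : Measure (E n))
  set c := Measure.addHaarScalarFactor (Measure.map Φ.linear volume) (volume : Measure (E n))
  have hc : (c : ENNReal) ≠ 0 := by
    have := Measure.addHaarScalarFactor_pos_of_isAddHaarMeasure (Measure.map Φ.linear volume)
      (volume : Measure (E n))
    exact_mod_cast this.ne'
  refine ⟨c, hc, ENNReal.coe_ne_top, ?_⟩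
  have hl : Continuous Φ.linear := Φ.linear.toLinearMap.continuous_of_finiteDimensional
  have : (Φ : E n → E n) = (fun x => Φ 0 + x) ∘ Φ.linear := by
    ext1 w
    simp [hadd w]
  rw [vol, vol, ← preimage_elem S T, ← hΦ,
    ← Measure.restrict_map hΦm (isOpen_elem T).measurableSet, ← Measure.restrict_smul]
  congr 1
  rw [this, ← Measure.map_map (by fun_prop) hl.measurable, hs, Measure.map_smul,
    map_add_left_eq_self]
  rfl

/-- A simplex contains the cone over each of its faces, in integrated form. -/
theorem lintegral_cone_le (T : Affine.Simplex ℝ (E n) n) (hn : 1 ≤ n) (i : Fin (n + 1)) :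
    ∃ c : ENNReal, c ≠ ⊤ ∧ ∀ f : E n → ENNReal, Measurable f →
      ∫⁻ s in Ioo (1 / 2 : ℝ) 1, ∫⁻ y, f (T.points i + s • (y - T.points i)) ∂surf (face T i)
        ≤ c * ∫⁻ x, f x ∂vol T := by
  obtain ⟨y, hy, -⟩ := exists_face_center T hn i
  set z := T.points i with hz
  set ℓ := ((affBasis T).coord i).linear with hℓ
  have hd : ℓ (y - z) = -1 := by
    have := etaV_add T i z (y - z)
    rw [add_sub_cancel, hy, hz, etaV_vertex, if_pos rfl] at this
    linarith
  -- Coordinates adapted to the cone with apex `z`: a vector along the face and a multiple of `y -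
  -- z`, which is transversal to it. The product measure is carried to a multiple of Lebesgue
  -- measure.
  let L : (faceDir T i × ℝ) ≃ₗ[ℝ] E n :=
    { toFun := fun p => p.1 + p.2 • (y - z)
      invFun := fun x => (⟨x + ℓ x • (y - z), LinearMap.mem_ker.2 (by
        rw [← hℓ, map_add, map_smul, hd]; simp)⟩, -ℓ x)
      map_add' := fun p q => by simp; module
      map_smul' := fun r p => by simp; module
      left_inv := fun p => by
        have : ℓ (p.1 : E n) = 0 := LinearMap.mem_ker.1 p.1.2
        ext <;> simp [map_add, map_smul, hd, this]
      right_inv := fun x => by simp }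
  have hL : ∀ p, L p = p.1 + p.2 • (y - z) := fun p => rfl
  have hLm : Measurable L := L.toLinearMap.continuous_of_finiteDimensional.measurable
  have hH : (Measure.map L (volume.prod volume)).IsAddHaarMeasure :=
    L.toContinuousLinearEquiv.isAddHaarMeasure_map (volume.prod volume)
  have hs := Measure.isAddLeftInvariant_eq_smul (Measure.map L (volume.prod volume))
    (volume : Measure (E n))
  set c := Measure.addHaarScalarFactor (Measure.map L (volume.prod volume))
    (volume : Measure (E n))
  refine ⟨2 ^ (n - 1) * c, ENNReal.mul_ne_top (by finiteness) ENNReal.coe_ne_top, fun f hf => ?_⟩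
  -- The closed simplex is needed, since cone points over the relative boundary of the face have
  -- vanishing coordinates; the measure is the same.
  set K := convexHull ℝ (range T.points) with hK
  have hKm : MeasurableSet K := (isCompact_convexHull T).measurableSet
  set F := K.indicator f with hF
  have hFm : Measurable F := hf.indicator hKm
  have h1 : c * ∫⁻ x, f x ∂vol T = ∫⁻ s : ℝ, ∫⁻ w : faceDir T i, F (z + (w + s • (y - z))) := by
    rw [vol_eq_restrict_convexHull, ← lintegral_indicator hKm, ← lintegral_add_left_eq_self _ z]
    have : (c : ENNReal) * ∫⁻ x, F (z + x) = ∫⁻ x, F (z + x) ∂(c • volume) := by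
      rw [lintegral_smul_measure]; rfl
    rw [this, ← hs, lintegral_map (by fun_prop) hLm,
      lintegral_prod_symm _ (by fun_prop)]
    simp [hL]
  rw [mul_assoc, h1, ← lintegral_const_mul' _ _ (by finiteness)]
  refine (lintegral_mono_ae ?_).trans (setLIntegral_le_lintegral (Ioo (1 / 2 : ℝ) 1) _)
  filter_upwards [ae_restrict_mem measurableSet_Ioo] with s hs'
  have hs0 : 0 < s := by linarith [hs'.1]
  -- The slice of the cone at height `s` is the face scaled by `s`, with Jacobian s^(n-1).
  have h2 : ∫⁻ w : faceDir T i, F (z + (w + s • (y - z)))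
      = ENNReal.ofReal (s ^ (n - 1)) * ∫⁻ w : faceDir T i, F (z + s • (w + (y - z))) := by
    have := Measure.map_addHaar_smul (volume : Measure (faceDir T i)) hs0.ne'
    have h3 : ∫⁻ w : faceDir T i, F (z + s • (w + (y - z)))
        = ∫⁻ w : faceDir T i, F (z + (w + s • (y - z))) ∂(Measure.map (s • ·) volume) := by
      rw [lintegral_map (by fun_prop) (by fun_prop)]
      simp [smul_add]
    rw [h3, this, lintegral_smul_measure, finrank_faceDir T hn, abs_of_pos (by positivity),
      smul_eq_mul, ← mul_assoc, ← ENNReal.ofReal_mul (by positivity),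
      mul_inv_cancel₀ (by positivity), ENNReal.ofReal_one, one_mul]
  rw [h2, ← mul_assoc]
  -- Staying away from the apex, s > 1/2, keeps the Jacobian bounded below.
  have h4 : 1 ≤ 2 ^ (n - 1) * ENNReal.ofReal (s ^ (n - 1)) := by
    rw [show (2 : ENNReal) = ENNReal.ofReal 2 by simp, ← ENNReal.ofReal_pow (by norm_num),
      ← ENNReal.ofReal_mul (by positivity), ← mul_pow, ENNReal.one_le_ofReal]
    exact one_le_pow₀ (by linarith [hs'.1])
  refine le_trans ?_ (le_mul_of_one_le_left' h4)
  rw [surf_face_eq_map T hn i hy, lintegral_map (by fun_prop)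
    (measurableEmbedding_add_faceDir T i y).measurable]
  refine le_trans (lintegral_mono_ae ?_) (setLIntegral_le_lintegral _ _)
  have hpm : MeasurableSet ((fun w : faceDir T i => y + w) ⁻¹' face T i) :=
    (measurableEmbedding_add_faceDir T i y).measurable (isCompact_face T i).measurableSet
  filter_upwards [ae_restrict_mem hpm] with w hw
  have e : z + s • (y + (w : E n) - z) = z + s • (w + (y - z)) := by congr 2; abel
  rw [e, hF, indicator_of_mem]
  rw [← e, hK, convexHull_eq]
  intro j
  rw [mem_preimage, face_eq] at hw
  rw [etaV_lineMap, hz, etaV_vertex]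
  have := hw.2 j; have := sub_pos.2 hs'.2
  split_ifs <;> positivity

end Faces

/-! ### Weak gradients -/

section WeakGradients

variable {n : ℕ}

theorem gradient_apply (φ : E n → ℝ) (x : E n) (i : Fin n) :
    gradient φ x i = fderiv ℝ φ x (EuclideanSpace.single i 1) := by
  rw [← InnerProductSpace.toDual_symm_apply (𝕜 := ℝ) (x := EuclideanSpace.single i 1)
    (y := fderiv ℝ φ x), real_inner_comm, EuclideanSpace.inner_single_left]
  simp [gradient]

theorem norm_gradient (φ : E n → ℝ) (x : E n) : ‖gradient φ x‖ = ‖fderiv ℝ φ x‖ := by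
  rw [gradient, LinearIsometryEquiv.norm_map]

theorem continuous_gradient {φ : E n → ℝ} (hφ : ContDiff ℝ ∞ φ) : Continuous (gradient φ) :=
  (InnerProductSpace.toDual ℝ (E n)).symm.continuous.comp (hφ.continuous_fderiv (by simp))

theorem gradient_sub {φ ψ : E n → ℝ} (hφ : ContDiff ℝ ∞ φ) (hψ : ContDiff ℝ ∞ ψ) (x : E n) :
    gradient (fun x => φ x - ψ x) x = gradient φ x - gradient ψ x := by
  unfold gradient
  rw [fderiv_fun_sub (hφ.differentiable (by simp) x) (hψ.differentiable (by simp) x), map_sub]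

theorem memLp_of_continuous {F X : Type*} [NormedAddCommGroup F] [TopologicalSpace X]
    [MeasurableSpace X] [OpensMeasurableSpace X] [SecondCountableTopologyEither X F]
    {f : X → F} (hf : Continuous f) {μ : Measure X} {S K : Set X} [IsFiniteMeasure (μ.restrict S)]
    (hK : IsCompact K) (hS : MeasurableSet S) (hSK : S ⊆ K) : MemLp f 2 (μ.restrict S) := by
  obtain ⟨C, hC⟩ := hK.exists_bound_of_continuousOn hf.continuousOn
  refine MemLp.of_bound hf.aestronglyMeasurable C ?_
  filter_upwards [ae_restrict_mem hS] with x hx using hC x (hSK hx)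

theorem memLp_vol {F : Type*} [NormedAddCommGroup F] (T : Affine.Simplex ℝ (E n) n) {f : E n → F}
    (hf : Continuous f) : MemLp f 2 (vol T) :=
  haveI : IsFiniteMeasure (volume.restrict (elem T)) := inferInstanceAs (IsFiniteMeasure (vol T))
  memLp_of_continuous hf (isCompact_convexHull T) (isOpen_elem T).measurableSet interior_subset

theorem memLp_surf (T : Affine.Simplex ℝ (E n) n) (hn : 1 ≤ n) {f : E n → ℝ}
    (hf : Continuous f) : MemLp f 2 (surf (bdry T)) :=
  haveI := isFiniteMeasure_surf_bdry T hn
  haveI : IsFiniteMeasure ((Measure.euclideanHausdorffMeasure (n - 1)).restrict (bdry T)) := this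
  memLp_of_continuous hf (isCompact_bdry T) (isCompact_bdry T).measurableSet subset_rfl

theorem memLp_surf_face (T : Affine.Simplex ℝ (E n) n) (hn : 1 ≤ n) (i : Fin (n + 1))
    {f : E n → ℝ} (hf : Continuous f) : MemLp f 2 (surf (face T i)) :=
  (memLp_surf T hn hf).mono_measure (surf_face_le T i)

theorem isWeakGrad_gradient (T : Affine.Simplex ℝ (E n) n) {φ : E n → ℝ} (hφ : ContDiff ℝ ∞ φ) :
    IsWeakGrad (elem T) φ (gradient φ) where
  memLp_fun := memLp_vol T hφ.continuous
  memLp_grad := memLp_vol T (continuous_gradient hφ)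
  integral_eq ψ hψ hc hs i := by
    have h0 : ∀ x, x ∉ elem T → ψ x = 0 := fun x hx =>
      image_eq_zero_of_notMem_tsupport fun h => hx (hs h)
    have h1 : ∀ x, x ∉ elem T → fderiv ℝ ψ x = 0 := fun x hx =>
      image_eq_zero_of_notMem_tsupport fun h => hx (hs (tsupport_fderiv_subset ℝ h))
    -- The test function and its derivative vanish off the element, so one can integrate by parts on
    -- the whole space, without boundary terms.
    rw [setIntegral_eq_integral_of_forall_compl_eq_zero fun x hx => by simp [h1 x hx],
      setIntegral_eq_integral_of_forall_compl_eq_zero fun x hx => by simp [h0 x hx]]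
    simp only [gradient_apply]
    have c1 : Continuous fun x => fderiv ℝ φ x (EuclideanSpace.single i 1) :=
      (hφ.continuous_fderiv (by simp)).clm_apply continuous_const
    have c2 : Continuous fun x => fderiv ℝ ψ x (EuclideanSpace.single i 1) :=
      (hψ.continuous_fderiv (by simp)).clm_apply continuous_const
    refine integral_mul_fderiv_eq_neg_fderiv_mul_of_integrable ?_ ?_ ?_
      (fun x _ => hφ.differentiable (by simp) x) (fun x _ => hψ.differentiable (by simp) x)
    · exact (c1.mul hψ.continuous).integrable_of_hasCompactSupport hc.mul_left
    · exact (hφ.continuous.mul c2).integrable_of_hasCompactSupport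
        (hc.fderiv_apply ℝ _).mul_left
    · exact (hφ.continuous.mul hψ.continuous).integrable_of_hasCompactSupport hc.mul_left

theorem IsWeakGrad.congr {Ω : Set (E n)} {v v' : E n → ℝ} {g : E n → E n} (h : IsWeakGrad Ω v g)
    (hv : v =ᵐ[volume.restrict Ω] v') : IsWeakGrad Ω v' g where
  memLp_fun := h.memLp_fun.ae_eq hv
  memLp_grad := h.memLp_grad
  integral_eq φ h1 h2 h3 i := by
    rw [← h.integral_eq φ h1 h2 h3 i]
    refine integral_congr_ae ?_
    filter_upwards [hv] with x hx
    rw [hx]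

theorem integrable_mul_test {Ω : Set (E n)} {v ψ : E n → ℝ} (hv : MemLp v 2 (volume.restrict Ω))
    (hψ : Continuous ψ) (hc : HasCompactSupport ψ) :
    Integrable (fun x => v x * ψ x) (volume.restrict Ω) :=
  hv.integrable_mul (q := 2) ((hψ.memLp_of_hasCompactSupport hc).restrict Ω)

theorem memLp_apply {X : Type*} [MeasurableSpace X] {μ : Measure X} {g : X → E n}
    (hg : MemLp g 2 μ) (i : Fin n) : MemLp (fun x => g x i) 2 μ :=
  (EuclideanSpace.proj i : E n →L[ℝ] ℝ).comp_memLp' hg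

theorem IsWeakGrad.sub {Ω : Set (E n)} {v v' : E n → ℝ} {g g' : E n → E n}
    (h : IsWeakGrad Ω v g) (h' : IsWeakGrad Ω v' g') : IsWeakGrad Ω (v - v') (g - g') where
  memLp_fun := h.memLp_fun.sub h'.memLp_fun
  memLp_grad := h.memLp_grad.sub h'.memLp_grad
  integral_eq φ h1 h2 h3 i := by
    have c2 : Continuous fun x => fderiv ℝ φ x (EuclideanSpace.single i 1) :=
      (h1.continuous_fderiv (by simp)).clm_apply continuous_const
    have e := h.integral_eq φ h1 h2 h3 i
    have e' := h'.integral_eq φ h1 h2 h3 i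
    simp only [Pi.sub_apply, sub_mul, PiLp.sub_apply]
    rw [integral_sub (integrable_mul_test h.memLp_fun c2 (h2.fderiv_apply ℝ _))
      (integrable_mul_test h'.memLp_fun c2 (h2.fderiv_apply ℝ _)),
      integral_sub (integrable_mul_test (memLp_apply h.memLp_grad i) h1.continuous h2)
      (integrable_mul_test (memLp_apply h'.memLp_grad i) h1.continuous h2), e, e']
    ring

theorem IsWeakGrad.unique {Ω : Set (E n)} (hΩ : IsOpen Ω) {v : E n → ℝ} {g g' : E n → E n}
    (h : IsWeakGrad Ω v g) (h' : IsWeakGrad Ω v g') : g =ᵐ[volume.restrict Ω] g' := by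
  have key : ∀ i, ∀ᵐ x, x ∈ Ω → (g - g') x i = 0 := fun i => by
    have hm := memLp_apply (h.memLp_grad.sub h'.memLp_grad) i
    refine hΩ.ae_eq_zero_of_integral_contDiff_smul_eq_zero
      (locallyIntegrableOn_of_locallyIntegrable_restrict (hm.locallyIntegrable (by norm_num)))
      fun φ h1 h2 h3 => ?_
    -- The difference `g - g'` is a weak gradient of `v - v = 0`, hence orthogonal to all test
    -- functions.
    have e := (h.sub h').integral_eq φ h1 h2 h3 i
    rw [sub_self] at e
    have h0 : ∀ x, x ∉ Ω → φ x = 0 := fun x hx =>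
      image_eq_zero_of_notMem_tsupport fun h => hx (h3 h)
    rw [← setIntegral_eq_integral_of_forall_compl_eq_zero (s := Ω)
      fun x hx => by rw [h0 x hx, zero_smul]]
    simp only [Pi.zero_apply, zero_mul, integral_zero] at e
    simp only [smul_eq_mul, mul_comm (φ _)]
    linarith
  rw [Filter.EventuallyEq, ae_restrict_iff' hΩ.measurableSet]
  filter_upwards [ae_all_iff.2 key] with x hx hxΩ
  ext i
  have := hx i hxΩ
  simpa [sub_eq_zero] using this

theorem MemH1.isWeakGrad {Ω : Set (E n)} {v : E n → ℝ} (h : MemH1 Ω v) :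
    IsWeakGrad Ω v (weakGrad Ω v) := by
  rw [weakGrad, dif_pos h]
  exact h.choose_spec

theorem IsWeakGrad.weakGrad_ae {Ω : Set (E n)} (hΩ : IsOpen Ω) {v : E n → ℝ} {g : E n → E n}
    (h : IsWeakGrad Ω v g) : weakGrad Ω v =ᵐ[volume.restrict Ω] g :=
  (MemH1.isWeakGrad ⟨g, h⟩).unique hΩ h

theorem memH1_of_contDiff (T : Affine.Simplex ℝ (E n) n) {φ : E n → ℝ} (hφ : ContDiff ℝ ∞ φ) :
    MemH1 (elem T) φ := ⟨_, isWeakGrad_gradient T hφ⟩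

end WeakGradients

/-! ### Approximation by smooth functions -/

section Approximation

variable {n : ℕ} {F : Type*} [NormedAddCommGroup F]

theorem eLpNorm_two_sq {X : Type*} [MeasurableSpace X] (μ : Measure X) (f : X → F) :
    eLpNorm f 2 μ ^ 2 = ∫⁻ x, ‖f x‖ₑ ^ 2 ∂μ := by
  have := eLpNorm_nnreal_pow_eq_lintegral (μ := μ) (f := f) (p := 2) (by norm_num)
  simpa using this

/-- The change of variables produces a^(-n/2), crudely bounded by 2^n because a ≥ 1/2. -/
theorem eLpNorm_comp_dilation_le {f : E n → F} (hf : AEStronglyMeasurable f volume) {a : ℝ}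
    (ha : 1 / 2 ≤ a) (b : E n) :
    eLpNorm (fun x => f (a • x + b)) 2 volume ≤ 2 ^ n * eLpNorm f 2 volume := by
  have ha0 : 0 < a := by linarith
  have hm : Measure.map (fun x : E n => a • x + b) volume
      = ENNReal.ofReal (a ^ n)⁻¹ • volume := by
    have : (fun x : E n => a • x + b) = (fun x => x + b) ∘ (a • ·) := rfl
    rw [this, ← Measure.map_map (by fun_prop) (by fun_prop),
      Measure.map_addHaar_smul _ ha0.ne', Measure.map_smul, map_add_right_eq_self,
      finrank_euclideanSpace_fin, abs_of_pos (by positivity)]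
  have hc : ENNReal.ofReal (a ^ n)⁻¹ ≤ 2 ^ n := by
    rw [show (2 : ENNReal) = ENNReal.ofReal 2 by simp, ← ENNReal.ofReal_pow (by norm_num)]
    refine ENNReal.ofReal_le_ofReal ?_
    rw [← inv_pow]
    exact pow_le_pow_left₀ (by positivity) (by rw [inv_le_comm₀ ha0 (by norm_num)]; linarith) n
  have hf' : AEStronglyMeasurable f (ENNReal.ofReal (a ^ n)⁻¹ • volume) := hf.smul_measure _
  have e := eLpNorm_map_measure (p := 2) (hm ▸ hf') (by fun_prop : AEMeasurable
    (fun x : E n => a • x + b) volume)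
  change _ = eLpNorm (fun x => f (a • x + b)) 2 volume at e
  rw [← e, hm, eLpNorm_smul_measure_of_ne_top (by norm_num), smul_eq_mul]
  gcongr
  calc ENNReal.ofReal (a ^ n)⁻¹ ^ (1 / (2 : ENNReal)).toReal
      ≤ (2 ^ n : ENNReal) ^ (1 / (2 : ENNReal)).toReal := by gcongr
    _ ≤ (2 ^ n : ENNReal) ^ (1 : ℝ) := by
        refine ENNReal.rpow_le_rpow_of_exponent_le (one_le_pow₀ (by norm_num)) ?_
        norm_num
    _ = 2 ^ n := by rw [ENNReal.rpow_one]

/-- Continuity of affine dilations in `L²`. -/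
theorem exists_dilation_close [NormedSpace ℝ F] {f : E n → F} (hf : MemLp f 2 volume) {δ : ENNReal} (hδ : δ ≠ 0) :
    ∃ η : ℝ, 0 < η ∧ η ≤ 1 / 2 ∧ ∀ a : ℝ, 1 - η ≤ a → a ≤ 1 → ∀ b : E n, ‖b‖ ≤ η →
      eLpNorm (fun x => f (a • x + b) - f x) 2 volume ≤ δ := by
  wlog hδt : δ ≠ ⊤ generalizing δ
  · obtain ⟨η, h1, h2, h3⟩ := this (δ := 1) (by simp) (by simp)
    refine ⟨η, h1, h2, fun a _ _ b _ => ?_⟩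
    rw [not_not.1 hδt]; exact le_top
  -- Replacing `f` by the compactly supported `g` costs 2^n δ₁ in the dilated term and δ₁ in the
  -- other; the dilation error of `g` adds another δ₁.
  set δ₁ : ENNReal := δ / (2 * 2 ^ n + 2) with hδ₁
  have hδ₁0 : δ₁ ≠ 0 := (ENNReal.div_pos hδ (by finiteness)).ne'
  obtain ⟨g, hgc, hfg, hg, hgm⟩ := hf.exists_hasCompactSupport_eLpNorm_sub_le (by norm_num) hδ₁0
  obtain ⟨R, hR⟩ := hgc.isCompact.isBounded.subset_ball_lt 1 0
  have hg0 : ∀ x, R ≤ ‖x‖ → g x = 0 := fun x hx => by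
    refine image_eq_zero_of_notMem_tsupport fun h => ?_
    have := hR.2 h
    rw [mem_ball_zero_iff] at this
    linarith
  -- Outside this ball both x and a x + b have norm at least R, because a ≥ 1/2 and ‖b‖ ≤ 1/2; so
  -- `g` vanishes at both points.
  set B := Metric.ball (0 : E n) (2 * R + 1)
  set V : ENNReal := volume B ^ (2 : ENNReal).toReal⁻¹ with hV
  have hVt : V ≠ ⊤ := ENNReal.rpow_ne_top_of_nonneg (by positivity) measure_ball_lt_top.ne
  obtain ⟨κ, hκ, hκV⟩ : ∃ κ : ℝ, 0 < κ ∧ V * ENNReal.ofReal κ ≤ δ₁ := by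
    refine ⟨(δ₁ / (V + 1)).toReal, ENNReal.toReal_pos ?_ ?_, ?_⟩
    · exact (ENNReal.div_pos hδ₁0 (by finiteness)).ne'
    · refine ENNReal.div_ne_top ?_ (by simp)
      exact ENNReal.div_ne_top hδt (by simp)
    · rw [ENNReal.ofReal_toReal]
      · calc V * (δ₁ / (V + 1)) ≤ (V + 1) * (δ₁ / (V + 1)) := by gcongr; simp
          _ ≤ δ₁ := ENNReal.mul_div_le
      · refine ENNReal.div_ne_top ?_ (by simp)
        exact ENNReal.div_ne_top hδt (by simp)
  obtain ⟨θ, hθ, hθg⟩ := Metric.uniformContinuous_iff.1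
    (hgc.uniformContinuous_of_continuous hg) κ hκ
  have hR1 := hR.1
  -- On `B` the displacement (a - 1) x + b has norm at most η (‖x‖ + 1) < η (2 R + 3) ≤ θ.
  refine ⟨min (1 / 2) (θ / (2 * R + 3)), by positivity, min_le_left _ _, fun a ha ha1 b hb => ?_⟩
  have hη1 : min (1 / 2) (θ / (2 * R + 3)) ≤ 1 / 2 := min_le_left _ _
  have hη2 : min (1 / 2) (θ / (2 * R + 3)) ≤ θ / (2 * R + 3) := min_le_right _ _
  set η := min (1 / 2) (θ / (2 * R + 3))
  have hη2 : η * (2 * R + 3) ≤ θ := by rwa [← le_div_iff₀ (by positivity)]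
  have hη0 : 0 < η := by positivity
  have hgd : eLpNorm (fun x => g (a • x + b) - g x) 2 volume ≤ δ₁ := by
    have hsupp : Function.support (fun x => g (a • x + b) - g x) ⊆ B := by
      intro x hx
      by_contra hxB
      rw [mem_ball_zero_iff, not_lt] at hxB
      refine hx ?_
      have : R ≤ ‖a • x + b‖ := by
        have h1 : ‖a • x‖ ≤ ‖a • x + b‖ + ‖b‖ := by
          have := norm_sub_le (a • x + b) b
          rwa [add_sub_cancel_right] at this
        rw [norm_smul, Real.norm_of_nonneg (by linarith)] at h1
        nlinarith
      simp only
      rw [hg0 _ this, hg0 x (by linarith), sub_zero]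
    rw [← eLpNorm_restrict_eq_of_support_subset hsupp]
    refine (eLpNorm_le_of_ae_bound (C := κ) ?_).trans ?_
    · filter_upwards [ae_restrict_mem measurableSet_ball] with x hx
      rw [← dist_eq_norm]
      refine (hθg ?_).le
      rw [mem_ball_zero_iff] at hx
      calc dist (a • x + b) x = ‖(a - 1) • x + b‖ := by rw [dist_eq_norm]; congr 1; module
        _ ≤ (1 - a) * ‖x‖ + ‖b‖ := by
          refine (norm_add_le _ _).trans ?_
          rw [norm_smul, Real.norm_eq_abs, abs_sub_comm, abs_of_nonneg (by linarith)]
        _ ≤ η * ‖x‖ + η := by gcongr; linarith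
        _ < θ := by nlinarith
    · rw [Measure.restrict_apply_univ]; exact hκV
  have h1 : eLpNorm (fun x => (f - g) (a • x + b)) 2 volume ≤ 2 ^ n * δ₁ :=
    (eLpNorm_comp_dilation_le (hf.1.sub hgm.1) (by linarith) b).trans (by gcongr)
  have hqmp : Measure.QuasiMeasurePreserving (fun x : E n => a • x + b) volume volume := by
    have : (fun x : E n => a • x + b) = (fun x => x + b) ∘ (a • ·) := rfl
    rw [this]
    refine (measurePreserving_add_right volume b).quasiMeasurePreserving.comp ?_
    exact ⟨by fun_prop, by
      rw [Measure.map_addHaar_smul _ (by linarith)]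
      exact Measure.smul_absolutelyContinuous⟩
  have hfa : AEStronglyMeasurable (fun x => (f - g) (a • x + b)) volume :=
    (hf.1.sub hgm.1).comp_quasiMeasurePreserving hqmp
  have e : (fun x => f (a • x + b) - f x) = ((fun x => (f - g) (a • x + b)) - (f - g))
      + fun x => g (a • x + b) - g x := by
    ext x; simp only [Pi.add_apply, Pi.sub_apply]; abel
  rw [e]
  calc _ ≤ eLpNorm ((fun x => (f - g) (a • x + b)) - (f - g)) 2 volume
        + eLpNorm (fun x => g (a • x + b) - g x) 2 volume :=
        eLpNorm_add_le (hfa.sub (hf.1.sub hgm.1))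
          ((by fun_prop : Continuous fun x => g (a • x + b) - g x).aestronglyMeasurable)
          (by norm_num)
    _ ≤ (2 ^ n * δ₁ + δ₁) + δ₁ := by
        gcongr
        refine (eLpNorm_sub_le hfa (hf.1.sub hgm.1) (by norm_num)).trans ?_
        gcongr
    _ ≤ (2 * 2 ^ n + 2) * δ₁ := by
        have : (2 ^ n * δ₁ + δ₁) + δ₁ = (2 ^ n + 2) * δ₁ := by ring
        rw [this]
        gcongr
        exact le_mul_of_one_le_left' (by norm_num)
    _ ≤ δ := ENNReal.mul_div_le

/-- Jensen's inequality for the square: on a probability space the L¹ norm is at most the L² norm.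
-/
theorem enorm_integral_sq_le [NormedSpace ℝ F] {Y : Type*} [MeasurableSpace Y] {ν : Measure Y}
    [IsProbabilityMeasure ν] {h : Y → F} (hh : AEStronglyMeasurable h ν) :
    ‖∫ y, h y ∂ν‖ₑ ^ 2 ≤ ∫⁻ y, ‖h y‖ₑ ^ 2 ∂ν := by
  rw [← eLpNorm_two_sq]
  gcongr
  calc ‖∫ y, h y ∂ν‖ₑ ≤ eLpNorm h 1 ν := by
        rw [eLpNorm_one_eq_lintegral_enorm]; exact enorm_integral_le_lintegral_enorm _
    _ ≤ eLpNorm h 2 ν := eLpNorm_le_eLpNorm_of_exponent_le (by norm_num) hh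

/-- Averages of functions that are small in `L²` are small in `L²`. -/
theorem eLpNorm_integral_le [NormedSpace ℝ F] {X Y : Type*} [MeasurableSpace X] [MeasurableSpace Y]
    {μ : Measure X} {ν : Measure Y} [SFinite μ] [IsProbabilityMeasure ν] {h : X → Y → F}
    (hh : StronglyMeasurable (Function.uncurry h)) {δ : ENNReal}
    (hδ : ∀ᵐ y ∂ν, eLpNorm (fun x => h x y) 2 μ ≤ δ) :
    eLpNorm (fun x => ∫ y, h x y ∂ν) 2 μ ≤ δ := by
  refine (ENNReal.pow_le_pow_left_iff (n := 2) (by norm_num)).1 ?_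
  rw [eLpNorm_two_sq]
  calc ∫⁻ x, ‖∫ y, h x y ∂ν‖ₑ ^ 2 ∂μ ≤ ∫⁻ x, ∫⁻ y, ‖h x y‖ₑ ^ 2 ∂ν ∂μ := by
        refine lintegral_mono fun x => ?_
        have hx : AEStronglyMeasurable (fun y => h x y) ν :=
          (hh.comp_measurable measurable_prodMk_left).aestronglyMeasurable
        exact enorm_integral_sq_le hx
    _ = ∫⁻ y, ∫⁻ x, ‖h x y‖ₑ ^ 2 ∂μ ∂ν :=
        lintegral_lintegral_swap (hh.enorm.pow_const 2).aemeasurable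
    _ ≤ ∫⁻ y, δ ^ 2 ∂ν := by
        refine lintegral_mono_ae ?_
        filter_upwards [hδ] with y hy
        rw [← eLpNorm_two_sq]
        gcongr
    _ = δ ^ 2 := by simp

end Approximation

/-! ### Density of smooth functions by dilation and mollification -/

section Mollification

variable {n : ℕ} {F : Type*} [NormedAddCommGroup F]

theorem integrable_bump_smul [NormedSpace ℝ F] (b : ContDiffBump (0 : E n)) {f : E n → F} (hf : MemLp f 2 volume)
    (z : E n) : Integrable (fun u => b.normed volume u • f (z - u)) volume :=
  HasCompactSupport.convolutionExists_left (ContinuousLinearMap.lsmul ℝ ℝ)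
    b.hasCompactSupport_normed b.continuous_normed (hf.locallyIntegrable (by norm_num)) z

/-- Convolution with a bump function after an affine dilation is close to the identity. -/
theorem eLpNorm_mollify_sub_le [NormedSpace ℝ F] [CompleteSpace F] {f : E n → F} (hfm : StronglyMeasurable f)
    (hf : MemLp f 2 volume) {δ : ENNReal} {a : ℝ} (c : E n) (b : ContDiffBump (0 : E n))
    (h : ∀ u ∈ Metric.ball (0 : E n) b.rOut,
      eLpNorm (fun x => f (a • x + (c - u)) - f x) 2 volume ≤ δ) :
    eLpNorm (fun x => (∫ u, b.normed volume u • f (a • x + c - u)) - f x) 2 volume ≤ δ := by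
  set ρ := b.normed (volume : Measure (E n)) with hρ
  have hρ0 : ∀ u, 0 ≤ ρ u := fun u => b.nonneg_normed u
  have hρm : Measurable fun u => ENNReal.ofReal (ρ u) :=
    b.continuous_normed.measurable.ennreal_ofReal
  -- The normalized bump is a probability density, so the mollification error is an average over `u`
  -- of translation errors.
  set ν : Measure (E n) := volume.withDensity fun u => ENNReal.ofReal (ρ u) with hν
  have hνp : IsProbabilityMeasure ν := ⟨by
    rw [hν, withDensity_apply _ MeasurableSet.univ, Measure.restrict_univ,
      ← ofReal_integral_eq_lintegral_ofReal b.integrable_normed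
        (ae_of_all _ fun u => b.nonneg_normed u), b.integral_normed, ENNReal.ofReal_one]⟩
  have e : ∀ x, (∫ u, ρ u • f (a • x + c - u)) - f x
      = ∫ u, (f (a • x + (c - u)) - f x) ∂ν := fun x => by
    have hint : Integrable (fun u => f (a • x + c - u)) ν := by
      rw [hν, integrable_withDensity_iff_integrable_smul' hρm
        (ae_of_all _ fun _ => ENNReal.ofReal_lt_top)]
      simp only [ENNReal.toReal_ofReal (hρ0 _)]
      exact integrable_bump_smul b hf _
    simp only [← add_sub_assoc]
    rw [integral_sub hint (integrable_const _), integral_const, probReal_univ, one_smul, hν,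
      integral_withDensity_eq_integral_toReal_smul hρm
        (ae_of_all _ fun _ => ENNReal.ofReal_lt_top)]
    simp only [ENNReal.toReal_ofReal (hρ0 _)]
  simp only [e]
  refine eLpNorm_integral_le ?_ ?_
  · refine StronglyMeasurable.sub (hfm.comp_measurable (by fun_prop))
      (hfm.comp_measurable measurable_fst)
  · rw [hν, ae_withDensity_iff hρm]
    refine ae_of_all _ fun u hu => h u ?_
    rw [← b.support_normed_eq (μ := volume)]
    intro h0
    exact hu (by rw [hρ, h0, ENNReal.ofReal_zero])

theorem eLpNorm_indicator_sub {Ω : Set (E n)} (hΩ : MeasurableSet Ω) {f h : E n → F}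
    {δ : ENNReal} (H : eLpNorm (fun x => h x - Ω.indicator f x) 2 volume ≤ δ) :
    eLpNorm (fun x => h x - f x) 2 (volume.restrict Ω) ≤ δ := by
  refine le_trans (le_of_eq (eLpNorm_congr_ae ?_)) ((eLpNorm_restrict_le _ 2 volume Ω).trans H)
  filter_upwards [ae_restrict_mem hΩ] with x hx
  rw [indicator_of_mem hx]

/-- Functions in `H¹` of a convex open set are limits of functions that are smooth on the whole
space. -/
theorem exists_smooth_close {Ω : Set (E n)} (hΩ : IsOpen Ω) (hcv : Convex ℝ Ω)
    (hne : Ω.Nonempty) {v : E n → ℝ} {g : E n → E n} (hw : IsWeakGrad Ω v g) {δ : ENNReal}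
    (hδ : δ ≠ 0) : ∃ φ : E n → ℝ, ContDiff ℝ ∞ φ ∧
      eLpNorm (fun x => φ x - v x) 2 (volume.restrict Ω) ≤ δ ∧
      eLpNorm (fun x => gradient φ x - g x) 2 (volume.restrict Ω) ≤ δ := by
  -- Strongly measurable representatives give the joint measurability needed in the convolution
  -- integrals.
  wlog hmeas : StronglyMeasurable v ∧ StronglyMeasurable g generalizing v g
  · have hv := hw.memLp_fun.1.ae_eq_mk
    have hg := hw.memLp_grad.1.ae_eq_mk
    have hw' : IsWeakGrad Ω (hw.memLp_fun.1.mk v) (hw.memLp_grad.1.mk g) := by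
      have h1 := hw.congr hv
      refine ⟨h1.memLp_fun, hw.memLp_grad.ae_eq hg, fun φ a b c i => ?_⟩
      rw [h1.integral_eq φ a b c i]
      congr 1
      refine integral_congr_ae ?_
      filter_upwards [hg] with x hx
      rw [← hx]
    obtain ⟨φ, h1, h2, h3⟩ := this hw'
      ⟨hw.memLp_fun.1.stronglyMeasurable_mk, hw.memLp_grad.1.stronglyMeasurable_mk⟩
    refine ⟨φ, h1, h2.trans' (le_of_eq (eLpNorm_congr_ae ?_)),
      h3.trans' (le_of_eq (eLpNorm_congr_ae ?_))⟩
    · filter_upwards [hv] with x hx; rw [hx]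
    · filter_upwards [hg] with x hx; rw [hx]
  obtain ⟨hvm, hgm⟩ := hmeas
  obtain ⟨x₀, hx₀⟩ := hne
  obtain ⟨r, hr, hrΩ⟩ := Metric.nhds_basis_closedBall.mem_iff.1 (hΩ.mem_nhds hx₀)
  have hΩm := hΩ.measurableSet
  set V := Ω.indicator v with hV
  set G := Ω.indicator g with hG
  have hVm : StronglyMeasurable V := hvm.indicator hΩm
  have hGm : StronglyMeasurable G := hgm.indicator hΩm
  have hV2 : MemLp V 2 volume := (memLp_indicator_iff_restrict hΩm).2 hw.memLp_fun
  have hG2 : MemLp G 2 volume := (memLp_indicator_iff_restrict hΩm).2 hw.memLp_grad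
  have hδ2 : δ / 2 ≠ 0 := (ENNReal.div_pos hδ (by norm_num)).ne'
  obtain ⟨η₁, hη₁, hη₁', H₁⟩ := exists_dilation_close hV2 hδ
  obtain ⟨η₂, hη₂, hη₂', H₂⟩ := exists_dilation_close hG2 hδ2
  -- This absorbs the loss ε ‖G‖ caused by the chain rule factor a = 1 - ε in the gradient.
  obtain ⟨κ, hκ, hκG⟩ : ∃ κ : ℝ, 0 < κ ∧ ENNReal.ofReal κ * eLpNorm G 2 volume ≤ δ / 2 := by
    have h1 : eLpNorm G 2 volume + 1 ≠ ⊤ := by simpa using hG2.2.ne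
    by_cases hδt : δ = ⊤
    · exact ⟨1, one_pos, by rw [hδt, ENNReal.top_div_of_ne_top (by norm_num)]; exact le_top⟩
    refine ⟨(δ / 2 / (eLpNorm G 2 volume + 1)).toReal, ENNReal.toReal_pos ?_ ?_, ?_⟩
    · exact (ENNReal.div_pos hδ2 h1).ne'
    · exact ENNReal.div_ne_top (ENNReal.div_ne_top hδt (by norm_num)) (by simp)
    · rw [ENNReal.ofReal_toReal (ENNReal.div_ne_top (ENNReal.div_ne_top hδt (by norm_num))
        (by simp)), mul_comm]
      calc eLpNorm G 2 volume * (δ / 2 / (eLpNorm G 2 volume + 1))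
          ≤ (eLpNorm G 2 volume + 1) * (δ / 2 / (eLpNorm G 2 volume + 1)) := by gcongr; simp
        _ ≤ δ / 2 := ENNReal.mul_div_le
  -- The dilation is x ↦ (1 - ε) x + ε x₀ and the kernel has radius ε r. The total shift c - u is
  -- then at most ε (‖x₀‖ + r), so that both 1 - a and the shift stay below η₁ and η₂.
  obtain ⟨ε, hε, hε1, hεκ, hεη₁, hεη₂⟩ : ∃ ε : ℝ, 0 < ε ∧ ε < 1 ∧ ε ≤ κ ∧
      ε * (1 + ‖x₀‖ + r) ≤ η₁ ∧ ε * (1 + ‖x₀‖ + r) ≤ η₂ := by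
    have hp : 0 < 1 + ‖x₀‖ + r := by positivity
    refine ⟨min (1 / 2) (min κ (min (η₁ / (1 + ‖x₀‖ + r)) (η₂ / (1 + ‖x₀‖ + r)))),
      by positivity, lt_of_le_of_lt (min_le_left _ _) (by norm_num),
      (min_le_right _ _).trans (min_le_left _ _), ?_, ?_⟩
    · rw [← le_div_iff₀ hp]
      exact (min_le_right _ _).trans ((min_le_right _ _).trans (min_le_left _ _))
    · rw [← le_div_iff₀ hp]
      exact (min_le_right _ _).trans ((min_le_right _ _).trans (min_le_right _ _))
  let b : ContDiffBump (0 : E n) := ⟨ε * r / 2, ε * r, by positivity, by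
    have := mul_pos hε hr; linarith⟩
  set ρ := b.normed (volume : Measure (E n)) with hρ
  have hρs : ContDiff ℝ ∞ ρ := b.contDiff_normed
  have hρc : HasCompactSupport ρ := b.hasCompactSupport_normed
  set a := 1 - ε with ha
  set c := ε • x₀ with hc
  have hcn : ∀ u ∈ Metric.ball (0 : E n) b.rOut, ‖c - u‖ ≤ ε * (‖x₀‖ + r) := fun u hu => by
    refine (norm_sub_le _ _).trans ?_
    rw [hc, norm_smul, Real.norm_of_nonneg hε.le, mul_add]
    gcongr
    exact (mem_ball_zero_iff.1 hu).le
  have hεn : 0 ≤ ε * (‖x₀‖ + r) := by positivity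
  have K₁ := eLpNorm_mollify_sub_le hVm hV2 c b fun u hu =>
    H₁ a (by rw [ha]; linarith) (by rw [ha]; linarith) (c - u) ((hcn u hu).trans (by linarith))
  have K₂ := eLpNorm_mollify_sub_le hGm hG2 c b fun u hu =>
    H₂ a (by rw [ha]; linarith) (by rw [ha]; linarith) (c - u) ((hcn u hu).trans (by linarith))
  set Q : E n → ℝ := fun z => ∫ u, ρ u • V (z - u) with hQ
  have hQs : ContDiff ℝ ∞ Q := hρc.contDiff_convolution_left (ContinuousLinearMap.lsmul ℝ ℝ) hρs
    (hV2.locallyIntegrable (by norm_num))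
  set φ : E n → ℝ := fun x => Q (a • x + c) with hφ
  have hφs : ContDiff ℝ ∞ φ := hQs.comp (by fun_prop)
  have hfd : ∀ (z : E n) (i : Fin n), fderiv ℝ Q z (EuclideanSpace.single i 1)
      = ∫ u, V u * fderiv ℝ ρ (z - u) (EuclideanSpace.single i 1) := by
    intro z i
    have h1 := hρc.hasFDerivAt_convolution_left (ContinuousLinearMap.lsmul ℝ ℝ : ℝ →L[ℝ] ℝ →L[ℝ] ℝ)
      (μ := volume) (hρs.of_le (by simp)) (hV2.locallyIntegrable (by norm_num)) z
    have h2 : fderiv ℝ Q z = _ := h1.fderiv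
    rw [h2, convolution_def, ContinuousLinearMap.integral_apply]
    · rw [← integral_sub_left_eq_self _ _ z]
      refine integral_congr_ae (ae_of_all _ fun u => ?_)
      simp [ContinuousLinearMap.precompL_apply, mul_comm]
    · exact HasCompactSupport.convolutionExists_left _ (hρc.fderiv ℝ)
        (hρs.continuous_fderiv (by simp)) (hV2.locallyIntegrable (by norm_num)) z
  -- Differentiation falls on the kernel. Since u ↦ ρ(z - u) is an admissible test function, the
  -- definition of the weak gradient moves the derivative onto `v`, although the extension by zero
  -- `V` may jump across the boundary of `Ω`.
  have hgrad : ∀ x ∈ Ω, gradient φ x = a • ∫ u, ρ u • G (a • x + c - u) := by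
    intro x hx
    set z := a • x + c with hz
    have hψs : ContDiff ℝ ∞ fun u => ρ (z - u) := hρs.comp (by fun_prop)
    have hzs : ∀ u ∉ Metric.closedBall z (ε * r), ρ (z - u) = 0 := by
      intro u hu
      refine image_eq_zero_of_notMem_tsupport ?_
      rw [hρ, b.tsupport_normed_eq]
      intro h
      refine hu ?_
      rw [mem_closedBall_zero_iff] at h
      rw [Metric.mem_closedBall, dist_comm, dist_eq_norm]
      exact h
    have hψc : HasCompactSupport fun u => ρ (z - u) :=
      HasCompactSupport.of_support_subset_isCompact (isCompact_closedBall z (ε * r)) fun u hu => by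
        by_contra h; exact hu (hzs u h)
    have hψt : tsupport (fun u => ρ (z - u)) ⊆ Ω := by
      have hcl : tsupport (fun u => ρ (z - u)) ⊆ Metric.closedBall z (ε * r) :=
        closure_minimal (fun u hu => by by_contra h; exact hu (hzs u h))
          Metric.isClosed_closedBall
      refine hcl.trans ?_
      · intro u hu
        rw [mem_closedBall_iff_norm] at hu
        have h1 : x₀ + ε⁻¹ • (u - z) ∈ Ω := by
          refine hrΩ ?_
          rw [mem_closedBall_iff_norm, add_sub_cancel_left, norm_smul, norm_inv,
            Real.norm_of_nonneg hε.le, inv_mul_le_iff₀ hε]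
          exact hu
        -- Convexity: a point of the ball of radius ε r about z = (1 - ε) x + ε x₀ is a convex
        -- combination of x and a point of the ball of radius r about x₀. Hence the support stays in
        -- `Ω`.
        have h2 := hcv hx h1 (by linarith : 0 ≤ a) hε.le (by rw [ha]; ring)
        rwa [smul_add, smul_inv_smul₀ hε.ne', ← hc, ← add_assoc, ← hz, add_sub_cancel] at h2
    have hint := integrable_bump_smul b hG2 z
    ext i
    have h1 : gradient φ x i = a * fderiv ℝ Q z (EuclideanSpace.single i 1) := by
      rw [gradient_apply]
      have h2 : HasFDerivAt (fun x : E n => a • x + c) (a • ContinuousLinearMap.id ℝ (E n)) x :=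
        ((hasFDerivAt_id x).const_smul a).add_const c
      have h3 := ((hQs.differentiable (by simp) z).hasFDerivAt).comp x h2
      have h4 : fderiv ℝ φ x = _ := h3.fderiv
      rw [h4]
      simp
    rw [h1, hfd, PiLp.smul_apply, smul_eq_mul]
    congr 1
    have h2 : (∫ u, ρ u • G (z - u)) i = ∫ u, G u i * ρ (z - u) := by
      have := (EuclideanSpace.proj i : E n →L[ℝ] ℝ).integral_comp_comm hint
      change ∫ u, (ρ u • G (z - u)) i = (∫ u, ρ u • G (z - u)) i at this
      rw [← this, ← integral_sub_left_eq_self _ _ z]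
      refine integral_congr_ae (ae_of_all _ fun u => ?_)
      simp [mul_comm, hρ]
    rw [h2]
    have h3 := hw.integral_eq _ hψs hψc hψt i
    have h4 : ∀ u, fderiv ℝ (fun u => ρ (z - u)) u = - fderiv ℝ ρ (z - u) := fun u => by
      have h5 : HasFDerivAt (fun u : E n => z - u) (-ContinuousLinearMap.id ℝ (E n)) u :=
        (hasFDerivAt_id u).const_sub z
      have h6 := (((hρs.differentiable (by simp) (z - u)).hasFDerivAt).comp u h5).fderiv
      change fderiv ℝ (fun u => ρ (z - u)) u = _ at h6
      rw [h6]
      ext w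
      simp
    have h5 : ∀ (w : E n → ℝ) (k : E n → ℝ), ∫ u, Ω.indicator w u * k u = ∫ u in Ω, w u * k u := by
      intro w k
      rw [← integral_indicator hΩm]
      refine integral_congr_ae (ae_of_all _ fun u => ?_)
      by_cases hu : u ∈ Ω <;> simp [hu]
    have h6 : ∀ u, G u i = Ω.indicator (fun u => g u i) u := fun u => by
      by_cases hu : u ∈ Ω <;> simp [hG, hu]
    simp only [h6, hV]
    rw [h5, h5]
    simp only [h4, neg_apply, mul_neg] at h3
    rw [integral_neg] at h3
    linarith
  refine ⟨φ, hφs, eLpNorm_indicator_sub hΩm K₁, ?_⟩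
  have hS : AEStronglyMeasurable (fun x => ∫ u, ρ u • G (a • x + c - u)) volume := by
    refine StronglyMeasurable.aestronglyMeasurable ?_
    refine StronglyMeasurable.integral_prod_right (f := fun x u => ρ u • G (a • x + c - u)) ?_
    exact (b.continuous_normed.stronglyMeasurable.comp_measurable measurable_snd).smul
      (hGm.comp_measurable (by fun_prop))
  have e : (fun x => gradient φ x - g x) =ᵐ[volume.restrict Ω]
      (a • fun x => (∫ u, ρ u • G (a • x + c - u)) - G x) - ε • G := by
    filter_upwards [ae_restrict_mem hΩm] with x hx
    simp only [Pi.sub_apply, Pi.smul_apply]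
    rw [hgrad x hx, hG, indicator_of_mem hx, ha]
    module
  rw [eLpNorm_congr_ae e]
  refine (eLpNorm_restrict_le _ 2 volume Ω).trans ?_
  refine (eLpNorm_sub_le ((hS.sub hG2.1).const_smul a) (hG2.1.const_smul ε) (by norm_num)).trans ?_
  rw [← ENNReal.add_halves δ]
  refine add_le_add ?_ ?_
  · rw [eLpNorm_const_smul]
    refine (mul_le_of_le_one_left' ?_).trans K₂
    rw [Real.enorm_eq_ofReal (by linarith), ENNReal.ofReal_le_one]
    linarith
  · rw [eLpNorm_const_smul, Real.enorm_eq_ofReal hε.le]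
    refine le_trans ?_ hκG
    gcongr

/-- The geometric rate is what makes the sequence of restrictions to the boundary summably Cauchy.
-/
theorem exists_smooth_seq {Ω : Set (E n)} (hΩ : IsOpen Ω) (hcv : Convex ℝ Ω)
    (hne : Ω.Nonempty) {v : E n → ℝ} {g : E n → E n} (hw : IsWeakGrad Ω v g) :
    ∃ φ : ℕ → E n → ℝ, (∀ k, ContDiff ℝ ∞ (φ k)) ∧
      (∀ k, eLpNorm (fun x => φ k x - v x) 2 (volume.restrict Ω) ≤ 2⁻¹ ^ k) ∧
      (∀ k, eLpNorm (fun x => gradient (φ k) x - g x) 2 (volume.restrict Ω) ≤ 2⁻¹ ^ k) := by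
  choose φ h1 h2 h3 using fun k : ℕ => exists_smooth_close hΩ hcv hne hw
    (δ := 2⁻¹ ^ k) (pow_ne_zero k (by simp))
  exact ⟨φ, h1, h2, h3⟩

end Mollification

/-! ### Trace and Poincaré inequalities for smooth functions -/

section Inequalities

variable {n : ℕ}

theorem ennreal_add_sq_le (a b : ENNReal) : (a + b) ^ 2 ≤ 4 * (a ^ 2 + b ^ 2) := by
  wlog h : a ≤ b generalizing a b
  · rw [add_comm a, add_comm (a ^ 2)]; exact this b a (le_of_not_ge h)
  calc (a + b) ^ 2 ≤ (b + b) ^ 2 := by gcongr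
    _ = 4 * b ^ 2 := by ring
    _ ≤ 4 * (a ^ 2 + b ^ 2) := by gcongr; exact le_add_self

/-- The increment of a smooth function along the second half of a segment. -/
theorem enorm_sub_sq_le {φ : E n → ℝ} (hφ : ContDiff ℝ ∞ φ) (a u : E n) {s : ℝ}
    (hs : 1 / 2 ≤ s) (hs1 : s ≤ 1) :
    ‖φ (a + u) - φ (a + s • u)‖ₑ ^ 2
      ≤ ‖u‖ₑ ^ 2 * ∫⁻ t in Ioo (1 / 2 : ℝ) 1, ‖gradient φ (a + t • u)‖ₑ ^ 2 := by
  have hd : ∀ t : ℝ, HasDerivAt (fun t : ℝ => φ (a + t • u)) (fderiv ℝ φ (a + t • u) u) t := by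
    intro t
    have h1 : HasDerivAt (fun t : ℝ => a + t • u) u t := by
      simpa using ((hasDerivAt_id t).smul_const u).const_add a
    exact ((hφ.differentiable (by simp) _).hasFDerivAt).comp_hasDerivAt t h1
  have hc : Continuous fun t : ℝ => fderiv ℝ φ (a + t • u) u :=
    ((hφ.continuous_fderiv (by simp)).comp (by fun_prop)).clm_apply continuous_const
  have hint := intervalIntegral.integral_eq_sub_of_hasDerivAt (a := s) (b := 1)
    (fun t _ => hd t) (hc.intervalIntegrable _ _)
  simp only [one_smul] at hint
  rw [← hint, intervalIntegral.integral_of_le hs1]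
  -- The interval has length at most 1, so the L¹ norm is bounded by the L² norm without a constant.
  -- Only t > 1/2 occurs, where the dilations used later have bounded inverse Jacobian.
  set μ := (volume : Measure ℝ).restrict (Ioo (1 / 2 : ℝ) 1) with hμ
  have hμ1 : μ univ ≤ 1 := by
    rw [hμ, Measure.restrict_apply_univ, Real.volume_Ioo]
    rw [ENNReal.ofReal_le_one]; norm_num
  have hg : Continuous fun t : ℝ => gradient φ (a + t • u) :=
    (continuous_gradient hφ).comp (by fun_prop)
  have h2 : ‖∫ t in Ioc s 1, fderiv ℝ φ (a + t • u) u‖ₑ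
      ≤ ‖u‖ₑ * eLpNorm (fun t : ℝ => gradient φ (a + t • u)) 1 μ := by
    refine (enorm_integral_le_lintegral_enorm _).trans ?_
    rw [eLpNorm_one_eq_lintegral_enorm, ← lintegral_const_mul' _ _ (by finiteness), hμ,
      restrict_Ioo_eq_restrict_Ioc]
    refine (lintegral_mono fun t => ?_).trans
      (lintegral_mono_set (Ioc_subset_Ioc_left hs))
    rw [← ofReal_norm, ← ofReal_norm, ← ofReal_norm, ← ENNReal.ofReal_mul (norm_nonneg _),
      norm_gradient, mul_comm]
    exact ENNReal.ofReal_le_ofReal (ContinuousLinearMap.le_opNorm _ _)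
  have h3 : eLpNorm (fun t : ℝ => gradient φ (a + t • u)) 1 μ
      ≤ eLpNorm (fun t : ℝ => gradient φ (a + t • u)) 2 μ := by
    refine (eLpNorm_le_eLpNorm_mul_rpow_measure_univ (p := 1) (q := 2) (by norm_num)
      hg.aestronglyMeasurable).trans ?_
    refine mul_le_of_le_one_right' ?_
    exact ENNReal.rpow_le_one hμ1 (by norm_num)
  rw [← eLpNorm_two_sq, ← mul_pow]
  gcongr
  exact h2.trans (by gcongr)

/-- The value at a point y of the face is compared with the value at z + s (y - z), where z is the
opposite vertex. After integration over y and over s in (1/2, 1), both the shifted value and the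
increment are integrals over the cone, bounded by `lintegral_cone_le`. -/
theorem exists_trace_inequality_face (T : Affine.Simplex ℝ (E n) n) (hn : 1 ≤ n)
    (i : Fin (n + 1)) : ∃ C : ENNReal, C ≠ ⊤ ∧ ∀ φ : E n → ℝ, ContDiff ℝ ∞ φ →
      eLpNorm φ 2 (surf (face T i)) ^ 2
        ≤ C * (eLpNorm φ 2 (vol T) ^ 2 + eLpNorm (gradient φ) 2 (vol T) ^ 2) := by
  obtain ⟨c, hc, hcone⟩ := lintegral_cone_le T hn i
  have hfin := isFiniteMeasure_surf_face T hn i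
  set z := T.points i with hz
  set D := Metric.diam (convexHull ℝ (range T.points)) with hD
  have hbd : ∀ y ∈ face T i, ‖y - z‖ₑ ≤ ENNReal.ofReal D := fun y hy => by
    rw [← ofReal_norm]
    refine ENNReal.ofReal_le_ofReal ?_
    rw [← dist_eq_norm]
    exact Metric.dist_le_diam_of_mem (isCompact_convexHull T).isBounded
      (face_subset_convexHull T i hy) (subset_convexHull ℝ _ ⟨i, rfl⟩)
  set H := ENNReal.ofReal D
  refine ⟨8 * c * (1 + H ^ 2), by finiteness, fun φ hφ => ?_⟩
  have hgc := continuous_gradient hφ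
  have hφc := hφ.continuous
  have hφm := hφc.measurable
  set A := eLpNorm φ 2 (surf (face T i)) ^ 2 with hA
  have hI : volume (Ioo (1 / 2 : ℝ) 1) = 2⁻¹ := by
    rw [Real.volume_Ioo, show (1 : ℝ) - 1 / 2 = 2⁻¹ by norm_num,
      ENNReal.ofReal_inv_of_pos (by norm_num)]; simp
  have h1 : ∀ s ∈ Ioo (1 / 2 : ℝ) 1, A ≤
      4 * ∫⁻ y, ‖φ (z + s • (y - z))‖ₑ ^ 2 ∂surf (face T i) + 4 * H ^ 2 *
        ∫⁻ y, (∫⁻ t in Ioo (1 / 2 : ℝ) 1, ‖gradient φ (z + t • (y - z))‖ₑ ^ 2) ∂surf (face T i) := by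
    intro s hs
    rw [hA, eLpNorm_two_sq, ← lintegral_const_mul' _ _ (by finiteness),
      ← lintegral_const_mul' _ _ (by finiteness), ← lintegral_add_left (by fun_prop)]
    refine lintegral_mono_ae ?_
    filter_upwards [ae_restrict_mem (isCompact_face T i).measurableSet] with y hy
    have h2 := enorm_sub_sq_le hφ z (y - z) hs.1.le hs.2.le
    rw [add_sub_cancel] at h2
    calc ‖φ y‖ₑ ^ 2 = ‖φ (z + s • (y - z)) + (φ y - φ (z + s • (y - z)))‖ₑ ^ 2 := by
          rw [add_sub_cancel]
      _ ≤ (‖φ (z + s • (y - z))‖ₑ + ‖φ y - φ (z + s • (y - z))‖ₑ) ^ 2 := by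
          gcongr; exact enorm_add_le _ _
      _ ≤ 4 * (‖φ (z + s • (y - z))‖ₑ ^ 2 + ‖φ y - φ (z + s • (y - z))‖ₑ ^ 2) :=
          ennreal_add_sq_le _ _
      _ ≤ 4 * (‖φ (z + s • (y - z))‖ₑ ^ 2 + H ^ 2 *
          ∫⁻ t in Ioo (1 / 2 : ℝ) 1, ‖gradient φ (z + t • (y - z))‖ₑ ^ 2) := by
          gcongr
          refine h2.trans ?_
          gcongr
          exact hbd y hy
      _ = _ := by ring
  have h2 : ∫⁻ y, (∫⁻ t in Ioo (1 / 2 : ℝ) 1, ‖gradient φ (z + t • (y - z))‖ₑ ^ 2)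
      ∂surf (face T i) ≤ c * eLpNorm (gradient φ) 2 (vol T) ^ 2 := by
    rw [lintegral_lintegral_swap (by
      refine Continuous.aemeasurable ?_
      unfold Function.uncurry
      fun_prop), eLpNorm_two_sq]
    exact hcone (fun x => ‖gradient φ x‖ₑ ^ 2) (by fun_prop)
  -- The left side does not depend on s; integrating over s turns the slice term into a volume
  -- integral, and 2⁻¹ is the length of the interval.
  have h3 : A * 2⁻¹ ≤ 4 * (c * eLpNorm φ 2 (vol T) ^ 2)
      + 4 * H ^ 2 * (c * eLpNorm (gradient φ) 2 (vol T) ^ 2) * 2⁻¹ := by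
    calc A * 2⁻¹ = ∫⁻ s in Ioo (1 / 2 : ℝ) 1, A := by rw [setLIntegral_const, hI]
      _ ≤ ∫⁻ s in Ioo (1 / 2 : ℝ) 1, (4 * ∫⁻ y, ‖φ (z + s • (y - z))‖ₑ ^ 2 ∂surf (face T i)
          + 4 * H ^ 2 * (c * eLpNorm (gradient φ) 2 (vol T) ^ 2)) := by
          refine setLIntegral_mono' measurableSet_Ioo fun s hs => (h1 s hs).trans ?_
          gcongr
      _ = 4 * (∫⁻ s in Ioo (1 / 2 : ℝ) 1, ∫⁻ y, ‖φ (z + s • (y - z))‖ₑ ^ 2 ∂surf (face T i))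
          + 4 * H ^ 2 * (c * eLpNorm (gradient φ) 2 (vol T) ^ 2) * 2⁻¹ := by
          rw [lintegral_add_right _ measurable_const, setLIntegral_const, hI,
            lintegral_const_mul' _ _ (by finiteness)]
      _ ≤ _ := by
          gcongr
          rw [eLpNorm_two_sq]
          exact hcone (fun x => ‖φ x‖ₑ ^ 2) (by fun_prop)
  set P := eLpNorm φ 2 (vol T) ^ 2
  set R := eLpNorm (gradient φ) 2 (vol T) ^ 2
  have h22 : (2⁻¹ : ENNReal) * 2 = 1 := ENNReal.inv_mul_cancel (by norm_num) (by norm_num)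
  calc A = A * 2⁻¹ * 2 := by rw [mul_assoc, h22, mul_one]
    _ ≤ (4 * (c * P) + 4 * H ^ 2 * (c * R) * 2⁻¹) * 2 := by gcongr
    _ = 8 * c * P + 4 * c * H ^ 2 * R * (2⁻¹ * 2) := by ring
    _ = 8 * c * P + 4 * c * H ^ 2 * R := by rw [h22, mul_one]
    _ ≤ 8 * c * P + (8 * c * H ^ 2 * P + 8 * c * R + 8 * c * H ^ 2 * R) := by
        gcongr
        refine le_add_left ?_
        gcongr
        norm_num
    _ = 8 * c * (1 + H ^ 2) * (P + R) := by ring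

/-- The trace inequality for smooth functions. -/
theorem exists_trace_inequality (T : Affine.Simplex ℝ (E n) n) (hn : 1 ≤ n) :
    ∃ C : ENNReal, C ≠ ⊤ ∧ ∀ φ : E n → ℝ, ContDiff ℝ ∞ φ →
      eLpNorm φ 2 (surf (bdry T))
        ≤ C * (eLpNorm φ 2 (vol T) + eLpNorm (gradient φ) 2 (vol T)) := by
  choose C hC h using exists_trace_inequality_face T hn
  -- Adding 1 ensures that the square of the constant dominates ∑ C i, which avoids a square root.
  refine ⟨∑ i, C i + 1, by simp [hC], fun φ hφ => ?_⟩
  refine (ENNReal.pow_le_pow_left_iff (n := 2) (by norm_num)).1 ?_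
  set P := eLpNorm φ 2 (vol T)
  set R := eLpNorm (gradient φ) 2 (vol T)
  have h1 : ∑ i, C i ≤ (∑ i, C i + 1) ^ 2 :=
    calc ∑ i, C i ≤ ∑ i, C i + 1 := le_self_add
      _ ≤ (∑ i, C i + 1) ^ 2 := le_self_pow le_add_self (by norm_num)
  calc eLpNorm φ 2 (surf (bdry T)) ^ 2 = ∑ i, eLpNorm φ 2 (surf (face T i)) ^ 2 := by
        simp only [eLpNorm_two_sq]
        rw [surf_bdry T hn, lintegral_sum_measure, tsum_fintype]
    _ ≤ ∑ i, C i * (P ^ 2 + R ^ 2) := Finset.sum_le_sum fun i _ => h i φ hφ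
    _ = (∑ i, C i) * (P ^ 2 + R ^ 2) := by rw [Finset.sum_mul]
    _ ≤ (∑ i, C i + 1) ^ 2 * (P + R) ^ 2 := by
        gcongr
        calc P ^ 2 + R ^ 2 ≤ P ^ 2 + R ^ 2 + 2 * P * R := le_self_add
          _ = (P + R) ^ 2 := by ring
    _ = _ := by rw [mul_pow]

/-- The Poincaré inequality for smooth functions. -/
theorem exists_poincare_inequality (T : Affine.Simplex ℝ (E n) n) :
    ∃ C : ENNReal, C ≠ ⊤ ∧ ∀ φ : E n → ℝ, ContDiff ℝ ∞ φ →
      eLpNorm (fun x => φ x - ⨍ y, φ y ∂vol T) 2 (vol T)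
        ≤ C * eLpNorm (gradient φ) 2 (vol T) := by
  set D := Metric.diam (elem T) with hD
  set H := ENNReal.ofReal D
  have hbd : ∀ x ∈ elem T, ∀ y ∈ elem T, ‖x - y‖ₑ ≤ H := fun x hx y hy => by
    rw [← ofReal_norm]
    refine ENNReal.ofReal_le_ofReal ?_
    rw [← dist_eq_norm]
    exact Metric.dist_le_diam_of_mem (isBounded_elem T) hx hy
  have hV0 := (vol_univ_pos T).ne'
  have hVt : vol T univ ≠ ⊤ := measure_ne_top _ _
  refine ⟨4 * H * 2 ^ n, by finiteness, fun φ hφ => ?_⟩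
  have hgc := continuous_gradient hφ
  have hφc := hφ.continuous
  set R := eLpNorm (gradient φ) 2 (vol T) with hR
  have hTm := (isOpen_elem T).measurableSet
  have hae : ∀ᵐ x ∂vol T, x ∈ elem T := ae_restrict_mem hTm
  -- The value at x is compared only with that at the midpoint of x and y. On this half of the
  -- segment the maps x ↦ t x + (1 - t) y have t ≥ 1/2.
  have h1 : ∫⁻ y, ∫⁻ x, ‖φ x - φ (y + (1 / 2 : ℝ) • (x - y))‖ₑ ^ 2 ∂vol T ∂vol T
      ≤ H ^ 2 * (2 ^ n * R) ^ 2 * vol T univ := by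
    rw [← lintegral_const]
    refine lintegral_mono_ae ?_
    filter_upwards [hae] with y hy
    calc ∫⁻ x, ‖φ x - φ (y + (1 / 2 : ℝ) • (x - y))‖ₑ ^ 2 ∂vol T
        ≤ ∫⁻ x, H ^ 2 * (∫⁻ t in Ioo (1 / 2 : ℝ) 1, ‖gradient φ (y + t • (x - y))‖ₑ ^ 2) ∂vol T := by
          refine lintegral_mono_ae ?_
          filter_upwards [hae] with x hx
          have := enorm_sub_sq_le hφ y (x - y) (s := 1 / 2) le_rfl (by norm_num)
          rw [add_sub_cancel] at this
          refine this.trans ?_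
          gcongr
          exact hbd x hx y hy
      _ = H ^ 2 * ∫⁻ t in Ioo (1 / 2 : ℝ) 1, ∫⁻ x, ‖gradient φ (y + t • (x - y))‖ₑ ^ 2 ∂vol T := by
          rw [lintegral_const_mul' _ _ (by finiteness), lintegral_lintegral_swap (by
            refine Continuous.aemeasurable ?_
            unfold Function.uncurry
            fun_prop)]
      _ ≤ H ^ 2 * ∫⁻ t in Ioo (1 / 2 : ℝ) 1, (2 ^ n * R) ^ 2 := by
          gcongr 1
          refine setLIntegral_mono' measurableSet_Ioo fun t ht => ?_
          rw [← eLpNorm_two_sq]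
          gcongr
          -- Extension by zero makes the dilation bound on the whole space applicable; by convexity
          -- the dilated point remains in the element.
          have e1 : eLpNorm ((elem T).indicator (gradient φ)) 2 volume = R := by
            rw [eLpNorm_indicator_eq_eLpNorm_restrict hTm]; rfl
          have e2 := eLpNorm_comp_dilation_le
            (f := (elem T).indicator (gradient φ)) (hgc.aestronglyMeasurable.indicator hTm)
            ht.1.le ((1 - t) • y)
          rw [e1] at e2
          refine le_trans (le_of_eq ?_) ((eLpNorm_restrict_le _ 2 volume (elem T)).trans e2)
          refine eLpNorm_congr_ae ?_
          filter_upwards [hae] with x hx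
          have e3 : y + t • (x - y) = t • x + (1 - t) • y := by module
          rw [e3, indicator_of_mem]
          exact convex_elem T hx hy (by linarith [ht.1]) (by linarith [ht.2]) (by ring)
      _ ≤ H ^ 2 * (2 ^ n * R) ^ 2 := by
          rw [setLIntegral_const]
          gcongr
          refine mul_le_of_le_one_right' ?_
          rw [Real.volume_Ioo, ENNReal.ofReal_le_one]; norm_num
  -- The midpoint is symmetric in x and y, so the second half of the segment contributes the same
  -- integral with the variables exchanged.
  have h2 : ∫⁻ y, ∫⁻ x, ‖φ x - φ y‖ₑ ^ 2 ∂vol T ∂vol T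
      ≤ 8 * (H ^ 2 * (2 ^ n * R) ^ 2 * vol T univ) := by
    calc ∫⁻ y, ∫⁻ x, ‖φ x - φ y‖ₑ ^ 2 ∂vol T ∂vol T
        ≤ ∫⁻ y, ∫⁻ x, (4 * ‖φ x - φ (y + (1 / 2 : ℝ) • (x - y))‖ₑ ^ 2
          + 4 * ‖φ y - φ (x + (1 / 2 : ℝ) • (y - x))‖ₑ ^ 2) ∂vol T ∂vol T := by
          refine lintegral_mono fun y => lintegral_mono fun x => ?_
          have e : y + (1 / 2 : ℝ) • (x - y) = x + (1 / 2 : ℝ) • (y - x) := by module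
          simp only
          rw [← mul_add, e]
          refine le_trans ?_ (ennreal_add_sq_le _ _)
          gcongr
          rw [show φ x - φ y = (φ x - φ (x + (1 / 2 : ℝ) • (y - x)))
            - (φ y - φ (x + (1 / 2 : ℝ) • (y - x))) by ring]
          exact enorm_sub_le
      _ = 4 * (∫⁻ y, ∫⁻ x, ‖φ x - φ (y + (1 / 2 : ℝ) • (x - y))‖ₑ ^ 2 ∂vol T ∂vol T)
          + 4 * ∫⁻ y, ∫⁻ x, ‖φ y - φ (x + (1 / 2 : ℝ) • (y - x))‖ₑ ^ 2 ∂vol T ∂vol T := by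
          rw [← lintegral_const_mul' _ _ (by finiteness),
            ← lintegral_const_mul' _ _ (by finiteness), ← lintegral_add_left]
          · refine lintegral_congr fun y => ?_
            rw [← lintegral_const_mul' _ _ (by finiteness),
              ← lintegral_const_mul' _ _ (by finiteness), ← lintegral_add_left (by fun_prop)]
          · refine Measurable.const_mul (Measurable.lintegral_prod_right' (f := fun q : E n × E n =>
              ‖φ q.2 - φ (q.1 + (1 / 2 : ℝ) • (q.2 - q.1))‖ₑ ^ 2) (by fun_prop)) _
      _ = 8 * ∫⁻ y, ∫⁻ x, ‖φ x - φ (y + (1 / 2 : ℝ) • (x - y))‖ₑ ^ 2 ∂vol T ∂vol T := by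
          rw [lintegral_lintegral_swap (f := fun y x => ‖φ y - φ (x + (1 / 2 : ℝ) • (y - x))‖ₑ ^ 2)
            (by
            refine Continuous.aemeasurable ?_
            unfold Function.uncurry
            fun_prop)]
          ring
      _ ≤ _ := by gcongr
  set ν : Measure (E n) := (vol T univ)⁻¹ • vol T with hν
  have hνp : IsProbabilityMeasure ν := ⟨by
    rw [hν, Measure.smul_apply, smul_eq_mul, ENNReal.inv_mul_cancel hV0 hVt]⟩
  have hφi : Integrable φ (vol T) := (memLp_vol T hφc).integrable (by norm_num)
  have hφν : Integrable φ ν := hφi.smul_measure (ENNReal.inv_ne_top.2 hV0)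
  -- The deviation from the mean is an average of differences, and Jensen's inequality reduces it to
  -- the double integral.
  have h3 : ∀ x, φ x - ⨍ y, φ y ∂vol T = ∫ y, (φ x - φ y) ∂ν := fun x => by
    rw [integral_sub (integrable_const _) hφν, integral_const, probReal_univ, one_smul, average]
  refine (ENNReal.pow_le_pow_left_iff (n := 2) (by norm_num)).1 ?_
  rw [eLpNorm_two_sq]
  calc ∫⁻ x, ‖φ x - ⨍ y, φ y ∂vol T‖ₑ ^ 2 ∂vol T
      ≤ ∫⁻ x, ∫⁻ y, ‖φ x - φ y‖ₑ ^ 2 ∂ν ∂vol T := by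
        refine lintegral_mono fun x => ?_
        rw [h3]
        exact enorm_integral_sq_le (by fun_prop)
    _ = (vol T univ)⁻¹ * ∫⁻ y, ∫⁻ x, ‖φ x - φ y‖ₑ ^ 2 ∂vol T ∂vol T := by
        rw [lintegral_lintegral_swap (by
          refine Continuous.aemeasurable ?_
          unfold Function.uncurry
          fun_prop), hν, lintegral_smul_measure, smul_eq_mul]
    _ ≤ (vol T univ)⁻¹ * (8 * (H ^ 2 * (2 ^ n * R) ^ 2 * vol T univ)) := by gcongr
    _ = 8 * (H * 2 ^ n * R) ^ 2 * ((vol T univ)⁻¹ * vol T univ) := by ring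
    _ = 8 * (H * 2 ^ n * R) ^ 2 := by rw [ENNReal.inv_mul_cancel hV0 hVt, mul_one]
    _ ≤ 16 * (H * 2 ^ n * R) ^ 2 := by gcongr; norm_num
    _ = (4 * H * 2 ^ n * R) ^ 2 := by ring

end Inequalities

/-! ### Traces -/

section Traces

variable {n : ℕ}

/-- By the trace inequality, smooth functions that converge in H¹ are Cauchy in L²(∂T); the limit
there is the trace. -/
theorem exists_isTrace (T : Affine.Simplex ℝ (E n) n) (hn : 1 ≤ n) {v : E n → ℝ}
    (hv : MemH1 (elem T) v) : ∃ w, IsTrace T v w := by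
  have hw := hv.isWeakGrad
  obtain ⟨φ, hφ, h1, h2⟩ := exists_smooth_seq (isOpen_elem T) (convex_elem T)
    (nonempty_elem T) hw
  obtain ⟨C, hC, htr⟩ := exists_trace_inequality T hn
  have hvT : MemLp v 2 (vol T) := hw.memLp_fun
  have hgT : MemLp (weakGrad (elem T) v) 2 (vol T) := hw.memLp_grad
  have hdiff : ∀ N k m : ℕ, N ≤ k → N ≤ m →
      eLpNorm (φ k - φ m) 2 (vol T) ≤ 2 * 2⁻¹ ^ N ∧
      eLpNorm (gradient fun x => φ k x - φ m x) 2 (vol T) ≤ 2 * 2⁻¹ ^ N := by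
    intro N k m hk hm
    have hp : ∀ j, N ≤ j → (2⁻¹ : ENNReal) ^ j ≤ 2⁻¹ ^ N := fun j hj =>
      pow_le_pow_right_of_le_one' (by simp) hj
    constructor
    · have e : φ k - φ m = (φ k - v) - (φ m - v) := by abel
      rw [e, two_mul]
      refine (eLpNorm_sub_le ((memLp_vol T (hφ k).continuous).sub hvT).1
        ((memLp_vol T (hφ m).continuous).sub hvT).1 (by norm_num)).trans ?_
      exact add_le_add ((h1 k).trans (hp k hk)) ((h1 m).trans (hp m hm))
    · have e : (gradient fun x => φ k x - φ m x) = (gradient (φ k) - weakGrad (elem T) v)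
          - (gradient (φ m) - weakGrad (elem T) v) := by
        ext1 x
        rw [gradient_sub (hφ k) (hφ m)]
        simp only [Pi.sub_apply]; abel
      rw [e, two_mul]
      refine (eLpNorm_sub_le ((memLp_vol T (continuous_gradient (hφ k))).sub hgT).1
        ((memLp_vol T (continuous_gradient (hφ m))).sub hgT).1 (by norm_num)).trans ?_
      exact add_le_add ((h2 k).trans (hp k hk)) ((h2 m).trans (hp m hm))
  obtain ⟨w, hwm, hwl⟩ := Lp.cauchy_complete_eLpNorm (p := 2) (μ := surf (bdry T)) (f := φ)
    (by norm_num) (fun k => memLp_surf T hn (hφ k).continuous)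
    -- The extra 1 provides the strict inequality in the completeness criterion.
    (B := fun N => (C * 4 + 1) * 2⁻¹ ^ N) (by
      rw [ENNReal.tsum_mul_left, ENNReal.tsum_geometric]
      exact ENNReal.mul_ne_top (by finiteness) (by simp)) (by
      intro N k m hk hm
      have h3 := htr (fun x => φ k x - φ m x) ((hφ k).sub (hφ m))
      obtain ⟨h4, h5⟩ := hdiff N k m hk hm
      have h6 : (2⁻¹ : ENNReal) ^ N ≠ 0 := pow_ne_zero _ (by simp)
      have h7 : (2⁻¹ : ENNReal) ^ N ≠ ⊤ := ENNReal.pow_ne_top (by simp)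
      calc eLpNorm (φ k - φ m) 2 (surf (bdry T)) ≤ _ := h3
        _ ≤ C * (2 * 2⁻¹ ^ N + 2 * 2⁻¹ ^ N) := by gcongr; exact h4
        _ = C * 4 * 2⁻¹ ^ N := by ring
        _ < C * 4 * 2⁻¹ ^ N + 2⁻¹ ^ N := ENNReal.lt_add_right (by finiteness) h6
        _ = _ := by ring)
  have h0 : Tendsto (fun k : ℕ => (2⁻¹ : ENNReal) ^ k) atTop (𝓝 0) :=
    ENNReal.tendsto_pow_atTop_nhds_zero_of_lt_one (by
      rw [ENNReal.inv_lt_one]; norm_num)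
  exact ⟨w, hv, hwm, φ, hφ, tendsto_of_tendsto_of_tendsto_of_le_of_le tendsto_const_nhds h0
    (fun _ => zero_le) h1, tendsto_of_tendsto_of_tendsto_of_le_of_le tendsto_const_nhds h0
    (fun _ => zero_le) h2, hwl⟩

theorem IsTrace.sub {T : Affine.Simplex ℝ (E n) n} (hn : 1 ≤ n) {v v' w w' : E n → ℝ}
    (h : IsTrace T v w) (h' : IsTrace T v' w') : IsTrace T (v - v') (w - w') := by
  obtain ⟨hv, hw, φ, hφ, h1, h2, h3⟩ := h
  obtain ⟨hv', hw', φ', hφ', h1', h2', h3'⟩ := h'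
  have hs := hv.isWeakGrad.sub hv'.isWeakGrad
  have key : ∀ {F : Type} [NormedAddCommGroup F] {μ : Measure (E n)} {f f' : ℕ → E n → F}
      {a b : E n → F}, (∀ k, MemLp (f k) 2 μ) → (∀ k, MemLp (f' k) 2 μ) → MemLp a 2 μ →
      MemLp b 2 μ → Tendsto (fun k => eLpNorm (fun x => f k x - a x) 2 μ) atTop (𝓝 0) →
      Tendsto (fun k => eLpNorm (fun x => f' k x - b x) 2 μ) atTop (𝓝 0) →
      Tendsto (fun k => eLpNorm (fun x => (f k x - f' k x) - (a x - b x)) 2 μ) atTop (𝓝 0) := by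
    intro F _ μ f f' a b hf hf' ha hb t t'
    have t2 := t.add t'
    rw [add_zero] at t2
    refine tendsto_of_tendsto_of_tendsto_of_le_of_le tendsto_const_nhds t2
      (fun _ => zero_le) fun k => ?_
    have e : (fun x => (f k x - f' k x) - (a x - b x))
        = (fun x => f k x - a x) - fun x => f' k x - b x := by
      ext1 x; simp only [Pi.sub_apply]; abel
    simp only
    rw [e]
    exact eLpNorm_sub_le ((hf k).sub ha).1 ((hf' k).sub hb).1 (by norm_num)
  refine ⟨⟨_, hs⟩, hw.sub hw', fun k x => φ k x - φ' k x, fun k => (hφ k).sub (hφ' k), ?_, ?_, ?_⟩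
  · exact key (fun k => memLp_vol T (hφ k).continuous) (fun k => memLp_vol T (hφ' k).continuous)
      hv.isWeakGrad.memLp_fun hv'.isWeakGrad.memLp_fun h1 h1'
  · have := key (fun k => memLp_vol T (continuous_gradient (hφ k)))
      (fun k => memLp_vol T (continuous_gradient (hφ' k)))
      hv.isWeakGrad.memLp_grad hv'.isWeakGrad.memLp_grad h2 h2'
    refine this.congr fun k => eLpNorm_congr_ae ?_
    filter_upwards [hs.weakGrad_ae (isOpen_elem T)] with x hx
    rw [hx, gradient_sub (hφ k) (hφ' k)]
    rfl
  · exact key (fun k => memLp_surf T hn (hφ k).continuous)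
      (fun k => memLp_surf T hn (hφ' k).continuous) hw hw' h3 h3'

theorem isTrace_of_contDiff (T : Affine.Simplex ℝ (E n) n) (hn : 1 ≤ n) {φ : E n → ℝ}
    (hφ : ContDiff ℝ ∞ φ) : IsTrace T φ φ := by
  refine ⟨memH1_of_contDiff T hφ, memLp_surf T hn hφ.continuous, fun _ => φ, fun _ => hφ, ?_, ?_, ?_⟩
  · simp
  · have : eLpNorm (fun x => gradient φ x - weakGrad (elem T) φ x) 2 (vol T) = 0 := by
      rw [← eLpNorm_zero (p := 2) (μ := vol T) (ε := E n)]
      refine eLpNorm_congr_ae ?_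
      filter_upwards [(isWeakGrad_gradient T hφ).weakGrad_ae (isOpen_elem T)] with x hx
      rw [hx, sub_self]; rfl
    simp only [this]; exact tendsto_const_nhds
  · simp

/-- If v vanishes, so does its weak gradient. The approximants then tend to 0 in H¹, and by the
trace inequality also on the boundary. Applied to differences, this shows that traces are unique and
depend only on the class of v. -/
theorem IsTrace.ae_eq_zero {T : Affine.Simplex ℝ (E n) n} (hn : 1 ≤ n) {v w : E n → ℝ}
    (h : IsTrace T v w) (hv0 : v =ᵐ[vol T] 0) : w =ᵐ[surf (bdry T)] 0 := by
  obtain ⟨hv, hw, φ, hφ, h1, h2, h3⟩ := h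
  obtain ⟨C, hC, htr⟩ := exists_trace_inequality T hn
  have hg : weakGrad (elem T) v =ᵐ[vol T] 0 := by
    have hz : IsWeakGrad (elem T) v 0 := by
      have : IsWeakGrad (elem T) (v - v) (weakGrad (elem T) v - weakGrad (elem T) v) :=
        hv.isWeakGrad.sub hv.isWeakGrad
      rw [sub_self, sub_self] at this
      exact this.congr hv0.symm
    exact hz.weakGrad_ae (isOpen_elem T)
  have e1 : ∀ k, eLpNorm (fun x => φ k x - v x) 2 (vol T) = eLpNorm (φ k) 2 (vol T) := fun k =>
    eLpNorm_congr_ae (by filter_upwards [hv0] with x hx; rw [hx]; simp)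
  have e2 : ∀ k, eLpNorm (fun x => gradient (φ k) x - weakGrad (elem T) v x) 2 (vol T)
      = eLpNorm (gradient (φ k)) 2 (vol T) := fun k =>
    eLpNorm_congr_ae (by filter_upwards [hg] with x hx; rw [hx]; simp)
  simp only [e1] at h1
  simp only [e2] at h2
  have t : Tendsto (fun k => C * (eLpNorm (φ k) 2 (vol T) + eLpNorm (gradient (φ k)) 2 (vol T))
      + eLpNorm (fun x => φ k x - w x) 2 (surf (bdry T))) atTop (𝓝 0) := by
    have := (ENNReal.Tendsto.const_mul (h1.add h2) (Or.inr hC)).add h3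
    simpa using this
  have hle : ∀ k, eLpNorm w 2 (surf (bdry T)) ≤
      C * (eLpNorm (φ k) 2 (vol T) + eLpNorm (gradient (φ k)) 2 (vol T))
      + eLpNorm (fun x => φ k x - w x) 2 (surf (bdry T)) := fun k => by
    have e : w = φ k - fun x => φ k x - w x := by ext x; simp
    have hm := memLp_surf T hn (hφ k).continuous
    calc eLpNorm w 2 (surf (bdry T)) = eLpNorm (φ k - fun x => φ k x - w x) 2 (surf (bdry T)) := by
          rw [← e]
      _ ≤ eLpNorm (φ k) 2 (surf (bdry T)) + eLpNorm (fun x => φ k x - w x) 2 (surf (bdry T)) :=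
          eLpNorm_sub_le hm.1 (hm.sub hw).1 (by norm_num)
      _ ≤ _ := by gcongr; exact htr _ (hφ k)
  have h0 := le_antisymm (ge_of_tendsto' t hle) zero_le
  rwa [eLpNorm_eq_zero_iff hw.1 (by norm_num)] at h0

theorem isTrace_trace (T : Affine.Simplex ℝ (E n) n) (hn : 1 ≤ n) {v : E n → ℝ}
    (hv : MemH1 (elem T) v) : IsTrace T v (trace T v) := by
  have h := exists_isTrace T hn hv
  rw [trace, dif_pos h]
  exact h.choose_spec

theorem IsTrace.trace_ae {T : Affine.Simplex ℝ (E n) n} (hn : 1 ≤ n) {v w : E n → ℝ}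
    (h : IsTrace T v w) : trace T v =ᵐ[surf (bdry T)] w := by
  have := ((isTrace_trace T hn h.1).sub hn h).ae_eq_zero hn (by rw [sub_self])
  filter_upwards [this] with x hx
  simpa [sub_eq_zero] using hx

end Traces

/-! ### Dual bases and moments -/

section Moments

variable {n p : ℕ}

/-- A polynomial that vanishes on a line near one of its points vanishes on this line. -/
theorem eq_zero_of_eventually_line {m : ℕ} {q : E n → ℝ} (hq : q ∈ polyFun n m) {x y : E n}
    (h : ∀ᶠ t in 𝓝 (0 : ℝ), q (y + t • (x - y)) = 0) : q x = 0 := by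
  have ha : AnalyticOnNhd ℝ (fun t : ℝ => q (y + t • (x - y))) univ := by
    refine polyFun_induction
      (motive := fun _ q => AnalyticOnNhd ℝ (fun t : ℝ => q (y + t • (x - y))) univ)
      (fun c => analyticOnNhd_const) (fun _ f g hf hg => hf.add hg) (fun _ f hf => hf)
      (fun m i f _ hf => AnalyticOnNhd.mul (fun t _ => ?_) hf) hq
    simp only [PiLp.add_apply, PiLp.smul_apply, smul_eq_mul]
    fun_prop
  have := ha.eq_of_eventuallyEq (g := fun _ => 0) analyticOnNhd_const (z₀ := 0) h
  simpa using congrFun this 1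

theorem integrable_surf_face (T : Affine.Simplex ℝ (E n) n) (hn : 1 ≤ n) (i : Fin (n + 1))
    {f : E n → ℝ} (hf : Continuous f) : Integrable f (surf (face T i)) :=
  haveI := isFiniteMeasure_surf_face T hn i
  (memLp_surf_face T hn i hf).integrable (by norm_num)

theorem integrable_vol (T : Affine.Simplex ℝ (E n) n)
    {f : E n → ℝ} (hf : Continuous f) : Integrable f (vol T) :=
  (memLp_vol T hf).integrable (by norm_num)

theorem continuous_of_mem_polyFun {m : ℕ} {q : E n → ℝ} (hq : q ∈ polyFun n m) : Continuous q :=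
  (contDiff_of_mem_polyFun hq).continuous

theorem continuous_etaF (T : Affine.Simplex ℝ (E n) n) (i : Fin (n + 1)) : Continuous (etaF T i) :=
  continuous_of_mem_polyFun (etaF_mem_polyFun T i)

theorem continuous_etaT (T : Affine.Simplex ℝ (E n) n) : Continuous (etaT T) :=
  continuous_of_mem_polyFun (etaT_mem_polyFun T)

/-- The weight is positive in the relative interior of the face, so q vanishes on the face. Analytic
continuation along lines through the barycentre reaches the whole hyperplane, as needed to factor
out the barycentric coordinate. -/
theorem eq_zero_of_integral_etaF (T : Affine.Simplex ℝ (E n) n) (hn : 1 ≤ n) (i : Fin (n + 1))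
    {q : E n → ℝ} (hq : q ∈ polyFun n p)
    (h : ∫ x, q x * (etaF T i x * q x) ∂surf (face T i) = 0) {x : E n} (hx : etaV T i x = 0) :
    q x = 0 := by
  have hqc := continuous_of_mem_polyFun hq
  have hec := continuous_etaF T i
  have hc : Continuous fun x => q x * (etaF T i x * q x) := by fun_prop
  rw [integral_eq_zero_iff_of_nonneg_ae ?_ (integrable_surf_face T hn i hc)] at h
  · have h0 := eq_zero_on_face T hn i hc h
    obtain ⟨y, hy, hy'⟩ := exists_face_center T hn i
    refine eq_zero_of_eventually_line hq (y := y) ?_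
    have h1 : ∀ᶠ t in 𝓝 (0 : ℝ), ∀ j, j ≠ i → 0 < etaV T j (y + t • (x - y)) := by
      rw [eventually_all]
      intro j
      by_cases hj : j = i
      · exact Eventually.of_forall fun t h => absurd hj h
      have hcj : Continuous fun t : ℝ => etaV T j (y + t • (x - y)) :=
        (continuous_etaV T j).comp (by fun_prop)
      filter_upwards [(hcj.tendsto 0).eventually_const_lt (u := 0) (by simpa using hy' j hj)]
        with t ht _ using ht
    filter_upwards [h1] with t ht
    have hi : etaV T i (y + t • (x - y)) = 0 := by rw [etaV_lineMap, hx, hy]; ring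
    have hm : y + t • (x - y) ∈ face T i := by
      rw [face_eq]
      refine ⟨hi, fun j => ?_⟩
      by_cases hj : j = i
      · rw [hj, hi]
      · exact (ht j hj).le
    have hp : 0 < etaF T i (y + t • (x - y)) :=
      Finset.prod_pos fun j hj => ht j (Finset.ne_of_mem_erase hj)
    have := h0 _ hm
    simpa [hp.ne'] using this
  · filter_upwards [ae_restrict_mem (isCompact_face T i).measurableSet] with x hx
    have := mul_nonneg (etaF_nonneg T (k := i) hx) (mul_self_nonneg (q x))
    simp only [Pi.zero_apply]
    linarith

theorem eq_zero_of_integral_etaT (T : Affine.Simplex ℝ (E n) n)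
    {q : E n → ℝ} (hq : q ∈ polyFun n p)
    (h : ∫ x, q x * (etaT T x * q x) ∂vol T = 0) (x : E n) : q x = 0 := by
  have hqc := continuous_of_mem_polyFun hq
  have hec := continuous_etaT T
  have hc : Continuous fun x => q x * (etaT T x * q x) := by fun_prop
  rw [integral_eq_zero_iff_of_nonneg_ae ?_ (integrable_vol T hc)] at h
  · have h0 := eq_zero_on_elem T hc h
    obtain ⟨y, hy⟩ := nonempty_elem T
    refine eq_zero_of_eventually_line hq (y := y) ?_
    have hcl : Continuous fun t : ℝ => y + t • (x - y) := by fun_prop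
    filter_upwards [hcl.tendsto 0 ((isOpen_elem T).mem_nhds (by simpa using hy))] with t ht
    have := h0 _ ht
    simpa [(etaT_pos T ht).ne'] using this
  · filter_upwards [ae_restrict_mem (isOpen_elem T).measurableSet] with x hx
    have := mul_nonneg (etaT_pos T hx).le (mul_self_nonneg (q x))
    simp only [Pi.zero_apply]
    linarith

theorem sum_smul_apply {d : ℕ} (a : Fin d → ℝ) (t : Fin d → E n → ℝ) (x : E n) :
    (∑ j, a j • t j) x = ∑ j, a j * t j x := by simp [Finset.sum_apply]

/-- Existence of dual functions with respect to a weighted inner product. -/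
theorem exists_dual_functions {d : ℕ} {μ : Measure (E n)}
    (hI : ∀ f : E n → ℝ, Continuous f → Integrable f μ) {η : E n → ℝ} (hη : Continuous η)
    {S : Set (E n)}
    (hpos : ∀ q ∈ polyFun n p, ∫ x, q x * (η x * q x) ∂μ = 0 → ∀ x ∈ S, q x = 0)
    {t : Fin d → E n → ℝ} (ht : ∀ j, t j ∈ polyFun n p)
    (hli : LinearIndependent ℝ fun j => restrictTo S (t j)) (c : ℝ) :
    ∃ χ : Fin d → E n → ℝ, (∀ j, χ j ∈ polyFun n p) ∧
      ∀ j k, ∫ x, χ j x * (η x * t k x) ∂μ = if j = k then c else 0 := by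
  have htc := fun j => continuous_of_mem_polyFun (ht j)
  have hint : ∀ j k, Integrable (fun x => t j x * (η x * t k x)) μ := fun j k =>
    hI _ ((htc j).mul (hη.mul (htc k)))
  -- The weighted Gram matrix. If aᵀG = 0, then aᵀG a = ∫ η q² = 0 for q = ∑ a_j t_j, so q vanishes
  -- on `S` and independence gives a = 0.
  let G : Matrix (Fin d) (Fin d) ℝ := Matrix.of fun j k => ∫ x, t j x * (η x * t k x) ∂μ
  have hsum : ∀ (a : Fin d → ℝ) k, ∫ x, (∑ j, a j • t j) x * (η x * t k x) ∂μ
      = ∑ j, a j * G j k := by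
    intro a k
    simp only [sum_smul_apply, Finset.sum_mul, mul_assoc]
    rw [integral_finsetSum _ fun j _ => (hint j k).const_mul (a j)]
    simp only [integral_const_mul, G, Matrix.of_apply]
  have hmem : ∀ a : Fin d → ℝ, ∑ j, a j • t j ∈ polyFun n p := fun a =>
    sum_mem fun j _ => Submodule.smul_mem _ _ (ht j)
  have hG : IsUnit G := by
    rw [← Matrix.vecMul_injective_iff_isUnit]
    refine (injective_iff_map_eq_zero G.vecMulLinear).2 fun a ha => ?_
    have h1 : ∫ x, (∑ j, a j • t j) x * (η x * (∑ j, a j • t j) x) ∂μ = 0 := by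
      have e : ∀ x, (∑ j, a j • t j) x * (η x * (∑ j, a j • t j) x)
          = ∑ k, a k * ((∑ j, a j • t j) x * (η x * t k x)) := fun x => by
        conv_lhs => rw [sum_smul_apply a t x]
        rw [sum_smul_apply]
        simp only [Finset.mul_sum]
        refine Finset.sum_congr rfl fun k _ => by ring
      simp only [e]
      have hc : Continuous (∑ j, a j • t j) := continuous_of_mem_polyFun (hmem a)
      have hi : ∀ k, Integrable (fun x => a k * ((∑ j, a j • t j) x * (η x * t k x))) μ :=
        fun k => (hI _ (hc.mul (hη.mul (htc k)))).const_mul (a k)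
      rw [integral_finsetSum _ fun k _ => hi k]
      refine Finset.sum_eq_zero fun k _ => ?_
      rw [integral_const_mul, hsum]
      have := congrFun ha k
      simp only [Matrix.vecMulLinear_apply, Matrix.vecMul, dotProduct, Pi.zero_apply] at this
      rw [this, mul_zero]
    have h2 := hpos _ (hmem a) h1
    have h3 : ∑ j, a j • restrictTo S (t j) = 0 := by
      ext x
      have := h2 x x.2
      rw [sum_smul_apply] at this
      simpa [Finset.sum_apply, restrictTo, LinearMap.funLeft] using this
    ext j
    exact Fintype.linearIndependent_iff.1 hli a h3 j
  -- Rows of c G⁻¹ turn the Gram matrix into c times the identity.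
  refine ⟨fun j => ∑ l, (c * G⁻¹ j l) • t l, fun j => hmem _, fun j k => ?_⟩
  rw [hsum]
  simp only [mul_assoc]
  rw [← Finset.mul_sum]
  have := congrFun (congrFun (Matrix.nonsing_inv_mul G (G.isUnit_iff_isUnit_det.1 hG)) j) k
  rw [Matrix.mul_apply, Matrix.one_apply] at this
  rw [this]
  split_ifs <;> simp

/-- Correction by dual functions removes all moments. -/
theorem integral_sub_correction_eq_zero {S : Set (E n)} {μ : Measure (E n)} (hS : ∀ᵐ x ∂μ, x ∈ S)
    (hI : ∀ f : E n → ℝ, Continuous f → Integrable f μ) {η : E n → ℝ} (hη : Continuous η)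
    {d : ℕ} (hd : d = Module.finrank ℝ (polyOn p S)) {t χ : Fin d → E n → ℝ}
    (ht : ∀ j, t j ∈ polyFun n p) (hχ : ∀ j, χ j ∈ polyFun n p) {c : ℝ} (hc : c ≠ 0)
    (hdual : ∀ j k, ∫ x, χ j x * (η x * t k x) ∂μ = if j = k then c else 0)
    {f : E n → ℝ} (hf : ∀ q : E n → ℝ, Continuous q → Integrable (fun x => q x * f x) μ)
    {q : E n → ℝ} (hq : q ∈ polyFun n p) :
    ∫ x, q x * (f x - ∑ j, (∫ y, χ j y * f y ∂μ) / (∫ y, χ j y * (η y * t j y) ∂μ)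
      * (η x * t j x)) ∂μ = 0 := by
  have htc := fun j => continuous_of_mem_polyFun (ht j)
  have hχc := fun j => continuous_of_mem_polyFun (hχ j)
  let r : Fin d → polyOn p S := fun j => ⟨restrictTo S (χ j), χ j, hχ j, rfl⟩
  have hfin : Module.Finite ℝ (polyOn p S) := by unfold polyOn; infer_instance
  -- Duality with c ≠ 0 makes the χ_j independent on `S`. As their number is the dimension of the
  -- polynomial space on `S`, they span it, and it suffices to test with them.
  have hli : LinearIndependent ℝ r := by
    rw [Fintype.linearIndependent_iff]
    intro a ha k
    have h1 : ∀ x ∈ S, ∑ j, a j * χ j x = 0 := fun x hx => by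
      have := congrFun (congrArg Subtype.val ha) ⟨x, hx⟩
      simpa [r, Finset.sum_apply, restrictTo, LinearMap.funLeft] using this
    have h2 : ∫ x, ∑ j, a j * (χ j x * (η x * t k x)) ∂μ = 0 := by
      rw [← integral_zero (E n) ℝ (μ := μ)]
      refine integral_congr_ae ?_
      filter_upwards [hS] with x hx
      have := h1 x hx
      simp only [← mul_assoc] at this ⊢
      rw [← Finset.sum_mul, ← Finset.sum_mul, this]; simp
    have hi : ∀ j, Integrable (fun x => a j * (χ j x * (η x * t k x))) μ :=
      fun j => (hI _ ((hχc j).mul (hη.mul (htc k)))).const_mul (a j)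
    rw [integral_finsetSum _ fun j _ => hi j] at h2
    simp only [integral_const_mul, hdual] at h2
    simpa [hc] using h2
  have hspan := hli.span_eq_top_of_card_eq_finrank' (by simp [hd])
  have hqs : (⟨restrictTo S q, q, hq, rfl⟩ : polyOn p S) ∈ Submodule.span ℝ (range r) := by
    rw [hspan]; trivial
  obtain ⟨a, ha⟩ := (Submodule.mem_span_range_iff_exists_fun ℝ).1 hqs
  have h1 : ∀ x ∈ S, q x = ∑ j, a j * χ j x := fun x hx => by
    have := congrFun (congrArg Subtype.val ha) ⟨x, hx⟩
    simp only [r] at this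
    simpa [Finset.sum_apply, restrictTo, LinearMap.funLeft] using this.symm
  set α : Fin d → ℝ := fun j => (∫ y, χ j y * f y ∂μ) / (∫ y, χ j y * (η y * t j y) ∂μ)
  have hα : ∀ j, α j * c = ∫ y, χ j y * f y ∂μ := fun j => by
    simp only [α, hdual, if_true]
    field_simp
  have e : (fun x => q x * (f x - ∑ j, α j * (η x * t j x))) =ᵐ[μ]
      fun x => ∑ k, a k * (χ k x * f x - ∑ j, α j * (χ k x * (η x * t j x))) := by
    filter_upwards [hS] with x hx
    rw [h1 x hx, Finset.sum_mul]
    refine Finset.sum_congr rfl fun k _ => ?_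
    rw [mul_assoc, mul_sub, Finset.mul_sum]
    congr 2
    refine Finset.sum_congr rfl fun j _ => by ring
  have i0 : ∀ k j, Integrable (fun x => α j * (χ k x * (η x * t j x))) μ := fun k j =>
    (hI _ ((hχc k).mul (hη.mul (htc j)))).const_mul (α j)
  have i1 : ∀ k, Integrable (fun x => ∑ j, α j * (χ k x * (η x * t j x))) μ := fun k =>
    integrable_finsetSum _ fun j _ => i0 k j
  have i2 : ∀ k, Integrable
      (fun x => a k * (χ k x * f x - ∑ j, α j * (χ k x * (η x * t j x)))) μ := fun k =>
    ((hf _ (hχc k)).sub (i1 k)).const_mul (a k)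
  rw [integral_congr_ae e, integral_finsetSum _ fun k _ => i2 k]
  refine Finset.sum_eq_zero fun k _ => ?_
  rw [integral_const_mul, integral_sub (hf _ (hχc k)) (i1 k),
    integral_finsetSum _ fun j _ => i0 k j]
  simp only [integral_const_mul, hdual]
  simp [hα]

theorem surf_face_univ_pos (T : Affine.Simplex ℝ (E n) n) (hn : 1 ≤ n) (i : Fin (n + 1)) :
    0 < (surf (face T i)).real univ := by
  have := isFiniteMeasure_surf_face T hn i
  rw [measureReal_def, ENNReal.toReal_pos_iff]
  refine ⟨pos_iff_ne_zero.2 fun h => ?_, measure_lt_top _ _⟩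
  obtain ⟨y, hy, hy'⟩ := exists_face_center T hn i
  rw [Measure.measure_univ_eq_zero] at h
  have := eq_zero_on_face T hn i (f := fun _ => 1) continuous_const (by rw [h]; rfl) y (by
    rw [face_eq]
    refine ⟨hy, fun j => ?_⟩
    by_cases hj : j = i
    · rw [hj, hy]
    · exact (hy' j hj).le)
  exact one_ne_zero this

theorem vol_real_univ_pos (T : Affine.Simplex ℝ (E n) n) : 0 < (vol T).real univ :=
  ENNReal.toReal_pos (vol_univ_pos T).ne' (measure_ne_top _ _)

theorem nonempty_dualBases {T : Affine.Simplex ℝ (E n) n} (hn : 1 ≤ n) (B : Bases T p) :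
    Nonempty (DualBases B) := by
  choose χF hF hF' using fun i => exists_dual_functions (p := p)
    (fun f hf => integrable_surf_face T hn i hf) (continuous_etaF T i) (S := face T i)
    (fun q hq h x hx => eq_zero_of_integral_etaF T hn i hq h (by rw [face_eq] at hx; exact hx.1))
    (B.tchiF_mem i) (B.tchiF_indep i) ((surf (face T i)).real univ)
  obtain ⟨χT, hT, hT'⟩ := exists_dual_functions (p := p)
    (fun f hf => integrable_vol T hf) (continuous_etaT T) (S := elem T)
    (fun q hq h x _ => eq_zero_of_integral_etaT T hq h x)
    B.tchiT_mem B.tchiT_indep ((vol T).real univ)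
  exact ⟨⟨χF, hF, hF', χT, hT, hT'⟩⟩

/-! ### The space of bubble functions -/

/-- The functions `∑_F η_F q_F + η_T r` with polynomials `q_F` and `r` of degree at most `p`. -/
def bubbleMap (T : Affine.Simplex ℝ (E n) n) (p : ℕ) :
    ((Fin (n + 1) → polyFun n p) × polyFun n p) →ₗ[ℝ] (E n → ℝ) where
  toFun z := fun x => ∑ i, etaF T i x * (z.1 i : E n → ℝ) x + etaT T x * (z.2 : E n → ℝ) x
  map_add' z z' := by
    ext x
    simp only [Prod.fst_add, Prod.snd_add, Pi.add_apply, Submodule.coe_add, mul_add,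
      Finset.sum_add_distrib]
    ring
  map_smul' c z := by
    ext x
    simp only [Prod.smul_fst, Prod.smul_snd, Pi.smul_apply, Submodule.coe_smul, smul_eq_mul,
      RingHom.id_apply, mul_add, Finset.mul_sum]
    congr 1
    · exact Finset.sum_congr rfl fun i _ => by ring
    · ring

/-- The space of bubble functions. -/
def bubbleSpace (T : Affine.Simplex ℝ (E n) n) (p : ℕ) : Submodule ℝ (E n → ℝ) :=
  LinearMap.range (bubbleMap T p)

theorem mem_bubbleSpace_iff {T : Affine.Simplex ℝ (E n) n} {u : E n → ℝ} :
    u ∈ bubbleSpace T p ↔ ∃ (q : Fin (n + 1) → E n → ℝ) (r : E n → ℝ), (∀ i, q i ∈ polyFun n p) ∧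
      r ∈ polyFun n p ∧ u = fun x => ∑ i, etaF T i x * q i x + etaT T x * r x := by
  constructor
  · rintro ⟨z, rfl⟩
    exact ⟨fun i => z.1 i, z.2, fun i => (z.1 i).2, z.2.2, rfl⟩
  · rintro ⟨q, r, hq, hr, rfl⟩
    exact ⟨⟨fun i => ⟨q i, hq i⟩, ⟨r, hr⟩⟩, rfl⟩

theorem contDiff_of_mem_bubbleSpace {T : Affine.Simplex ℝ (E n) n} {u : E n → ℝ}
    (hu : u ∈ bubbleSpace T p) : ContDiff ℝ ∞ u := by
  obtain ⟨q, r, hq, hr, rfl⟩ := mem_bubbleSpace_iff.1 hu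
  refine ContDiff.add (ContDiff.sum fun i _ => ?_) ?_
  · exact (contDiff_of_mem_polyFun (etaF_mem_polyFun T i)).mul (contDiff_of_mem_polyFun (hq i))
  · exact (contDiff_of_mem_polyFun (etaT_mem_polyFun T)).mul (contDiff_of_mem_polyFun hr)

theorem bubble_on_face {T : Affine.Simplex ℝ (E n) n} (q : Fin (n + 1) → E n → ℝ) (r : E n → ℝ)
    {i : Fin (n + 1)} {x : E n} (hx : x ∈ face T i) :
    ∑ k, etaF T k x * q k x + etaT T x * r x = etaF T i x * q i x := by
  rw [etaT_eq_zero_of_mem_face T hx, zero_mul, add_zero, Finset.sum_eq_single i]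
  · intro k _ hk
    rw [etaF_eq_zero_of_mem_face T hk hx, zero_mul]
  · simp

/-- Bubble functions are determined by their moments. -/
theorem bubble_eq_zero {T : Affine.Simplex ℝ (E n) n} (hn : 1 ≤ n) {u : E n → ℝ}
    (hu : u ∈ bubbleSpace T p)
    (hF : ∀ i, ∀ q ∈ polyFun n p, ∫ x, q x * u x ∂surf (face T i) = 0)
    (hT : ∀ q ∈ polyFun n p, ∫ x, q x * u x ∂vol T = 0) : u = 0 := by
  obtain ⟨q, r, hq, hr, rfl⟩ := mem_bubbleSpace_iff.1 hu
  have h1 : ∀ i, ∃ s ∈ polyFun n p, ∀ x, q i x = etaV T i x * s x := by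
    -- Only the bubble of face `i` survives there, and `q i` is itself an admissible test
    -- polynomial. The resulting weighted square vanishes, so `q i` contains the coordinate of the
    -- opposite vertex as a factor.
    intro i
    have h2 := hF i (q i) (hq i)
    rw [integral_congr_ae (g := fun x => q i x * (etaF T i x * q i x)) (by
      filter_upwards [ae_restrict_mem (isCompact_face T i).measurableSet] with x hx
      rw [bubble_on_face q r hx])] at h2
    obtain ⟨y, hy, -⟩ := exists_face_center T hn i
    refine exists_factor_of_vanish (hq i) ((affBasis T).coord i) (T.points i - y) ?_
      fun x hx => eq_zero_of_integral_etaF T hn i (hq i) h2 hx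
    have := etaV_add T i y (T.points i - y)
    rw [add_sub_cancel, hy, etaV_vertex, if_pos rfl] at this
    linarith
  choose s hs hqs using h1
  -- The extracted coordinate completes each face bubble to the element bubble, and the remaining
  -- polynomial still has degree at most p.
  have e : ∀ x, ∑ i, etaF T i x * q i x + etaT T x * r x = etaT T x * (∑ i, s i + r) x := by
    intro x
    simp only [Pi.add_apply, Finset.sum_apply, mul_add, Finset.mul_sum]
    congr 1
    refine Finset.sum_congr rfl fun i _ => ?_
    rw [hqs, etaT_eq T i]; ring
  have hm : ∑ i, s i + r ∈ polyFun n p := add_mem (sum_mem fun i _ => hs i) hr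
  have h3 := hT _ hm
  simp only [e] at h3
  ext x
  rw [e, eq_zero_of_integral_etaT T hm h3 x]; simp

end Moments

/-! ### Moments of the Fortin operator -/

section OperatorMoments

variable {n p : ℕ} {T : Affine.Simplex ℝ (E n) n} {B : Bases T p}

theorem contDiff_etaFj (B : Bases T p) (i : Fin (n + 1)) (j : Fin (dimFace T p i)) :
    ContDiff ℝ ∞ (B.etaFj i j) :=
  (contDiff_of_mem_polyFun (etaF_mem_polyFun T i)).mul (contDiff_of_mem_polyFun (B.tchiF_mem i j))

theorem contDiff_etaTj (B : Bases T p) (j : Fin (dimElem T p)) : ContDiff ℝ ∞ (B.etaTj j) :=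
  (contDiff_of_mem_polyFun (etaT_mem_polyFun T)).mul (contDiff_of_mem_polyFun (B.tchiT_mem j))

theorem contDiff_PiTilde (D : DualBases B) (v : E n → ℝ) : ContDiff ℝ ∞ (PiTilde D v) :=
  contDiff_const.add (ContDiff.sum fun i _ => ContDiff.sum fun j _ =>
    contDiff_const.mul (contDiff_etaFj B i j))

theorem contDiff_Pi (D : DualBases B) (v : E n → ℝ) : ContDiff ℝ ∞ (Pi D v) :=
  (contDiff_PiTilde D v).add (ContDiff.sum fun j _ => contDiff_const.mul (contDiff_etaTj B j))

theorem Pi_mem_space (D : DualBases B) (v : E n → ℝ) : Pi D v ∈ B.space := by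
  have e : Pi D v = proj0 T v + ∑ i, ∑ j,
      ((∫ y, D.chiF i j y * trace T (v - proj0 T v) y ∂surf (face T i)) /
        (∫ y, D.chiF i j y * B.etaFj i j y ∂surf (face T i))) • B.etaFj i j +
      ∑ j, ((∫ y, D.chiT j y * (v - PiTilde D v) y ∂vol T) /
        (∫ y, D.chiT j y * B.etaTj j y ∂vol T)) • B.etaTj j := by
    ext x
    simp [Pi, PiTilde, Finset.sum_apply]
  rw [e]
  refine add_mem (Submodule.mem_sup_left (add_mem (Submodule.mem_sup_left ?_)
    (Submodule.mem_sup_right ?_))) (Submodule.mem_sup_right ?_)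
  · exact const_mem_polyFun 0 _
  · exact sum_mem fun i _ => sum_mem fun j _ =>
      Submodule.smul_mem _ _ (Submodule.subset_span ⟨i, j, rfl⟩)
  · exact sum_mem fun j _ => Submodule.smul_mem _ _ (Submodule.subset_span ⟨j, rfl⟩)

/-- The target space does not involve the bases; this is why the constants are uniform in their
choice. -/
theorem Pi_sub_mean_mem (D : DualBases B) (v : E n → ℝ) :
    (fun x => Pi D v x - ⨍ y, v y ∂vol T) ∈ bubbleSpace T p := by
  refine mem_bubbleSpace_iff.2 ⟨fun i => ∑ j,
      ((∫ y, D.chiF i j y * trace T (v - proj0 T v) y ∂surf (face T i)) /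
        (∫ y, D.chiF i j y * B.etaFj i j y ∂surf (face T i))) • B.tchiF i j,
      ∑ j, ((∫ y, D.chiT j y * (v - PiTilde D v) y ∂vol T) /
        (∫ y, D.chiT j y * B.etaTj j y ∂vol T)) • B.tchiT j,
    fun i => sum_mem fun j _ => Submodule.smul_mem _ _ (B.tchiF_mem i j),
    sum_mem fun j _ => Submodule.smul_mem _ _ (B.tchiT_mem j), ?_⟩
  ext x
  simp only [Pi, PiTilde, proj0, sum_smul_apply, Finset.mul_sum, Bases.etaFj, Bases.etaTj]
  rw [add_assoc, add_sub_cancel_left]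
  congr 1
  · exact Finset.sum_congr rfl fun i _ => Finset.sum_congr rfl fun j _ => by ring
  · exact Finset.sum_congr rfl fun j _ => by ring

theorem contDiff_proj0 (T : Affine.Simplex ℝ (E n) n) (v : E n → ℝ) :
    ContDiff ℝ ∞ (proj0 T v) := contDiff_const

theorem trace_sub_ae (hn : 1 ≤ n) {v φ : E n → ℝ} (hv : MemH1 (elem T) v)
    (hφ : ContDiff ℝ ∞ φ) : trace T (v - φ) =ᵐ[surf (bdry T)] fun x => trace T v x - φ x :=
  ((isTrace_trace T hn hv).sub hn (isTrace_of_contDiff T hn hφ)).trace_ae hn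

theorem memLp_trace (hn : 1 ≤ n) {v : E n → ℝ} (hv : MemH1 (elem T) v) :
    MemLp (trace T v) 2 (surf (bdry T)) := (isTrace_trace T hn hv).2.1

/-- All element bubbles and the bubbles of the other faces vanish on this face. What remains is the
correction by its own dual functions applied to the trace of v minus its mean. -/
theorem integral_face_sub_Pi (hn : 1 ≤ n) (D : DualBases B) {v : E n → ℝ}
    (hv : MemH1 (elem T) v) (i : Fin (n + 1)) {q : E n → ℝ} (hq : q ∈ polyFun n p) :
    ∫ x, q x * (trace T v x - Pi D v x) ∂surf (face T i) = 0 := by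
  have hH : MemH1 (elem T) (v - proj0 T v) :=
    ⟨_, hv.isWeakGrad.sub (isWeakGrad_gradient T (contDiff_proj0 T v))⟩
  have hae : ∀ᵐ x ∂surf (face T i), x ∈ face T i :=
    ae_restrict_mem (isCompact_face T i).measurableSet
  have key := integral_sub_correction_eq_zero (p := p) hae
    (fun f hf => integrable_surf_face T hn i hf) (continuous_etaF T i) rfl
    (B.tchiF_mem i) (D.chiF_mem i) (surf_face_univ_pos T hn i).ne' (D.chiF_dual i)
    (f := trace T (v - proj0 T v))
    (fun q hq => (memLp_surf_face T hn i hq).integrable_mul (q := 2)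
      ((memLp_trace hn hH).mono_measure (surf_face_le T i))) hq
  rw [← key]
  refine integral_congr_ae ?_
  filter_upwards [hae, ae_mono (surf_face_le T i)
    (trace_sub_ae hn hv (contDiff_proj0 T v))] with x hx ht
  rw [ht]
  have h1 : Pi D v x = proj0 T v x + ∑ j,
      (∫ y, D.chiF i j y * trace T (v - proj0 T v) y ∂surf (face T i)) /
        (∫ y, D.chiF i j y * B.etaFj i j y ∂surf (face T i)) * B.etaFj i j x := by
    simp only [Pi, PiTilde]
    rw [Finset.sum_eq_zero (s := Finset.univ) (f := fun j =>
      (∫ y, D.chiT j y * (v - PiTilde D v) y ∂vol T) /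
      (∫ y, D.chiT j y * B.etaTj j y ∂vol T) * B.etaTj j x), add_zero,
      Finset.sum_eq_single i]
    · intro k _ hk
      refine Finset.sum_eq_zero fun j _ => ?_
      rw [Bases.etaFj, etaF_eq_zero_of_mem_face T hk hx]; ring
    · simp
    · intro j _
      rw [Bases.etaTj, etaT_eq_zero_of_mem_face T hx]; ring
  rw [h1, ← sub_sub]
  rfl

/-- The last step of the operator is precisely the correction by dual functions applied to `v -
PiTilde D v`. -/
theorem integral_elem_sub_Pi (D : DualBases B) {v : E n → ℝ}
    (hv : MemLp v 2 (vol T)) {q : E n → ℝ} (hq : q ∈ polyFun n p) :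
    ∫ x, q x * (v x - Pi D v x) ∂vol T = 0 := by
  have key := integral_sub_correction_eq_zero (p := p)
    (ae_restrict_mem (isOpen_elem T).measurableSet)
    (fun f hf => integrable_vol T hf) (continuous_etaT T) rfl
    B.tchiT_mem D.chiT_mem (vol_real_univ_pos T).ne' D.chiT_dual
    (f := v - PiTilde D v)
    (fun q hq => (memLp_vol T hq).integrable_mul (q := 2)
      (hv.sub (memLp_vol T (contDiff_PiTilde D v).continuous))) hq
  rw [← key]
  refine integral_congr_ae (ae_of_all _ fun x => ?_)
  simp only [Pi, Pi.sub_apply, ← sub_sub]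
  rfl

/-! ### Stability of bubble functions with respect to their moments -/

theorem enorm_integral_mul_le {X : Type*} [MeasurableSpace X] {μ : Measure X} {f g : X → ℝ}
    (hf : MemLp f 2 μ) (hg : MemLp g 2 μ) :
    ‖∫ x, f x * g x ∂μ‖ₑ ≤ eLpNorm f 2 μ * eLpNorm g 2 μ := by
  refine (enorm_integral_le_lintegral_enorm _).trans ?_
  rw [← eLpNorm_one_eq_lintegral_enorm]
  have := eLpNorm_smul_le_mul_eLpNorm (p := 2) (q := 2) (r := 1) hg.1 hf.1
  exact this

theorem gradient_sum {ι : Type*} [Fintype ι] (a : ι → ℝ) {b : ι → E n → ℝ}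
    (hb : ∀ j, ContDiff ℝ ∞ (b j)) :
    gradient (∑ j, a j • b j) = ∑ j, a j • gradient (b j) := by
  ext1 x
  have hd : ∀ j, HasFDerivAt (b j) (fderiv ℝ (b j) x) x := fun j =>
    ((hb j).differentiable (by simp) x).hasFDerivAt
  have h : HasFDerivAt (∑ j, a j • b j) (∑ j, a j • fderiv ℝ (b j) x) x :=
    HasFDerivAt.sum fun j _ => (hd j).const_smul (a j)
  simp only [gradient, h.fderiv, map_sum, map_smul, Finset.sum_apply, Pi.smul_apply]

theorem eLpNorm_sum_smul_le {ι X F : Type*} [Fintype ι] [MeasurableSpace X]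
    [NormedAddCommGroup F] [NormedSpace ℝ F] {μ : Measure X} (a : ι → ℝ) {b : ι → X → F}
    (hb : ∀ j, AEStronglyMeasurable (b j) μ) :
    eLpNorm (∑ j, a j • b j) 2 μ ≤ ∑ j, ‖a j‖ₑ * eLpNorm (b j) 2 μ := by
  refine (eLpNorm_sum_le (fun j _ => (hb j).const_smul (a j)) (by norm_num)).trans ?_
  exact Finset.sum_le_sum fun j _ => (eLpNorm_const_smul _ _ _ _).le

/-- The moment of a bubble function with respect to a continuous weight. -/
def momentFunctional (T : Affine.Simplex ℝ (E n) n) (p : ℕ) (μ : Measure (E n))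
    (hI : ∀ f : E n → ℝ, Continuous f → Integrable f μ) (q : E n → ℝ) (hq : Continuous q) :
    bubbleSpace T p →ₗ[ℝ] ℝ where
  toFun u := ∫ x, q x * (u : E n → ℝ) x ∂μ
  map_add' u v := by
    simp only [Submodule.coe_add, Pi.add_apply, mul_add]
    exact integral_add (hI _ (hq.mul (contDiff_of_mem_bubbleSpace u.2).continuous))
      (hI _ (hq.mul (contDiff_of_mem_bubbleSpace v.2).continuous))
  map_smul' c u := by
    simp only [Submodule.coe_smul, Pi.smul_apply, smul_eq_mul, RingHom.id_apply]
    rw [← integral_const_mul]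
    exact integral_congr_ae (ae_of_all _ fun x => by simp only; ring)

/-- The finitely many moments against a basis of P^p form an injective linear map on bubble
functions, so a bubble function is a fixed linear combination of its moments. These equal the
moments of the data, which the Cauchy–Schwarz inequality bounds. The constant still depends on the
simplex. -/
theorem exists_bubble_stability (T : Affine.Simplex ℝ (E n) n) (hn : 1 ≤ n) (p : ℕ) :
    ∃ C : ENNReal, C ≠ ⊤ ∧ ∀ u ∈ bubbleSpace T p, ∀ w ψ : E n → ℝ,
      MemLp w 2 (surf (bdry T)) → MemLp ψ 2 (vol T) →
      (∀ i, ∀ q ∈ polyFun n p, ∫ x, q x * (w x - u x) ∂surf (face T i) = 0) →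
      (∀ q ∈ polyFun n p, ∫ x, q x * (ψ x - u x) ∂vol T = 0) →
      eLpNorm u 2 (vol T) + eLpNorm (gradient u) 2 (vol T)
        ≤ C * (eLpNorm w 2 (surf (bdry T)) + eLpNorm ψ 2 (vol T)) := by
  let e := Module.finBasis ℝ (polyFun n p)
  set κ := Fin (Module.finrank ℝ (polyFun n p))
  let μ : (Fin (n + 1) × κ) ⊕ κ → Measure (E n) :=
    Sum.elim (fun a => surf (face T a.1)) fun _ => vol T
  let q : (Fin (n + 1) × κ) ⊕ κ → E n → ℝ := Sum.elim (fun a => e a.2) fun k => e k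
  have hI : ∀ j, ∀ f : E n → ℝ, Continuous f → Integrable f (μ j) := by
    rintro (⟨i, k⟩ | k) f hf
    · exact integrable_surf_face T hn i hf
    · exact integrable_vol T hf
  have hqm : ∀ j, q j ∈ polyFun n p := by
    rintro (⟨i, k⟩ | k)
    · exact (e k).2
    · exact (e k).2
  have hqc : ∀ j, Continuous (q j) := fun j => continuous_of_mem_polyFun (hqm j)
  let M : bubbleSpace T p →ₗ[ℝ] ((Fin (n + 1) × κ) ⊕ κ → ℝ) :=
    LinearMap.pi fun j => momentFunctional T p (μ j) (hI j) (q j) (hqc j)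
  have hM : ∀ u j, M u j = ∫ x, q j x * (u : E n → ℝ) x ∂μ j := fun u j => rfl
  have hspan : ∀ (ν : Measure (E n)), (∀ f : E n → ℝ, Continuous f → Integrable f ν) →
      ∀ u : E n → ℝ, Continuous u → (∀ k, ∫ x, (e k : E n → ℝ) x * u x ∂ν = 0) →
      ∀ r ∈ polyFun n p, ∫ x, r x * u x ∂ν = 0 := by
    intro ν hν u hu h r hr
    have h1 : r = ∑ k, e.repr ⟨r, hr⟩ k • (e k : E n → ℝ) := by
      have := congrArg Subtype.val (e.sum_repr ⟨r, hr⟩)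
      rw [Submodule.coe_sum] at this
      exact this.symm
    have h2 : ∀ x, r x * u x = ∑ k, e.repr ⟨r, hr⟩ k * ((e k : E n → ℝ) x * u x) := fun x => by
      conv_lhs => rw [h1, sum_smul_apply, Finset.sum_mul]
      exact Finset.sum_congr rfl fun k _ => by ring
    simp only [h2]
    have hi : ∀ k, Integrable (fun x => e.repr ⟨r, hr⟩ k * ((e k : E n → ℝ) x * u x)) ν :=
      fun k => (hν _ ((continuous_of_mem_polyFun (e k).2).mul hu)).const_mul _
    rw [integral_finsetSum _ fun k _ => hi k]
    simp [integral_const_mul, h]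
  have hker : LinearMap.ker M = ⊥ := by
    rw [LinearMap.ker_eq_bot']
    intro u hu
    have huc := (contDiff_of_mem_bubbleSpace u.2).continuous
    refine Subtype.ext (bubble_eq_zero hn u.2 (fun i => hspan _
      (fun f hf => integrable_surf_face T hn i hf) _ huc fun k => ?_)
      (hspan _ (fun f hf => integrable_vol T hf) _ huc fun k => ?_))
    · exact congrFun hu (Sum.inl (i, k))
    · exact congrFun hu (Sum.inr k)
  obtain ⟨L, hL⟩ := M.exists_leftInverse_of_injective hker
  -- Images of the unit vectors under a left inverse of the moment map: every bubble function is the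
  -- sum of its moments times these functions.
  let b : (Fin (n + 1) × κ) ⊕ κ → E n → ℝ := fun j => L (fun k => if j = k then 1 else 0)
  have hb : ∀ j, ContDiff ℝ ∞ (b j) := fun j => contDiff_of_mem_bubbleSpace (L _).2
  have hrep : ∀ u : bubbleSpace T p, (u : E n → ℝ) = ∑ j, M u j • b j := fun u => by
    have h1 : L (M u) = u := congrFun (congrArg DFunLike.coe hL) u
    rw [LinearMap.pi_apply_eq_sum_univ L (M u)] at h1
    conv_lhs => rw [← h1]
    simp [b]
  have hqL : ∀ j, MemLp (q j) 2 (μ j) := by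
    rintro (⟨i, k⟩ | k)
    · exact memLp_surf_face T hn i (hqc _)
    · exact memLp_vol T (hqc _)
  have hgc : ∀ j, Continuous (gradient (b j)) := fun j => continuous_gradient (hb j)
  refine ⟨∑ j, eLpNorm (q j) 2 (μ j) * (eLpNorm (b j) 2 (vol T)
    + eLpNorm (gradient (b j)) 2 (vol T)), ?_, ?_⟩
  · refine (ENNReal.sum_lt_top.2 fun j _ => ENNReal.mul_lt_top (hqL j).2
      (ENNReal.add_lt_top.2 ⟨?_, ?_⟩)).ne
    · exact (memLp_vol T (hb j).continuous).2
    · exact (memLp_vol T (hgc j)).2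
  · intro u hu w ψ hw hψ hF hT
    have huc := (contDiff_of_mem_bubbleSpace hu).continuous
    set N := eLpNorm w 2 (surf (bdry T)) + eLpNorm ψ 2 (vol T)
    have hdata : ∀ (ν : Measure (E n)) (f r : E n → ℝ), MemLp f 2 ν → MemLp r 2 ν → MemLp u 2 ν →
        ∫ x, r x * (f x - u x) ∂ν = 0 → ∫ x, r x * u x ∂ν = ∫ x, r x * f x ∂ν := by
      intro ν f r hf hr hu h
      simp only [mul_sub] at h
      have i1 : Integrable (fun x => r x * f x) ν := hr.integrable_mul (q := 2) hf
      have i2 : Integrable (fun x => r x * u x) ν := hr.integrable_mul (q := 2) hu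
      rw [integral_sub i1 i2] at h
      linarith
    have hMb : ∀ j, ‖M ⟨u, hu⟩ j‖ₑ ≤ eLpNorm (q j) 2 (μ j) * N := by
      rintro (⟨i, k⟩ | k)
      · have hw' : MemLp w 2 (surf (face T i)) := hw.mono_measure (surf_face_le T i)
        rw [hM]
        have h1 := hdata (surf (face T i)) w (e k) hw' (hqL (Sum.inl (i, k)))
          (memLp_surf_face T hn i huc) (hF i _ (e k).2)
        change ‖∫ x, (e k : E n → ℝ) x * u x ∂surf (face T i)‖ₑ ≤ _
        rw [h1]
        refine (enorm_integral_mul_le (hqL (Sum.inl (i, k))) hw').trans ?_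
        gcongr
        exact (eLpNorm_mono_measure _ (surf_face_le T i)).trans le_self_add
      · rw [hM]
        have h1 := hdata (vol T) ψ (e k) hψ (hqL (Sum.inr k))
          (memLp_vol T huc) (hT _ (e k).2)
        change ‖∫ x, (e k : E n → ℝ) x * u x ∂vol T‖ₑ ≤ _
        rw [h1]
        refine (enorm_integral_mul_le (hqL (Sum.inr k)) hψ).trans ?_
        gcongr
        exact le_add_self
    have hu1 : u = ∑ j, M ⟨u, hu⟩ j • b j := hrep ⟨u, hu⟩
    have hu2 : gradient u = ∑ j, M ⟨u, hu⟩ j • gradient (b j) := by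
      conv_lhs => rw [hu1]
      exact gradient_sum _ hb
    calc eLpNorm u 2 (vol T) + eLpNorm (gradient u) 2 (vol T)
        ≤ ∑ j, ‖M ⟨u, hu⟩ j‖ₑ * eLpNorm (b j) 2 (vol T)
          + ∑ j, ‖M ⟨u, hu⟩ j‖ₑ * eLpNorm (gradient (b j)) 2 (vol T) := by
          refine add_le_add ?_ ?_
          · conv_lhs => rw [hu1]
            exact eLpNorm_sum_smul_le _ fun j => (hb j).continuous.aestronglyMeasurable
          · rw [hu2]
            exact eLpNorm_sum_smul_le _ fun j => (hgc j).aestronglyMeasurable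
      _ = ∑ j, ‖M ⟨u, hu⟩ j‖ₑ * (eLpNorm (b j) 2 (vol T)
          + eLpNorm (gradient (b j)) 2 (vol T)) := by
          rw [← Finset.sum_add_distrib]; simp only [mul_add]
      _ ≤ ∑ j, eLpNorm (q j) 2 (μ j) * N * (eLpNorm (b j) 2 (vol T)
          + eLpNorm (gradient (b j)) 2 (vol T)) := by
          gcongr with j _
          exact hMb j
      _ = _ := by
          rw [Finset.sum_mul]
          exact Finset.sum_congr rfl fun j _ => by ring

/-- The estimates on a single simplex, for smooth functions. -/
theorem exists_bubble_estimate (T : Affine.Simplex ℝ (E n) n) (hn : 1 ≤ n) (p : ℕ) :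
    ∃ C : ENNReal, C ≠ ⊤ ∧ ∀ φ : E n → ℝ, ContDiff ℝ ∞ φ → ∀ u ∈ bubbleSpace T p,
      (∀ i, ∀ q ∈ polyFun n p,
        ∫ x, q x * ((φ x - ⨍ y, φ y ∂vol T) - u x) ∂surf (face T i) = 0) →
      (∀ q ∈ polyFun n p, ∫ x, q x * ((φ x - ⨍ y, φ y ∂vol T) - u x) ∂vol T = 0) →
      eLpNorm (fun x => (φ x - ⨍ y, φ y ∂vol T) - u x) 2 (vol T)
          ≤ C * eLpNorm (gradient φ) 2 (vol T) ∧
        eLpNorm (gradient u) 2 (vol T) ≤ C * eLpNorm (gradient φ) 2 (vol T) := by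
  obtain ⟨C₁, hC₁, h₁⟩ := exists_bubble_stability T hn p
  obtain ⟨C₂, hC₂, h₂⟩ := exists_trace_inequality T hn
  obtain ⟨C₃, hC₃, h₃⟩ := exists_poincare_inequality T
  -- Poincaré controls φ minus its mean on the element by C₃, the trace inequality then controls it
  -- on the boundary by C₂ (C₃ + 1), and stability adds the factor C₁.
  refine ⟨C₃ + C₁ * (C₂ * (C₃ + 1) + C₃), by finiteness, fun φ hφ u hu hF hT => ?_⟩
  set m := ⨍ y, φ y ∂vol T with hm
  have hψ : ContDiff ℝ ∞ fun x => φ x - m := hφ.sub contDiff_const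
  set R := eLpNorm (gradient φ) 2 (vol T) with hR
  have hg : gradient (fun x => φ x - m) = gradient φ := by
    ext1 x
    rw [gradient_sub hφ contDiff_const]
    simp [gradient_fun_const]
  have a₃ := h₃ φ hφ
  have a₂ := h₂ _ hψ
  rw [hg] at a₂
  have a₁ := h₁ u hu _ _ (memLp_surf T hn hψ.continuous) (memLp_vol T hψ.continuous) hF hT
  have key : eLpNorm u 2 (vol T) + eLpNorm (gradient u) 2 (vol T)
      ≤ C₁ * (C₂ * (C₃ + 1) + C₃) * R := by
    refine a₁.trans ?_
    calc C₁ * (eLpNorm (fun x => φ x - m) 2 (surf (bdry T)) + eLpNorm (fun x => φ x - m) 2 (vol T))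
        ≤ C₁ * (C₂ * (C₃ * R + R) + C₃ * R) := by
          gcongr
          refine a₂.trans ?_
          gcongr
      _ = _ := by ring
  constructor
  · have hum := memLp_vol T (contDiff_of_mem_bubbleSpace hu).continuous
    calc eLpNorm (fun x => (φ x - m) - u x) 2 (vol T)
        ≤ eLpNorm (fun x => φ x - m) 2 (vol T) + eLpNorm u 2 (vol T) :=
          eLpNorm_sub_le (memLp_vol T hψ.continuous).1 hum.1 (by norm_num)
      _ ≤ C₃ * R + C₁ * (C₂ * (C₃ + 1) + C₃) * R :=
          add_le_add a₃ (le_self_add.trans key)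
      _ = _ := by ring
  · refine (le_add_self.trans key).trans ?_
    gcongr
    exact le_add_self

end OperatorMoments

/-! ### Estimates that are uniform over all simplices -/

section Transfer

variable {n p : ℕ}

/-- Two points of the ball at distance r/2 in the direction of v are mapped to points at distance at
most diam K. -/
theorem norm_linear_le {Ψ : E n ≃ᵃ[ℝ] E n} {K : Set (E n)} (hK : Bornology.IsBounded K) {x : E n}
    {r : ℝ} (hr : 0 < r) (h : Metric.ball x r ⊆ Ψ ⁻¹' K) (v : E n) :
    ‖Ψ.linear v‖ ≤ 2 * Metric.diam K / r * ‖v‖ := by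
  by_cases hv : v = 0
  · simp [hv]
  have hv' : 0 < ‖v‖ := norm_pos_iff.2 hv
  set t := r / 2 / ‖v‖ with ht
  have ht0 : 0 < t := by positivity
  have hm : t • v + x ∈ Metric.ball x r := by
    rw [mem_ball_iff_norm, add_sub_cancel_right, norm_smul, Real.norm_of_nonneg ht0.le, ht,
      div_mul_cancel₀ _ hv'.ne']
    linarith
  have h1 := Metric.dist_le_diam_of_mem hK (h hm) (h (Metric.mem_ball_self hr))
  have h2 : Ψ (t • v + x) = t • Ψ.linear v + Ψ x := by
    have := Ψ.map_vadd x (t • v)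
    simpa using this
  rw [h2, dist_eq_norm, add_sub_cancel_right, norm_smul, Real.norm_of_nonneg ht0.le, ht] at h1
  have h3 : r / 2 / ‖v‖ * ‖Ψ.linear v‖ * (2 * ‖v‖ / r) ≤ Metric.diam K * (2 * ‖v‖ / r) := by gcongr
  calc ‖Ψ.linear v‖ = r / 2 / ‖v‖ * ‖Ψ.linear v‖ * (2 * ‖v‖ / r) := by field_simp
    _ ≤ _ := h3
    _ = _ := by ring

theorem contDiff_affineEquiv (Ψ : E n ≃ᵃ[ℝ] E n) : ContDiff ℝ ∞ Ψ := by
  have h : (Ψ : E n → E n) = fun x => Ψ.linear.toContinuousLinearEquiv x + Ψ 0 := by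
    ext1 x
    have := Ψ.map_vadd 0 x
    simpa using this
  rw [h]
  fun_prop

theorem norm_gradient_comp_le (Ψ : E n ≃ᵃ[ℝ] E n) {a : ℝ} (ha : 0 ≤ a)
    (h : ∀ v, ‖Ψ.linear v‖ ≤ a * ‖v‖) {f : E n → ℝ} (hf : ContDiff ℝ ∞ f) (y : E n) :
    ‖gradient (fun x => f (Ψ x)) y‖ ≤ a * ‖gradient f (Ψ y)‖ := by
  have e : (Ψ : E n → E n) = fun x => Ψ.linear.toContinuousLinearEquiv x + Ψ 0 := by
    ext1 x
    have := Ψ.map_vadd 0 x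
    simpa using this
  have h1 : HasFDerivAt Ψ (Ψ.linear.toContinuousLinearEquiv : E n →L[ℝ] E n) y := by
    rw [e]
    exact (Ψ.linear.toContinuousLinearEquiv.hasFDerivAt).add_const _
  have h2 := ((hf.differentiable (by simp) (Ψ y)).hasFDerivAt.comp y h1).fderiv
  change fderiv ℝ (fun x => f (Ψ x)) y = _ at h2
  rw [norm_gradient, norm_gradient, h2, mul_comm]
  refine (ContinuousLinearMap.opNorm_comp_le _ _).trans ?_
  gcongr
  exact ContinuousLinearMap.opNorm_le_bound _ ha h

theorem measurable_affineEquiv (Ψ : E n ≃ᵃ[ℝ] E n) : Measurable Ψ :=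
  Ψ.continuous_of_finiteDimensional.measurable

theorem integral_comp_of_map_eq {Ψ : E n ≃ᵃ[ℝ] E n} {μ ν : Measure (E n)} {c : ENNReal}
    (h : μ.map Ψ = c • ν) {f : E n → ℝ} (hf : Continuous f) :
    ∫ x, f (Ψ x) ∂μ = c.toReal * ∫ x, f x ∂ν := by
  rw [← integral_map (measurable_affineEquiv Ψ).aemeasurable hf.aestronglyMeasurable, h,
    integral_smul_measure, smul_eq_mul]

theorem eLpNorm_comp_of_map_eq {F : Type*} [NormedAddCommGroup F] {Ψ : E n ≃ᵃ[ℝ] E n}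
    {μ ν : Measure (E n)} {c : ENNReal}
    (h : μ.map Ψ = c • ν) {f : E n → F} (hf : Continuous f) :
    eLpNorm (fun x => f (Ψ x)) 2 μ = c ^ (1 / 2 : ENNReal).toReal * eLpNorm f 2 ν := by
  have := eLpNorm_map_measure (p := 2) (μ := μ) (f := Ψ) (g := f) hf.aestronglyMeasurable
    (measurable_affineEquiv Ψ).aemeasurable
  change _ = eLpNorm (fun x => f (Ψ x)) 2 μ at this
  rw [← this, h, eLpNorm_smul_measure_of_ne_top (by norm_num), smul_eq_mul]

theorem average_comp_simplexEquiv (S T : Affine.Simplex ℝ (E n) n) {f : E n → ℝ}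
    (hf : Continuous f) : ⨍ x, f (simplexEquiv S T x) ∂vol S = ⨍ x, f x ∂vol T := by
  obtain ⟨c, hc0, hct, hc⟩ := map_vol S T
  have h1 : (vol S).real univ = c.toReal * (vol T).real univ := by
    have := congrArg (fun μ : Measure (E n) => (μ univ).toReal) hc
    simp only [Measure.smul_apply, smul_eq_mul, ENNReal.toReal_mul] at this
    rwa [Measure.map_apply (measurable_affineEquiv _) MeasurableSet.univ, preimage_univ] at this
  have h2 : c.toReal ≠ 0 := ENNReal.toReal_ne_zero.2 ⟨hc0, hct⟩
  rw [average_eq, average_eq, integral_comp_of_map_eq hc hf, h1, smul_eq_mul, smul_eq_mul]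
  field_simp

theorem bubble_comp_simplexEquiv (S T : Affine.Simplex ℝ (E n) n) {u : E n → ℝ}
    (hu : u ∈ bubbleSpace T p) : (fun x => u (simplexEquiv S T x)) ∈ bubbleSpace S p := by
  obtain ⟨q, r, hq, hr, rfl⟩ := mem_bubbleSpace_iff.1 hu
  refine mem_bubbleSpace_iff.2 ⟨fun i x => q i (simplexEquiv S T x),
    fun x => r (simplexEquiv S T x),
    fun i => comp_affine_mem_polyFun (hq i) (simplexEquiv S T).toAffineMap,
    comp_affine_mem_polyFun hr (simplexEquiv S T).toAffineMap, ?_⟩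
  funext x
  exact congrArg₂ (· + ·) (Finset.sum_congr rfl fun i _ => by rw [etaF_simplexEquiv])
    (by rw [etaT_simplexEquiv])

/-- Composition with the inverse affine map keeps the degree of test polynomials, so vanishing
moments are transported whatever the measure factor. -/
theorem moment_comp_eq_zero {Ψ : E n ≃ᵃ[ℝ] E n} {μ ν : Measure (E n)} {c : ENNReal}
    (h : μ.map Ψ = c • ν) {f : E n → ℝ} (hf : Continuous f)
    (hν : ∀ q ∈ polyFun n p, ∫ x, q x * f x ∂ν = 0) {q : E n → ℝ} (hq : q ∈ polyFun n p) :
    ∫ x, q x * f (Ψ x) ∂μ = 0 := by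
  have hq' : (fun x => q (Ψ.symm x)) ∈ polyFun n p :=
    comp_affine_mem_polyFun hq Ψ.symm.toAffineMap
  have := integral_comp_of_map_eq h ((continuous_of_mem_polyFun hq').mul hf)
  simp only [Pi.mul_apply, AffineEquiv.symm_apply_apply] at this
  rw [this]
  exact mul_eq_zero_of_right _ (hν _ hq')

/-- Scaling to one reference simplex. The bubble space, the mean and the moment conditions pull
back, and the volume factors cancel. Only gradients change: φ ∘ Φ gains a factor of order h_T, and
returning to T costs the gradient of u a factor of order 1/r. -/
theorem exists_uniform_bubble_estimate (hn : 1 ≤ n) (p : ℕ) :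
    ∃ C : ENNReal, C ≠ ⊤ ∧ ∀ (T : Affine.Simplex ℝ (E n) n) (x : E n) (r : ℝ), 0 < r →
      Metric.ball x r ⊆ elem T → ∀ φ : E n → ℝ, ContDiff ℝ ∞ φ → ∀ u ∈ bubbleSpace T p,
      (∀ i, ∀ q ∈ polyFun n p,
        ∫ x, q x * ((φ x - ⨍ y, φ y ∂vol T) - u x) ∂surf (face T i) = 0) →
      (∀ q ∈ polyFun n p, ∫ x, q x * ((φ x - ⨍ y, φ y ∂vol T) - u x) ∂vol T = 0) →
      eLpNorm (fun x => (φ x - ⨍ y, φ y ∂vol T) - u x) 2 (vol T)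
          ≤ C * ENNReal.ofReal (size T) * eLpNorm (gradient φ) 2 (vol T) ∧
        eLpNorm (gradient u) 2 (vol T)
          ≤ C * ENNReal.ofReal (size T / r) * eLpNorm (gradient φ) 2 (vol T) := by
  -- Any simplex may serve as reference, as long as it is fixed before `T`; if there is none, the
  -- claim is vacuous.
  by_cases hne : Nonempty (Affine.Simplex ℝ (E n) n)
  swap
  · exact ⟨0, by simp, fun T => absurd ⟨T⟩ hne⟩
  obtain ⟨S⟩ := hne
  obtain ⟨C₁, hC₁, h₁⟩ := exists_bubble_estimate S hn p
  obtain ⟨y, hy⟩ := nonempty_elem S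
  obtain ⟨ρ, hρ, hball⟩ := Metric.isOpen_iff.1 (isOpen_elem S) y hy
  set d := size S with hd
  have hd0 : 0 ≤ d := Metric.diam_nonneg
  -- The summand 1 serves the L² estimate, and 2 d serves the gradient estimate, where the bound 2 d
  -- / r for the inverse map enters.
  refine ⟨C₁ * ENNReal.ofReal (2 / ρ) * (1 + ENNReal.ofReal (2 * d)), by finiteness,
    fun T x r hr hxr φ hφ u hu hF hT => ?_⟩
  set Φ := simplexEquiv S T with hΦ
  have hΦs := contDiff_affineEquiv Φ
  have hs0 : 0 ≤ size T := Metric.diam_nonneg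
  have hA := norm_linear_le (Ψ := Φ) (isBounded_elem T) hρ (by rw [hΦ, preimage_elem]; exact hball)
  have hA' := norm_linear_le (Ψ := Φ.symm) (K := elem S) (isBounded_elem S) hr (by
    intro z hz
    rw [mem_preimage, ← preimage_elem S T, mem_preimage, ← hΦ, AffineEquiv.apply_symm_apply]
    exact hxr hz)
  change ∀ v, ‖Φ.linear v‖ ≤ 2 * size T / ρ * ‖v‖ at hA
  change ∀ v, ‖Φ.symm.linear v‖ ≤ 2 * d / r * ‖v‖ at hA'
  obtain ⟨c, hc0, hct, hc⟩ := map_vol S T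
  set k := c ^ (1 / 2 : ENNReal).toReal with hk
  have hk0 : k ≠ 0 := by
    rw [hk]; exact (ENNReal.rpow_pos (pos_iff_ne_zero.2 hc0) hct).ne'
  have hkt : k ≠ ⊤ := ENNReal.rpow_ne_top_of_nonneg (by positivity) hct
  have hus := contDiff_of_mem_bubbleSpace hu
  set m := ⨍ y, φ y ∂vol T with hm
  have hφΦ : ContDiff ℝ ∞ fun x => φ (Φ x) := hφ.comp hΦs
  have huΦ : ContDiff ℝ ∞ fun x => u (Φ x) := hus.comp hΦs
  have hmS : ⨍ y, φ (Φ y) ∂vol S = m := average_comp_simplexEquiv S T hφ.continuous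
  have hfc : Continuous fun x => (φ x - m) - u x :=
    (hφ.continuous.sub continuous_const).sub hus.continuous
  obtain ⟨e₁, e₂⟩ := h₁ (fun x => φ (Φ x)) hφΦ (fun x => u (Φ x)) (bubble_comp_simplexEquiv S T hu)
    (fun i q hq => by
      obtain ⟨c', -, -, hc'⟩ := map_surf_face S T hn i
      rw [hmS]
      exact moment_comp_eq_zero hc' hfc (hF i) hq)
    (fun q hq => by
      rw [hmS]
      exact moment_comp_eq_zero hc hfc hT hq)
  rw [hmS] at e₁
  set R := eLpNorm (gradient φ) 2 (vol T) with hR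
  have g₁ : eLpNorm (gradient fun x => φ (Φ x)) 2 (vol S)
      ≤ ENNReal.ofReal (2 * size T / ρ) * (k * R) := by
    rw [hR, hk, ← eLpNorm_comp_of_map_eq hc (continuous_gradient hφ)]
    refine eLpNorm_le_mul_eLpNorm_of_ae_le_mul (ae_of_all _ fun x => ?_) 2
    exact norm_gradient_comp_le Φ (by positivity) hA hφ x
  have g₂ : k * eLpNorm (gradient u) 2 (vol T)
      ≤ ENNReal.ofReal (2 * d / r) * eLpNorm (gradient fun x => u (Φ x)) 2 (vol S) := by
    rw [hk, ← eLpNorm_comp_of_map_eq hc (continuous_gradient hus)]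
    refine eLpNorm_le_mul_eLpNorm_of_ae_le_mul (ae_of_all _ fun x => ?_) 2
    have := norm_gradient_comp_le Φ.symm (by positivity) hA' huΦ (Φ x)
    simpa using this
  have e₁' : k * eLpNorm (fun x => (φ x - m) - u x) 2 (vol T)
      ≤ C₁ * eLpNorm (gradient fun x => φ (Φ x)) 2 (vol S) := by
    rw [hk, ← eLpNorm_comp_of_map_eq hc hfc]; exact e₁
  have hsplit : ENNReal.ofReal (2 * size T / ρ) = ENNReal.ofReal (2 / ρ) * ENNReal.ofReal (size T) := by
    rw [← ENNReal.ofReal_mul (by positivity)]; congr 1; ring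
  constructor
  · rw [← ENNReal.mul_le_mul_iff_right hk0 hkt]
    calc k * eLpNorm (fun x => (φ x - m) - u x) 2 (vol T)
        ≤ C₁ * (ENNReal.ofReal (2 * size T / ρ) * (k * R)) := e₁'.trans (by gcongr)
      _ = k * (C₁ * ENNReal.ofReal (2 / ρ) * 1 * ENNReal.ofReal (size T) * R) := by
          rw [hsplit]; ring
      _ ≤ _ := by gcongr; exact le_self_add
  · rw [← ENNReal.mul_le_mul_iff_right hk0 hkt]
    have hsplit' : ENNReal.ofReal (size T) * ENNReal.ofReal (2 * d / r)
        = ENNReal.ofReal (2 * d) * ENNReal.ofReal (size T / r) := by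
      rw [← ENNReal.ofReal_mul (by positivity), ← ENNReal.ofReal_mul (by positivity)]
      congr 1; ring
    calc k * eLpNorm (gradient u) 2 (vol T)
        ≤ ENNReal.ofReal (2 * d / r) * (C₁ * (ENNReal.ofReal (2 * size T / ρ) * (k * R))) :=
          g₂.trans (by gcongr; exact e₂.trans (by gcongr))
      _ = k * (C₁ * ENNReal.ofReal (2 / ρ) *
          (ENNReal.ofReal (size T) * ENNReal.ofReal (2 * d / r)) * R) := by rw [hsplit]; ring
      _ = k * (C₁ * ENNReal.ofReal (2 / ρ) * ENNReal.ofReal (2 * d) *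
          ENNReal.ofReal (size T / r) * R) := by rw [hsplit']; ring
      _ ≤ _ := by gcongr; exact le_add_self

end Transfer

/-! ### Estimates for functions in `H¹` -/

section SobolevEstimates

variable {n p : ℕ} {T : Affine.Simplex ℝ (E n) n} {B : Bases T p}

theorem enorm_average_sub_le {v φ : E n → ℝ} (hv : MemLp v 2 (vol T)) (hφ : MemLp φ 2 (vol T)) :
    ‖⨍ x, φ x ∂vol T - ⨍ x, v x ∂vol T‖ₑ ≤ ‖((vol T).real univ)⁻¹‖ₑ *
      eLpNorm (fun _ : E n => (1 : ℝ)) 2 (vol T) * eLpNorm (fun x => φ x - v x) 2 (vol T) := by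
  have h1 : MemLp (fun _ : E n => (1 : ℝ)) 2 (vol T) := memLp_vol T continuous_const
  have h2 := enorm_integral_mul_le h1 (hφ.sub hv)
  simp only [one_mul, Pi.sub_apply] at h2
  rw [average_eq, average_eq, ← smul_sub, ← integral_sub (hφ.integrable (by norm_num))
    (hv.integrable (by norm_num)), enorm_smul, mul_assoc]
  gcongr
  exact h2

theorem eLpNorm_sub_sub_const_le {μ : Measure (E n)} {f g : E n → ℝ} (hf : MemLp f 2 μ)
    (hg : MemLp g 2 μ) (d : ℝ) :
    eLpNorm (fun x => (f x - g x) - d) 2 μ ≤ eLpNorm (fun x => f x - g x) 2 μ +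
      ‖d‖ₑ * eLpNorm (fun _ : E n => (1 : ℝ)) 2 μ := by
  have e : (fun _ : E n => d) = d • fun _ : E n => (1 : ℝ) := by ext; simp
  have h := eLpNorm_sub_le (p := 2) (hf.sub hg).1
    (aestronglyMeasurable_const (μ := μ) (b := d)) (by norm_num)
  refine h.trans ?_
  rw [e]
  exact add_le_add le_rfl (eLpNorm_const_smul _ _ _ _).le

theorem gradient_sub_const {u : E n → ℝ} (c : ℝ) :
    gradient (fun x => u x - c) = gradient u := by
  ext1 x
  simp only [gradient, fderiv_sub_const]

/-- Smooth functions that converge to `v` in `H¹(T)` and whose images under the Fortin operator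
converge to that of `v`. -/
theorem exists_seq_tendsto_Pi (hn : 1 ≤ n) (D : DualBases B) {v : E n → ℝ}
    (hv : MemH1 (elem T) v) : ∃ φ : ℕ → E n → ℝ, (∀ k, ContDiff ℝ ∞ (φ k)) ∧
      Tendsto (fun k => eLpNorm (fun x => φ k x - v x) 2 (vol T)) atTop (𝓝 0) ∧
      Tendsto (fun k => eLpNorm (fun x => gradient (φ k) x - weakGrad (elem T) v x) 2 (vol T))
        atTop (𝓝 0) ∧
      Tendsto (fun k => eLpNorm (fun x => Pi D (φ k) x - Pi D v x) 2 (vol T)) atTop (𝓝 0) ∧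
      Tendsto (fun k => eLpNorm (fun x => gradient (Pi D (φ k)) x - gradient (Pi D v) x) 2 (vol T))
        atTop (𝓝 0) := by
  have hw := memLp_trace hn hv
  have hvT : MemLp v 2 (vol T) := hv.isWeakGrad.memLp_fun
  -- The sequence from the definition of the trace converges in H¹(T) and on the boundary
  -- simultaneously.
  obtain ⟨-, -, φ, hφ, h1, h2, h3⟩ := isTrace_trace T hn hv
  obtain ⟨C, hC, hst⟩ := exists_bubble_stability T hn p
  have hφT := fun k => memLp_vol T (hφ k).continuous
  have hφF := fun k => memLp_surf T hn (hφ k).continuous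
  have o1 : MemLp (fun _ : E n => (1 : ℝ)) 2 (vol T) := memLp_vol T continuous_const
  have o2 : MemLp (fun _ : E n => (1 : ℝ)) 2 (surf (bdry T)) := memLp_surf T hn continuous_const
  set d : ℕ → ℝ := fun k => ⨍ x, φ k x ∂vol T - ⨍ x, v x ∂vol T with hd
  have hd0 : Tendsto (fun k => ‖d k‖ₑ) atTop (𝓝 0) := by
    have t := ENNReal.Tendsto.const_mul (a := ‖((vol T).real univ)⁻¹‖ₑ *
      eLpNorm (fun _ : E n => (1 : ℝ)) 2 (vol T)) h1 (Or.inr (ENNReal.mul_ne_top enorm_ne_top o1.2.ne))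
    rw [mul_zero] at t
    exact tendsto_of_tendsto_of_tendsto_of_le_of_le tendsto_const_nhds t
      (fun _ => zero_le) fun k => enorm_average_sub_le hvT (hφT k)
  -- Removing the difference `d k` of the means puts the difference of the images into the bubble
  -- space. Its moments are those of the differences of the data, so the stability bound forces it
  -- to tend to 0; a constant depending on `T` is enough here.
  set u : ℕ → E n → ℝ := fun k x => (Pi D (φ k) x - Pi D v x) - d k with hu
  have hub : ∀ k, u k ∈ bubbleSpace T p := fun k => by
    have e : u k = (fun x => Pi D (φ k) x - ⨍ y, φ k y ∂vol T) -
        fun x => Pi D v x - ⨍ y, v y ∂vol T := by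
      ext x; simp only [hu, hd, Pi.sub_apply]; ring
    rw [e]
    exact sub_mem (Pi_sub_mean_mem D _) (Pi_sub_mean_mem D _)
  have hPs : ∀ f : E n → ℝ, Continuous (Pi D f) := fun f => (contDiff_Pi D f).continuous
  have hb : ∀ k, eLpNorm (u k) 2 (vol T) + eLpNorm (gradient (u k)) 2 (vol T) ≤
      C * ((eLpNorm (fun x => φ k x - trace T v x) 2 (surf (bdry T)) +
        ‖d k‖ₑ * eLpNorm (fun _ : E n => (1 : ℝ)) 2 (surf (bdry T))) +
        (eLpNorm (fun x => φ k x - v x) 2 (vol T) +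
        ‖d k‖ₑ * eLpNorm (fun _ : E n => (1 : ℝ)) 2 (vol T))) := fun k => by
    refine (hst (u k) (hub k) (fun x => (φ k x - trace T v x) - d k)
      (fun x => (φ k x - v x) - d k)
      (((hφF k).sub hw).sub (memLp_surf T hn continuous_const))
      (((hφT k).sub hvT).sub (memLp_vol T continuous_const)) (fun i q hq => ?_)
      fun q hq => ?_).trans ?_
    · have hqL := memLp_surf_face T hn i (continuous_of_mem_polyFun hq)
      have m1 := integral_face_sub_Pi hn D (memH1_of_contDiff T (hφ k)) i hq
      have m2 := integral_face_sub_Pi hn D hv i hq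
      have i1 : Integrable (fun x => q x * (trace T (φ k) x - Pi D (φ k) x)) (surf (face T i)) :=
        hqL.integrable_mul (q := 2) (((memLp_trace hn (memH1_of_contDiff T (hφ k))).mono_measure
          (surf_face_le T i)).sub (memLp_surf_face T hn i (hPs _)))
      have i2 : Integrable (fun x => q x * (trace T v x - Pi D v x)) (surf (face T i)) :=
        hqL.integrable_mul (q := 2) ((hw.mono_measure
          (surf_face_le T i)).sub (memLp_surf_face T hn i (hPs _)))
      have := integral_sub i1 i2
      rw [m1, m2, sub_zero] at this
      rw [← this]
      refine integral_congr_ae ?_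
      filter_upwards [ae_mono (surf_face_le T i)
        ((isTrace_of_contDiff T hn (hφ k)).trace_ae hn)] with x hx
      rw [hx]
      simp only [hu]
      ring
    · have hqL := memLp_vol T (continuous_of_mem_polyFun hq)
      have m1 := integral_elem_sub_Pi D (hφT k) hq
      have m2 := integral_elem_sub_Pi D hvT hq
      have i1 : Integrable (fun x => q x * (φ k x - Pi D (φ k) x)) (vol T) :=
        hqL.integrable_mul (q := 2) ((hφT k).sub (memLp_vol T (hPs _)))
      have i2 : Integrable (fun x => q x * (v x - Pi D v x)) (vol T) :=
        hqL.integrable_mul (q := 2) (hvT.sub (memLp_vol T (hPs _)))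
      have := integral_sub i1 i2
      rw [m1, m2, sub_zero] at this
      rw [← this]
      refine integral_congr_ae (ae_of_all _ fun x => ?_)
      simp only [hu]
      ring
    · gcongr
      · exact eLpNorm_sub_sub_const_le (hφF k) hw _
      · exact eLpNorm_sub_sub_const_le (hφT k) hvT _
  have hlim : Tendsto (fun k => eLpNorm (u k) 2 (vol T) + eLpNorm (gradient (u k)) 2 (vol T))
      atTop (𝓝 0) := by
    have t1 := ENNReal.Tendsto.mul_const hd0 (Or.inr o2.2.ne)
    have t2 := ENNReal.Tendsto.mul_const hd0 (Or.inr o1.2.ne)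
    have t := ENNReal.Tendsto.const_mul ((h3.add t1).add (h1.add t2)) (Or.inr hC)
    simp only [zero_mul, add_zero, mul_zero] at t
    exact tendsto_of_tendsto_of_tendsto_of_le_of_le tendsto_const_nhds t (fun _ => zero_le) hb
  refine ⟨φ, hφ, h1, h2, ?_, ?_⟩
  · have t := hlim.add (ENNReal.Tendsto.mul_const hd0 (Or.inr o1.2.ne))
    rw [zero_mul, add_zero] at t
    refine tendsto_of_tendsto_of_tendsto_of_le_of_le tendsto_const_nhds t
      (fun _ => zero_le) fun k => ?_
    have h := eLpNorm_sub_sub_const_le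
      (memLp_vol T (contDiff_of_mem_bubbleSpace (hub k)).continuous)
      (memLp_vol T (continuous_const (y := (0 : ℝ)))) (-d k)
    simp only [sub_zero, enorm_neg, sub_neg_eq_add] at h
    have e : (fun x => u k x + d k) = fun x => Pi D (φ k) x - Pi D v x := by
      ext x; simp only [hu]; ring
    rw [e] at h
    exact h.trans (add_le_add le_self_add le_rfl)
  · refine tendsto_of_tendsto_of_tendsto_of_le_of_le tendsto_const_nhds hlim
      (fun _ => zero_le) fun k => ?_
    have e : gradient (u k) = fun x => gradient (Pi D (φ k)) x - gradient (Pi D v) x := by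
      rw [hu]
      simp only [gradient_sub_const]
      exact funext fun x => gradient_sub (contDiff_Pi D _) (contDiff_Pi D _) x
    simp only
    rw [← e]
    exact le_add_self

theorem tendsto_eLpNorm_of_tendsto_sub {X F : Type*} [MeasurableSpace X] [NormedAddCommGroup F]
    {μ : Measure X} {f : ℕ → X → F} {g : X → F} (hf : ∀ k, MemLp (f k) 2 μ) (hg : MemLp g 2 μ)
    (h : Tendsto (fun k => eLpNorm (fun x => f k x - g x) 2 μ) atTop (𝓝 0)) :
    Tendsto (fun k => eLpNorm (f k) 2 μ) atTop (𝓝 (eLpNorm g 2 μ)) := by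
  have hle : ∀ k, eLpNorm (f k) 2 μ ≤ eLpNorm (fun x => f k x - g x) 2 μ + eLpNorm g 2 μ := by
    intro k
    have := eLpNorm_add_le ((hf k).sub hg).1 hg.1 (p := 2) (by norm_num)
    rw [sub_add_cancel] at this
    exact this
  have hge : ∀ k, eLpNorm g 2 μ - eLpNorm (fun x => f k x - g x) 2 μ ≤ eLpNorm (f k) 2 μ := by
    intro k
    rw [tsub_le_iff_right]
    have := eLpNorm_sub_le (hf k).1 ((hf k).sub hg).1 (p := 2) (by norm_num)
    rw [sub_sub_cancel] at this
    exact this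
  refine tendsto_of_tendsto_of_tendsto_of_le_of_le ?_ ?_ hge hle
  · have := ENNReal.Tendsto.sub (tendsto_const_nhds (x := eLpNorm g 2 μ)) h (Or.inl hg.2.ne)
    simpa using this
  · simpa using h.add (tendsto_const_nhds (x := eLpNorm g 2 μ))

/-- The bubble estimate applies to each smooth approximant, and all its terms converge along the
sequence with the uniform constant retained. -/
theorem exists_uniform_Pi_estimate (hn : 1 ≤ n) (p : ℕ) :
    ∃ C : ENNReal, C ≠ ⊤ ∧ ∀ (T : Affine.Simplex ℝ (E n) n) (B : Bases T p) (D : DualBases B)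
      (x : E n) (r : ℝ), 0 < r → Metric.ball x r ⊆ elem T →
      ∀ v : E n → ℝ, MemH1 (elem T) v →
      eLpNorm (v - Pi D v) 2 (vol T)
          ≤ C * ENNReal.ofReal (size T) * eLpNorm (weakGrad (elem T) v) 2 (vol T) ∧
        eLpNorm (gradient (Pi D v)) 2 (vol T)
          ≤ C * ENNReal.ofReal (size T / r) * eLpNorm (weakGrad (elem T) v) 2 (vol T) := by
  obtain ⟨C, hC, h⟩ := exists_uniform_bubble_estimate hn p
  refine ⟨C, hC, fun T B D x r hr hx v hv => ?_⟩
  obtain ⟨φ, hφ, h1, h2, h3, h4⟩ := exists_seq_tendsto_Pi hn D hv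
  have hvT : MemLp v 2 (vol T) := hv.isWeakGrad.memLp_fun
  have hφT := fun k => memLp_vol T (hφ k).continuous
  have hPs : ∀ f : E n → ℝ, MemLp (Pi D f) 2 (vol T) := fun f =>
    memLp_vol T (contDiff_Pi D f).continuous
  have hgs : ∀ f : E n → ℝ, MemLp (gradient (Pi D f)) 2 (vol T) := fun f =>
    memLp_vol T (continuous_gradient (contDiff_Pi D f))
  have hk := fun k => h T x r hr hx (φ k) (hφ k) _ (Pi_sub_mean_mem D (φ k))
    (fun i q hq => by
      rw [← integral_face_sub_Pi hn D (memH1_of_contDiff T (hφ k)) i hq]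
      refine integral_congr_ae ?_
      filter_upwards [ae_mono (surf_face_le T i)
        ((isTrace_of_contDiff T hn (hφ k)).trace_ae hn)] with x hx
      rw [hx]
      ring)
    (fun q hq => by
      rw [← integral_elem_sub_Pi D (hφT k) hq]
      refine integral_congr_ae (ae_of_all _ fun x => ?_)
      simp only
      ring)
  -- The mean cancels in φ - Πφ and has no gradient.
  simp only [sub_sub_sub_cancel_right, gradient_sub_const] at hk
  have tg := tendsto_eLpNorm_of_tendsto_sub
    (fun k => memLp_vol T (continuous_gradient (hφ k))) hv.isWeakGrad.memLp_grad h2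
  have hs : Tendsto (fun k => eLpNorm (fun x => (φ k x - Pi D (φ k) x) - (v - Pi D v) x) 2 (vol T))
      atTop (𝓝 0) := by
    have t := h1.add h3
    rw [add_zero] at t
    refine tendsto_of_tendsto_of_tendsto_of_le_of_le tendsto_const_nhds t
      (fun _ => zero_le) fun k => ?_
    have e : (fun x => (φ k x - Pi D (φ k) x) - (v - Pi D v) x)
        = (fun x => φ k x - v x) - fun x => Pi D (φ k) x - Pi D v x := by
      ext x; simp only [Pi.sub_apply]; ring
    simp only
    rw [e]
    exact eLpNorm_sub_le ((hφT k).sub hvT).1 ((hPs _).sub (hPs _)).1 (by norm_num)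
  have t1 := tendsto_eLpNorm_of_tendsto_sub (fun k => (hφT k).sub (hPs (φ k)))
    (hvT.sub (hPs v)) hs
  have t2 := tendsto_eLpNorm_of_tendsto_sub (fun k => hgs (φ k)) (hgs v) h4
  exact ⟨le_of_tendsto_of_tendsto' t1 (ENNReal.Tendsto.const_mul tg (Or.inr (by finiteness)))
      fun k => (hk k).1,
    le_of_tendsto_of_tendsto' t2 (ENNReal.Tendsto.const_mul tg (Or.inr (by finiteness)))
      fun k => (hk k).2⟩

end SobolevEstimates

/-! ### The properties of the Fortin operator -/

section FortinOperator

variable {n p : ℕ} {T : Affine.Simplex ℝ (E n) n} {B : Bases T p}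

theorem weakGrad_ae_gradient (T : Affine.Simplex ℝ (E n) n) {φ : E n → ℝ} (hφ : ContDiff ℝ ∞ φ) :
    weakGrad (elem T) φ =ᵐ[vol T] gradient φ :=
  (isWeakGrad_gradient T hφ).weakGrad_ae (isOpen_elem T)

theorem exists_Pi_estimates (hn : 1 ≤ n) (p : ℕ) (σ : ℝ) : ∃ C : ℝ, 0 < C ∧
    ∀ (T : Affine.Simplex ℝ (E n) n) (B : Bases T p) (D : DualBases B), ShapeRegular σ T →
      ∀ v : E n → ℝ, MemH1 (elem T) v →
        normL2 (vol T) (Pi D v) ≤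
          C * (normL2 (vol T) v + size T * normL2 (vol T) (weakGrad (elem T) v)) ∧
        normL2 (vol T) (weakGrad (elem T) (Pi D v)) ≤
          C * normL2 (vol T) (weakGrad (elem T) v) ∧
        normL2 (vol T) (v - Pi D v) ≤
          C * (size T * normL2 (vol T) (weakGrad (elem T) v)) := by
  obtain ⟨C, hC, h⟩ := exists_uniform_Pi_estimate hn p
  set c := C.toReal with hc
  have hc0 : 0 ≤ c := ENNReal.toReal_nonneg
  -- The 1 comes from ‖Πv‖ ≤ ‖v‖ + ‖v - Πv‖, and c |σ| bounds c h_T / r; the absolute value keeps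
  -- the constant positive for every real σ.
  refine ⟨1 + c + c * |σ|, by positivity, fun T B D ⟨x, r, hr, hx, hσ⟩ v hv => ?_⟩
  obtain ⟨h1, h2⟩ := h T B D x r hr hx v hv
  have hG : eLpNorm (weakGrad (elem T) v) 2 (vol T) ≠ ⊤ := hv.isWeakGrad.memLp_grad.2.ne
  have hs0 : 0 ≤ size T := Metric.diam_nonneg
  have hvT : MemLp v 2 (vol T) := hv.isWeakGrad.memLp_fun
  have hPT : MemLp (Pi D v) 2 (vol T) := memLp_vol T (contDiff_Pi D v).continuous
  set V := normL2 (vol T) v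
  set G := normL2 (vol T) (weakGrad (elem T) v) with hGdef
  have hV0 : 0 ≤ V := ENNReal.toReal_nonneg
  have hG0 : 0 ≤ G := ENNReal.toReal_nonneg
  have e1 : normL2 (vol T) (v - Pi D v) ≤ c * size T * G := by
    have := ENNReal.toReal_mono (by finiteness) h1
    rwa [ENNReal.toReal_mul, ENNReal.toReal_mul, ENNReal.toReal_ofReal hs0] at this
  have e2 : normL2 (vol T) (weakGrad (elem T) (Pi D v)) ≤ c * (size T / r) * G := by
    rw [normL2, eLpNorm_congr_ae (weakGrad_ae_gradient T (contDiff_Pi D v))]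
    have := ENNReal.toReal_mono (by finiteness) h2
    rwa [ENNReal.toReal_mul, ENNReal.toReal_mul, ENNReal.toReal_ofReal (by positivity)] at this
  have e3 : normL2 (vol T) (Pi D v) ≤ V + normL2 (vol T) (v - Pi D v) := by
    have := eLpNorm_sub_le hvT.1 (hvT.sub hPT).1 (p := 2) (by norm_num)
    rw [sub_sub_cancel] at this
    have := ENNReal.toReal_mono (ENNReal.add_ne_top.2 ⟨hvT.2.ne, (hvT.sub hPT).2.ne⟩) this
    rwa [ENNReal.toReal_add hvT.2.ne (hvT.sub hPT).2.ne] at this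
  have hr' : size T / r ≤ |σ| := (div_le_iff₀ hr).2 (hσ.trans (by gcongr; exact le_abs_self σ))
  have hcσ : 0 ≤ c * |σ| := by positivity
  have e4 : c * size T * G ≤ (1 + c + c * |σ|) * (size T * G) := by
    rw [mul_assoc]
    gcongr
    linarith
  refine ⟨?_, ?_, e1.trans e4⟩
  · have : V ≤ (1 + c + c * |σ|) * V := le_mul_of_one_le_left hV0 (by linarith)
    linarith
  · refine e2.trans ?_
    gcongr
    calc c * (size T / r) ≤ c * |σ| := by gcongr
      _ ≤ _ := by linarith

theorem exists_normAlpha_Pi_le (hn : 1 ≤ n) (p : ℕ) (σ K : ℝ) : ∃ C : ℝ, 0 < C ∧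
    ∀ (T : Affine.Simplex ℝ (E n) n) (B : Bases T p) (D : DualBases B), ShapeRegular σ T →
      ∀ α : ℝ, 0 < α → size T ≤ K * α → ∀ v : E n → ℝ, MemH1 (elem T) v →
        normAlpha T α (Pi D v) ≤ C * normAlpha T α v := by
  obtain ⟨C, hC, h⟩ := exists_Pi_estimates hn p σ
  -- From (V + K α G)² ≤ 2 V² + 2 K² α² G², with a further α² G² for the gradient term.
  refine ⟨C * Real.sqrt (2 + 2 * K ^ 2), by positivity, fun T B D hT α hα hK v hv => ?_⟩
  obtain ⟨h1, h2, -⟩ := h T B D hT v hv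
  have hs0 : 0 ≤ size T := Metric.diam_nonneg
  rw [normAlpha, normAlpha]
  set V := normL2 (vol T) v
  set G := normL2 (vol T) (weakGrad (elem T) v)
  have hP0 : 0 ≤ normL2 (vol T) (Pi D v) := ENNReal.toReal_nonneg
  have hQ0 : 0 ≤ normL2 (vol T) (weakGrad (elem T) (Pi D v)) := ENNReal.toReal_nonneg
  have hV0 : 0 ≤ V := ENNReal.toReal_nonneg
  have hG0 : 0 ≤ G := ENNReal.toReal_nonneg
  have a1 : normL2 (vol T) (Pi D v) ^ 2 ≤ C ^ 2 * (V + K * α * G) ^ 2 := by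
    rw [← mul_pow]
    refine pow_le_pow_left₀ hP0 (h1.trans ?_) 2
    gcongr
  have a2 : normL2 (vol T) (weakGrad (elem T) (Pi D v)) ^ 2 ≤ C ^ 2 * G ^ 2 := by
    rw [← mul_pow]
    exact pow_le_pow_left₀ hQ0 h2 2
  have a3 : (V + K * α * G) ^ 2 ≤ 2 * V ^ 2 + 2 * (K * α * G) ^ 2 := by
    linarith [sq_nonneg (V - K * α * G)]
  refine Real.sqrt_le_iff.2 ⟨by positivity, ?_⟩
  rw [mul_pow, mul_pow, Real.sq_sqrt (by positivity), Real.sq_sqrt (by positivity)]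
  calc normL2 (vol T) (Pi D v) ^ 2 + α ^ 2 * normL2 (vol T) (weakGrad (elem T) (Pi D v)) ^ 2
      ≤ C ^ 2 * (2 * V ^ 2 + 2 * (K * α * G) ^ 2) + α ^ 2 * (C ^ 2 * G ^ 2) := by
        gcongr
        exact a1.trans (by gcongr)
    _ = C ^ 2 * (2 * V ^ 2 + (1 + 2 * K ^ 2) * (α ^ 2 * G ^ 2)) := by ring
    _ ≤ C ^ 2 * ((2 + 2 * K ^ 2) * V ^ 2 + (2 + 2 * K ^ 2) * (α ^ 2 * G ^ 2)) := by
        gcongr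
        · linarith [sq_nonneg K]
        · linarith
    _ = _ := by ring

/-- The image minus c is a bubble function. Its moments are, up to sign, those of v - Πv and thus
vanish, so it is zero by `bubble_eq_zero`. -/
theorem Pi_eq_of_ae_eq_const (hn : 1 ≤ n) (D : DualBases B) {v : E n → ℝ} {c : ℝ}
    (h : ∀ᵐ x ∂vol T, v x = c) (x : E n) : Pi D v x = c := by
  have hcs : ContDiff ℝ ∞ fun _ : E n => c := contDiff_const
  have hv : MemH1 (elem T) v :=
    ⟨_, (isWeakGrad_gradient T hcs).congr (by filter_upwards [h] with x hx; exact hx.symm)⟩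
  have hm : ⨍ x, v x ∂vol T = c := by
    rw [average_congr (h : v =ᵐ[vol T] fun _ => c), average_const]
  have htr : trace T v =ᵐ[surf (bdry T)] fun _ => c := by
    have := ((isTrace_trace T hn hv).sub hn (isTrace_of_contDiff T hn hcs)).ae_eq_zero hn (by
      filter_upwards [h] with x hx; simp [hx])
    filter_upwards [this] with x hx
    simpa [sub_eq_zero] using hx
  have hb := Pi_sub_mean_mem D v
  rw [hm] at hb
  have := bubble_eq_zero hn hb (fun i q hq => ?_) fun q hq => ?_
  · have hx := congrFun this x
    simpa [sub_eq_zero] using hx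
  · rw [← neg_eq_zero, ← integral_neg, ← integral_face_sub_Pi hn D hv i hq]
    refine integral_congr_ae ?_
    filter_upwards [ae_mono (surf_face_le T i) htr] with x hx
    rw [hx]
    ring
  · rw [← neg_eq_zero, ← integral_neg, ← integral_elem_sub_Pi D hv.isWeakGrad.memLp_fun hq]
    refine integral_congr_ae ?_
    filter_upwards [h] with x hx
    rw [hx]
    ring

theorem integral_bdry_trace_sub_Pi (hn : 1 ≤ n) (D : DualBases B) {v τ : E n → ℝ}
    (hv : MemH1 (elem T) v) (hτ : FacewisePoly T p τ) :
    ∫ x, τ x * trace T (v - Pi D v) x ∂surf (bdry T) = 0 := by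
  have hH : MemH1 (elem T) (v - Pi D v) :=
    ⟨_, hv.isWeakGrad.sub (isWeakGrad_gradient T (contDiff_Pi D v))⟩
  have hint : ∀ i, Integrable (fun x => τ x * trace T (v - Pi D v) x) (surf (face T i)) := by
    intro i
    obtain ⟨P, hP, hae⟩ := hτ i
    have hPi : Integrable (fun x => P x * trace T (v - Pi D v) x) (surf (face T i)) :=
      (memLp_surf_face T hn i (continuous_of_mem_polyFun hP)).integrable_mul (q := 2)
        ((memLp_trace hn hH).mono_measure (surf_face_le T i))
    refine hPi.congr ?_
    filter_upwards [hae] with x hx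
    rw [hx]
  -- Faces overlap only in null sets, so the boundary integral splits into face integrals, on each
  -- of which `τ` is a single polynomial.
  rw [surf_bdry T hn, Measure.sum_fintype, integral_finsetSum_measure fun i _ => hint i]
  refine Finset.sum_eq_zero fun i _ => ?_
  obtain ⟨P, hP, hae⟩ := hτ i
  rw [← integral_face_sub_Pi hn D hv i hP]
  refine integral_congr_ae ?_
  filter_upwards [hae, ae_mono (surf_face_le T i) (trace_sub_ae hn hv (contDiff_Pi D v))]
    with x hx ht
  rw [hx, ht]

end FortinOperator

end Fortin

end

theorem theorem3p2 (n p : ℕ) (hn : 1 ≤ n) :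
    -- the dual functions exist for every choice of the bases
    (∀ (T : Affine.Simplex ℝ (Fortin.E n) n) (B : Fortin.Bases T p),
      Nonempty (Fortin.DualBases B)) ∧
    -- traces exist, the operator maps into the discrete space, and the moment conditions hold
    (∀ (T : Affine.Simplex ℝ (Fortin.E n) n) (B : Fortin.Bases T p) (D : Fortin.DualBases B)
      (v : Fortin.E n → ℝ), Fortin.MemH1 (Fortin.elem T) v →
        (∃ w, Fortin.IsTrace T v w) ∧
        Fortin.Pi D v ∈ B.space ∧
        Fortin.MemH1 (Fortin.elem T) (Fortin.Pi D v) ∧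
        (∀ τ, Fortin.FacewisePoly T p τ →
          ∫ x, τ x * Fortin.trace T (v - Fortin.Pi D v) x
            ∂Fortin.surf (Fortin.bdry T) = 0) ∧
        (∀ u ∈ Fortin.polyFun n p,
          ∫ x, u x * (v - Fortin.Pi D v) x ∂Fortin.vol T = 0)) ∧
    -- idempotency on the constants
    (∀ (T : Affine.Simplex ℝ (Fortin.E n) n) (B : Fortin.Bases T p) (D : Fortin.DualBases B)
      (v : Fortin.E n → ℝ) (c : ℝ), (∀ᵐ x ∂Fortin.vol T, v x = c) →
        ∀ x ∈ Fortin.elem T, Fortin.Pi D v x = c) ∧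
    -- the estimates, with a constant that depends only on `n`, `p` and the shape regularity
    (∀ σ : ℝ, ∃ C : ℝ, 0 < C ∧
      ∀ (T : Affine.Simplex ℝ (Fortin.E n) n) (B : Fortin.Bases T p) (D : Fortin.DualBases B),
        Fortin.ShapeRegular σ T →
        ∀ v : Fortin.E n → ℝ, Fortin.MemH1 (Fortin.elem T) v →
          Fortin.normL2 (Fortin.vol T) (Fortin.Pi D v) ≤
            C * (Fortin.normL2 (Fortin.vol T) v +
              Fortin.size T *
                Fortin.normL2 (Fortin.vol T) (Fortin.weakGrad (Fortin.elem T) v)) ∧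
          Fortin.normL2 (Fortin.vol T)
              (Fortin.weakGrad (Fortin.elem T) (Fortin.Pi D v)) ≤
            C * Fortin.normL2 (Fortin.vol T) (Fortin.weakGrad (Fortin.elem T) v) ∧
          Fortin.normL2 (Fortin.vol T) (v - Fortin.Pi D v) ≤
            C * (Fortin.size T *
              Fortin.normL2 (Fortin.vol T) (Fortin.weakGrad (Fortin.elem T) v))) ∧
    -- uniform boundedness in the `α`-weighted norm if the diameter is at most `K * α`
    (∀ σ K : ℝ, ∃ C : ℝ, 0 < C ∧
      ∀ (T : Affine.Simplex ℝ (Fortin.E n) n) (B : Fortin.Bases T p) (D : Fortin.DualBases B),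
        Fortin.ShapeRegular σ T →
        ∀ α : ℝ, 0 < α → Fortin.size T ≤ K * α →
        ∀ v : Fortin.E n → ℝ, Fortin.MemH1 (Fortin.elem T) v →
          Fortin.normAlpha T α (Fortin.Pi D v) ≤ C * Fortin.normAlpha T α v) := by
  refine ⟨fun T B => Fortin.nonempty_dualBases hn B, fun T B D v hv => ⟨?_, ?_, ?_, ?_, ?_⟩,
    fun T B D v c h x _ => Fortin.Pi_eq_of_ae_eq_const hn D h x,
    Fortin.exists_Pi_estimates hn p, Fortin.exists_normAlpha_Pi_le hn p⟩
  · exact Fortin.exists_isTrace T hn hv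
  · exact Fortin.Pi_mem_space D v
  · exact Fortin.memH1_of_contDiff T (Fortin.contDiff_Pi D v)
  · exact fun τ hτ => Fortin.integral_bdry_trace_sub_Pi hn D hv hτ
  · exact fun u hu => Fortin.integral_elem_sub_Pi D hv.isWeakGrad.memLp_fun hu
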